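/- Let $C$ (covariates), $A$ (treatment), $Z$ (mediator) and $Y$ (real-valued outcome) be observed discrete random variables with countable sets of values $\mathcal C,\mathcal A,\mathcal Z,\mathcal Y\subset\mathbb R$. Let $Z(a)$ and $Y(a,z)$ denote the potential mediators and potential outcomes, and $Y(a)=Y(a,Z(a))$. Let $p(\cdot)$ and $p(\cdot\mid\cdot)$ denote probability mass functions. Fix $a^*,a\in\mathcal A$. Consider the model of all joint laws of $(C,A,Z,Y,(Z(a))_a,(Y(a,z))_{a,z})$ that satisfy: consistency ($A=a$ implies $Y=Y(a)$ and $Z=Z(a)$, and $A=a,\,Z=z$ implies $Y=Y(a,z)$, almost surely); positivity ($p(Y(a),A,Z,C)>0$ at all values, for every $a$); the back-door assumption (BD): for all $a,a'\in\mathcal A$ and $z\in\mathcal Z$, $(Y(a),Y(a'))\perp A\mid C$ and $Y(a,z)\perp A\mid C$; the two-door assumption (TD): for all $a,a'\in\mathcal A$ and $z\in\mathcal Z$, $Y(a,z)=Y(a',z)$ almost surely, $Z(a')\perp A\mid C$, and $Y(a,z)\perp Z(a')\mid A,C$. Let the true law belong to this model, and let $\theta=EY(a^*)-EY(a)$, where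 both expectations exist and are finite. Define \begin{align*} \varphi_{bd}={}&\frac{I(A=a^*)}{p(a^*|C)}\big(Y-E(Y|a^*,C)\big)-\frac{I(A=a)}{p(a|C)}\big(Y-E(Y|a,C)\big)+E(Y|a^*,C)-E(Y|a,C)-\theta,\\ \varphi_{td}={}&\big(Y-E(Y|A,Z,C)\big)\frac{p(Z|a^*,C)-p(Z|a,C)}{p(Z|A,C)}\\ &+\Big(\sum_{\bar a}E(Y|\bar a,Z,C)p(\bar a|C)-\sum_{\bar a,z}E(Y|\bar a,z,C)p(z|A,C)p(\bar a|C)\Big)\frac{I(A=a^*)-I(A=a)}{p(A|C)}\\ &+\sum_z E(Y|A,z,C)\big(p(z|a^*,C)-p(z|a,C)\big)-\theta,\\ \varphi_{bd,td}={}&\big(Y-E(Y|Z,C)\big)\frac{p(Z|a^*,C)-p(Z|a,C)}{\sum_{\bar a}p(Z|\bar a,C)p(\bar a|C)}\\ &+\Big(E(Y|Z,C)-\sum_zE(Y|z,C)p(z|A,C)\Big)\frac{I(A=a^*)-I(A=a)}{p(A|C)}\\ &+\sum_zE(Y|z,C)\big(p(z|a^*,C)-p(z|a,C)\big)-\theta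 , \end{align*} and assume $E\varphi_{td}^2<\infty$ (automatic when the sets of values are finite). A regular submodel is a one-parameter family of laws in the model passing through the true law at $t=0$ whose observed-data log-likelihood is differentiable at $t=0$, with difference quotients at $0$ bounded uniformly over the sample space (automatic when the sets of values are finite); this derivative is its score $S$. The tangent space $\Lambda$ is the mean-square closure of the linear span of the scores. An influence function for $\theta$ is a square-integrable function $\varphi$ of $(C,A,Z,Y)$ such that $\theta$ is differentiable at $t=0$ along every regular submodel, with derivative $E(\varphi S)$. The efficient influence function is the $L^2$ projection of an influence function on $\Lambda$. The semiparametric efficiency bound is the supremum of the Cramér–Rao bounds $\theta'(0)^2/E(S^2)$ over the regular submodels with $E(S^2)>0$ (the supremum of the empty set being $0$). Then $Y\perp A\mid Z,C$, and the efficient influence function for $\theta$ is $\varphi_{bd,td}$. The function $\varphi_{td}$ is an influence function for $\theta$, and $\varphi_{bd,td}$ is its projection on $\Lambda$. Moreover $\Lambda$ is the tangent space of the factorization $p(c)p(a|c)p(z|a,c)p(y|z,c)$ with unrestricted factors, that is, the set of all sums $s_1(C)+s_2(A,C)+s_3(Z,A,C)+s_4(Y,Z,C)$ of square-integrable functions with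 $E s_1=0$, $E(s_2|C)=0$, $E(s_3|A,C)=0$ and $E(s_4|Z,C)=0$. The semiparametric efficiency bound for $\theta$ equals \begin{align*} \operatorname{var}\varphi_{bd,td}={}&\operatorname{var}\varphi_{td}\\ &+\sum_{z,c}\big(p(z|a^*,c)-p(z|a,c)\big)^2p(c)\operatorname{var}(Y|z,c)\bigg(\frac1{\sum_{\bar a}p(z|\bar a,c)p(\bar a|c)}-\sum_{\bar a}\frac{p(\bar a|c)}{p(z|\bar a,c)}\bigg), \end{align*} where the last sum is nonpositive and a summand whose factor $p(z|a^*,c)-p(z|a,c)$ or $\operatorname{var}(Y|z,c)$ vanishes is read as $0$. The bound is not larger than $\operatorname{var}\varphi_{td}$ or $\operatorname{var}\varphi_{bd}$ (the latter possibly $+\infty$). -/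

import Mathlib

open MeasureTheory ProbabilityTheory Filter Topology

namespace TwoDoor

noncomputable section

/-- Joint values of all observed and counterfactual variables
`(C, A, Z, Y, (Z(a))_a, (Y(a,z))_{a,z})`. A full-data law is a probability measure on this space. -/
abbrev FullData (𝒞 𝒜 𝒵 : Type*) (𝒴 : Set ℝ) :=
  𝒞 × 𝒜 × 𝒵 × 𝒴 × (𝒜 → 𝒵) × (𝒜 → 𝒵 → 𝒴)

/-- Values of the observed variables `(C, A, Z, Y)`. -/
abbrev Obs (𝒞 𝒜 𝒵 : Type*) (𝒴 : Set ℝ) := 𝒞 × 𝒜 × 𝒵 × 𝒴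

section Coordinates

variable {𝒞 𝒜 𝒵 : Type*} {𝒴 : Set ℝ}

/-- The covariate `C`. -/
def cov (x : Obs 𝒞 𝒜 𝒵 𝒴) : 𝒞 := x.1

/-- The treatment `A`. -/
def trt (x : Obs 𝒞 𝒜 𝒵 𝒴) : 𝒜 := x.2.1

/-- The mediator `Z`. -/
def med (x : Obs 𝒞 𝒜 𝒵 𝒴) : 𝒵 := x.2.2.1

/-- The outcome `Y`, as an element of its set of values. -/
def outV (x : Obs 𝒞 𝒜 𝒵 𝒴) : 𝒴 := x.2.2.2

/-- The outcome `Y`, as a real number. -/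
def out (x : Obs 𝒞 𝒜 𝒵 𝒴) : ℝ := (outV x : ℝ)

/-- The observed part `(C, A, Z, Y)` of the full data. -/
def obs (w : FullData 𝒞 𝒜 𝒵 𝒴) : Obs 𝒞 𝒜 𝒵 𝒴 := (w.1, w.2.1, w.2.2.1, w.2.2.2.1)

/-- The potential mediator `Z(a)`. -/
def zPot (a : 𝒜) (w : FullData 𝒞 𝒜 𝒵 𝒴) : 𝒵 := w.2.2.2.2.1 a

/-- The potential outcome `Y(a, z)`. -/
def yPotMed (a : 𝒜) (z : 𝒵) (w : FullData 𝒞 𝒜 𝒵 𝒴) : 𝒴 := w.2.2.2.2.2 a z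

/-- The potential outcome `Y(a) = Y(a, Z(a))`. -/
def yPot (a : 𝒜) (w : FullData 𝒞 𝒜 𝒵 𝒴) : 𝒴 := yPotMed a (zPot a w) w

end Coordinates

/-- Conditional independence `X ⊥ W | V` of discrete random variables:
`p(v) p(x, w, v) = p(x, v) p(w, v)` for all values. -/
def CondIndepDiscrete {Ω α β γ : Type*} [MeasurableSpace Ω] (μ : Measure Ω)
    (X : Ω → α) (W : Ω → β) (V : Ω → γ) : Prop :=
  ∀ x w v, μ.real {ω | V ω = v} * μ.real {ω | X ω = x ∧ W ω = w ∧ V ω = v} =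
    μ.real {ω | X ω = x ∧ V ω = v} * μ.real {ω | W ω = w ∧ V ω = v}

section Model

variable {𝒞 𝒜 𝒵 : Type*} {𝒴 : Set ℝ}
  [MeasurableSpace 𝒞] [MeasurableSpace 𝒜] [MeasurableSpace 𝒵]

/-- Law of the observed data. -/
def obsLaw (Q : Measure (FullData 𝒞 𝒜 𝒵 𝒴)) : Measure (Obs 𝒞 𝒜 𝒵 𝒴) := Q.map obs

/-- Consistency of observed and potential variables. -/
structure Consistency (Q : Measure (FullData 𝒞 𝒜 𝒵 𝒴)) : Prop where
  outcome : ∀ a, ∀ᵐ w ∂Q, trt (obs w) = a → outV (obs w) = yPot a w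
  mediator : ∀ a, ∀ᵐ w ∂Q, trt (obs w) = a → med (obs w) = zPot a w
  outcome_mediator : ∀ a z, ∀ᵐ w ∂Q,
    trt (obs w) = a → med (obs w) = z → outV (obs w) = yPotMed a z w

/-- Positivity: `p(Y(a), A, Z, C) > 0` for every `a`, at all values. -/
def Positivity (Q : Measure (FullData 𝒞 𝒜 𝒵 𝒴)) : Prop :=
  ∀ (a : 𝒜) (y : 𝒴) (a' : 𝒜) (z : 𝒵) (c : 𝒞),
    0 < Q.real {w | yPot a w = y ∧ trt (obs w) = a' ∧ med (obs w) = z ∧ cov (obs w) = c}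

/-- The back-door assumption (no unmeasured treatment-outcome confounding given `C`), for the
potential outcomes `Y(a)` and, since a mediator is present, for the potential outcomes
`Y(a, z)`. -/
structure BackDoor (Q : Measure (FullData 𝒞 𝒜 𝒵 𝒴)) : Prop where
  pair : ∀ a a' : 𝒜, CondIndepDiscrete Q (fun w => (yPot a w, yPot a' w))
    (fun w => trt (obs w)) (fun w => cov (obs w))
  mediated : ∀ (a : 𝒜) (z : 𝒵), CondIndepDiscrete Q (yPotMed a z)
    (fun w => trt (obs w)) (fun w => cov (obs w))

/-- The two-door assumption. -/
structure TwoDoorAssumption (Q : Measure (FullData 𝒞 𝒜 𝒵 𝒴)) : Prop where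
  no_direct_effect : ∀ (a a' : 𝒜) (z : 𝒵), ∀ᵐ w ∂Q, yPotMed a z w = yPotMed a' z w
  mediator_indep : ∀ a' : 𝒜, CondIndepDiscrete Q (zPot a')
    (fun w => trt (obs w)) (fun w => cov (obs w))
  outcome_indep : ∀ (a a' : 𝒜) (z : 𝒵), CondIndepDiscrete Q (yPotMed a z) (zPot a')
    (fun w => (trt (obs w), cov (obs w)))

/-- The semiparametric model: all full-data laws satisfying consistency, positivity, the back-door
assumption and the two-door assumption. -/
def backDoorTwoDoorModel (𝒞 𝒜 𝒵 : Type*) (𝒴 : Set ℝ)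
    [MeasurableSpace 𝒞] [MeasurableSpace 𝒜] [MeasurableSpace 𝒵] :
    Set (Measure (FullData 𝒞 𝒜 𝒵 𝒴)) :=
  {Q | IsProbabilityMeasure Q ∧ Consistency Q ∧ Positivity Q ∧ BackDoor Q ∧ TwoDoorAssumption Q}

/-- The average causal effect `θ = E Y(a*) - E Y(a)`. -/
def ace (aStar a : 𝒜) (Q : Measure (FullData 𝒞 𝒜 𝒵 𝒴)) : ℝ :=
  (∫ w, (yPot aStar w : ℝ) ∂Q) - ∫ w, (yPot a w : ℝ) ∂Q

/-! Semiparametric efficiency theory, for a model `M` (a set of full-data laws), the true law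
`Q₀` and a parameter `θ`. -/

/-- `Q` is a regular one-parameter submodel of `M` through `Q₀ = Q 0` with score `S`: the
observed-data log-likelihood is differentiable at `0` with derivative `S`, with difference quotients
bounded uniformly over the sample space. (On a finite sample space of positive
probabilities, the bound follows from differentiability.) -/
structure IsRegularSubmodel (M : Set (Measure (FullData 𝒞 𝒜 𝒵 𝒴)))
    (Q₀ : Measure (FullData 𝒞 𝒜 𝒵 𝒴)) (Q : ℝ → Measure (FullData 𝒞 𝒜 𝒵 𝒴))
    (S : Obs 𝒞 𝒜 𝒵 𝒴 → ℝ) : Prop where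
  base : Q 0 = Q₀
  mem : ∀ᶠ t in 𝓝 (0 : ℝ), Q t ∈ M
  score : ∀ x, HasDerivAt (fun t => Real.log ((obsLaw (Q t)).real {x})) (S x) 0
  bound : ∃ K : ℝ, ∀ᶠ t in 𝓝 (0 : ℝ), ∀ x,
    |Real.log ((obsLaw (Q t)).real {x}) - Real.log ((obsLaw (Q 0)).real {x})| ≤ K * |t|

/-- The scores of the regular submodels. -/
def scores (M : Set (Measure (FullData 𝒞 𝒜 𝒵 𝒴))) (Q₀ : Measure (FullData 𝒞 𝒜 𝒵 𝒴)) :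
    Set (Obs 𝒞 𝒜 𝒵 𝒴 → ℝ) :=
  {S | ∃ Q, IsRegularSubmodel M Q₀ Q S}

/-- The tangent space: the mean-square closure of the linear combinations of scores. -/
def tangentSpace (M : Set (Measure (FullData 𝒞 𝒜 𝒵 𝒴))) (Q₀ : Measure (FullData 𝒞 𝒜 𝒵 𝒴)) :
    Set (Obs 𝒞 𝒜 𝒵 𝒴 → ℝ) :=
  {f | MemLp f 2 (obsLaw Q₀) ∧
    ∀ ε > 0, ∃ s ∈ Submodule.span ℝ (scores M Q₀), ∫ x, (f x - s x) ^ 2 ∂(obsLaw Q₀) < ε}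

/-- `φ` is an influence function for `θ`: it is square integrable, and along every
regular submodel `θ` is differentiable with derivative `E(φ S)`. -/
def IsInfluenceFunction (M : Set (Measure (FullData 𝒞 𝒜 𝒵 𝒴)))
    (Q₀ : Measure (FullData 𝒞 𝒜 𝒵 𝒴)) (θ : Measure (FullData 𝒞 𝒜 𝒵 𝒴) → ℝ)
    (φ : Obs 𝒞 𝒜 𝒵 𝒴 → ℝ) : Prop :=
  MemLp φ 2 (obsLaw Q₀) ∧ ∀ Q S, IsRegularSubmodel M Q₀ Q S →
    HasDerivAt (fun t => θ (Q t)) (∫ x, φ x * S x ∂(obsLaw Q₀)) 0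

/-- `g` is the orthogonal projection in `L²(P)` of `f` onto the linear space `Λ`. -/
def IsProjection (P : Measure (Obs 𝒞 𝒜 𝒵 𝒴)) (Λ : Set (Obs 𝒞 𝒜 𝒵 𝒴 → ℝ))
    (f g : Obs 𝒞 𝒜 𝒵 𝒴 → ℝ) : Prop :=
  MemLp f 2 P ∧ g ∈ Λ ∧ ∀ h ∈ Λ, ∫ x, (f x - g x) * h x ∂P = 0

/-- The efficient influence function: the projection of an influence function on the tangent
space. -/
def IsEfficientInfluenceFunction (M : Set (Measure (FullData 𝒞 𝒜 𝒵 𝒴)))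
    (Q₀ : Measure (FullData 𝒞 𝒜 𝒵 𝒴)) (θ : Measure (FullData 𝒞 𝒜 𝒵 𝒴) → ℝ)
    (φ : Obs 𝒞 𝒜 𝒵 𝒴 → ℝ) : Prop :=
  ∃ ψ, IsInfluenceFunction M Q₀ θ ψ ∧ IsProjection (obsLaw Q₀) (tangentSpace M Q₀) ψ φ

/-- The semiparametric efficiency bound: the supremum of the Cramér-Rao bounds
`θ'(0)² / E S²` over the regular submodels with positive information. -/
def efficiencyBound (M : Set (Measure (FullData 𝒞 𝒜 𝒵 𝒴)))
    (Q₀ : Measure (FullData 𝒞 𝒜 𝒵 𝒴)) (θ : Measure (FullData 𝒞 𝒜 𝒵 𝒴) → ℝ) : ENNReal :=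
  sSup {b | ∃ Q S d, IsRegularSubmodel M Q₀ Q S ∧ HasDerivAt (fun t => θ (Q t)) d 0 ∧
    0 < ∫ x, S x ^ 2 ∂(obsLaw Q₀) ∧ b = ENNReal.ofReal (d ^ 2 / ∫ x, S x ^ 2 ∂(obsLaw Q₀))}

end Model

section Formulas

variable {𝒞 𝒜 𝒵 : Type*} {𝒴 : Set ℝ}
  [MeasurableSpace 𝒞] [MeasurableSpace 𝒜] [MeasurableSpace 𝒵] (P : Measure (Obs 𝒞 𝒜 𝒵 𝒴))

/-- `p(c)`. -/
def pC (c : 𝒞) : ℝ := P.real {x | cov x = c}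

/-- `p(a | c)`. -/
def pA (a : 𝒜) (c : 𝒞) : ℝ := (cond P {x | cov x = c}).real {x | trt x = a}

/-- `p(z | a, c)`. -/
def pZ (z : 𝒵) (a : 𝒜) (c : 𝒞) : ℝ :=
  (cond P {x | trt x = a ∧ cov x = c}).real {x | med x = z}

/-- `E(Y | a, c)`. -/
def meanAC (a : 𝒜) (c : 𝒞) : ℝ := ∫ x, out x ∂(cond P {x | trt x = a ∧ cov x = c})

/-- `E(Y | a, z, c)`. -/
def meanAZC (a : 𝒜) (z : 𝒵) (c : 𝒞) : ℝ :=
  ∫ x, out x ∂(cond P {x | trt x = a ∧ med x = z ∧ cov x = c})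

/-- `E(Y | z, c)`. -/
def meanZC (z : 𝒵) (c : 𝒞) : ℝ := ∫ x, out x ∂(cond P {x | med x = z ∧ cov x = c})

/-- `var(Y | z, c)`. -/
def varZC (z : 𝒵) (c : 𝒞) : ℝ := variance out (cond P {x | med x = z ∧ cov x = c})

/-- The indicator `I(A = a)`. -/
def ind (a : 𝒜) (x : Obs 𝒞 𝒜 𝒵 𝒴) : ℝ := Set.indicator {x | trt x = a} 1 x

/-- `φ_bd`, the efficient influence function under the back-door assumption. -/
def phiBD (aStar a : 𝒜) (θ : ℝ) (x : Obs 𝒞 𝒜 𝒵 𝒴) : ℝ :=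
  ind aStar x / pA P aStar (cov x) * (out x - meanAC P aStar (cov x))
    - ind a x / pA P a (cov x) * (out x - meanAC P a (cov x))
    + meanAC P aStar (cov x) - meanAC P a (cov x) - θ

/-- `φ_td`, the efficient influence function under the two-door assumption. -/
def phiTD (aStar a : 𝒜) (θ : ℝ) (x : Obs 𝒞 𝒜 𝒵 𝒴) : ℝ :=
  (out x - meanAZC P (trt x) (med x) (cov x)) *
      ((pZ P (med x) aStar (cov x) - pZ P (med x) a (cov x)) / pZ P (med x) (trt x) (cov x))
    + ((∑' b, meanAZC P b (med x) (cov x) * pA P b (cov x))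
        - ∑' (b) (z), meanAZC P b z (cov x) * pZ P z (trt x) (cov x) * pA P b (cov x)) *
      ((ind aStar x - ind a x) / pA P (trt x) (cov x))
    + (∑' z, meanAZC P (trt x) z (cov x) * (pZ P z aStar (cov x) - pZ P z a (cov x))) - θ

/-- `φ_{bd,td}`. -/
def phiBDTD (aStar a : 𝒜) (θ : ℝ) (x : Obs 𝒞 𝒜 𝒵 𝒴) : ℝ :=
  (out x - meanZC P (med x) (cov x)) *
      ((pZ P (med x) aStar (cov x) - pZ P (med x) a (cov x)) /
        ∑' b, pZ P (med x) b (cov x) * pA P b (cov x))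
    + (meanZC P (med x) (cov x) - ∑' z, meanZC P z (cov x) * pZ P z (trt x) (cov x)) *
      ((ind aStar x - ind a x) / pA P (trt x) (cov x))
    + (∑' z, meanZC P z (cov x) * (pZ P z aStar (cov x) - pZ P z a (cov x))) - θ

/-- The tangent space of the factorization `p(c) p(a|c) p(z|a,c) p(y|z,c)` with unrestricted
factors: sums of square-integrable scores of the four factors. -/
def factorTangentSpace : Set (Obs 𝒞 𝒜 𝒵 𝒴 → ℝ) :=
  {f | ∃ (s₁ : 𝒞 → ℝ) (s₂ : 𝒜 → 𝒞 → ℝ) (s₃ : 𝒵 → 𝒜 → 𝒞 → ℝ) (s₄ : 𝒴 → 𝒵 → 𝒞 → ℝ),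
    (∀ x, f x = s₁ (cov x) + s₂ (trt x) (cov x) + s₃ (med x) (trt x) (cov x)
      + s₄ (outV x) (med x) (cov x)) ∧
    MemLp (fun x => s₁ (cov x)) 2 P ∧
    MemLp (fun x => s₂ (trt x) (cov x)) 2 P ∧
    MemLp (fun x => s₃ (med x) (trt x) (cov x)) 2 P ∧
    MemLp (fun x => s₄ (outV x) (med x) (cov x)) 2 P ∧
    (∫ x, s₁ (cov x) ∂P = 0) ∧
    (∀ c, ∫ x, s₂ (trt x) c ∂(cond P {x | cov x = c}) = 0) ∧
    (∀ a c, ∫ x, s₃ (med x) a c ∂(cond P {x | trt x = a ∧ cov x = c}) = 0) ∧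
    (∀ z c, ∫ x, s₄ (outV x) z c ∂(cond P {x | med x = z ∧ cov x = c}) = 0)}

/-- The correction
`∑_{z,c} (p(z|a*,c)-p(z|a,c))² p(c) var(Y|z,c) (1 / ∑_b p(z|b,c)p(b|c) - ∑_b p(b|c)/p(z|b,c))`. -/
def varCorrection (aStar a : 𝒜) : ℝ :=
  ∑' zc : 𝒵 × 𝒞, (pZ P zc.1 aStar zc.2 - pZ P zc.1 a zc.2) ^ 2 * pC P zc.2 * varZC P zc.1 zc.2 *
    (1 / (∑' b, pZ P zc.1 b zc.2 * pA P b zc.2) - ∑' b, pA P b zc.2 / pZ P zc.1 b zc.2)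

end Formulas

end

end TwoDoor

open TwoDoor

/-! The observed law is the only thing that matters, and the model restricts it by a single
condition. By (TD), given A and C, Y(a,z) is independent of Z(a) and does not depend on a; by (BD)
it is independent of A given C. With consistency this gives p(y|a,z,c) = p(y|z,c), i.e. Y ⊥ A | Z, C
(`condIndep_outcome_treatment`). Conversely, every positive law p(c,a)p(z|a,c)p(y|z,c) is realized
in the model by independent tables of potential mediators indexed by (a,c) and potential outcomes
indexed by (z,c) (`canonicalLaw_mem`, `obsLaw_canonicalLaw_real`).

Tangent space. A square-integrable mean-zero f is a sum of scores of the four factors exactly when f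
- E(f|A,Z,C) is a function of (Y,Z,C) (`mem_factorTangentSpace_iff`). This criterion is stable under
mean-square limits, and scores satisfy it because log p(y|a,z,c) does not involve a along a
submodel. In the other direction, bounded elements are scores of paths that tilt each factor by 1 +
ts, and truncation followed by recentring shows that they are dense (`tangentSpace_eq`).

Influence functions. Let R = Y - E(Y|Z,C). The functions φ_bd, φ_td and φ_{bd,td} all have the form
Rw + M + T - θ with the same mediator part M and covariate part T; only the weight w, a function of
(A,Z,C), changes. The weight of φ_{bd,td} is the conditional mean given (Y,Z,C) of each of the other
two. Hence passing to it changes the function by something with conditional mean zero both given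
(A,Z,C) and given (Y,Z,C), which is orthogonal to the tangent space
(`integral_residual_mul_sub_eq_zero`). The weight of φ_{bd,td} depends on (Z,C) alone, so φ_{bd,td}
itself lies in the tangent space.

That θ has derivative E(φ_bd S) follows by differentiating E Y(a) = E(Y I(A=a)/p(a|C))
(`hasDerivAt_ace`); scores are bounded, so this needs no second moment of φ_bd. The bound follows
from Cauchy–Schwarz and the density of scores (`efficiencyBound_eq`). The variance formula is
Pythagoras, with the two mean squares of Rw summed over the cells of (Z,C) and of (A,Z,C). -/

namespace TwoDoor

noncomputable section

set_option linter.unusedSectionVars false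

/-! ### Conditional means on a discrete space with positive atoms. -/

section FiberMean

variable {X : Type*} [MeasurableSpace X] [DiscreteMeasurableSpace X]
  {P : Measure X} [IsProbabilityMeasure P]

theorem aestronglyMeasurable_discrete {X : Type*} [MeasurableSpace X] [DiscreteMeasurableSpace X] {P : Measure X}
    (f : X → ℝ) : AEStronglyMeasurable f P :=
  (Measurable.of_discrete (f := f)).aestronglyMeasurable

/-- The mean of `f` given `V = v`. -/
def fiberMean {γ : Type*} (P : Measure X) (V : X → γ) (f : X → ℝ) (v : γ) : ℝ :=
  ∫ x, f x ∂(ProbabilityTheory.cond P {x | V x = v})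

variable {γ δ : Type*}

theorem fiberMean_eq (V : X → γ) (f : X → ℝ) (v : γ) :
    fiberMean P V f v = (P.real {x | V x = v})⁻¹ * ∫ x in {x | V x = v}, f x ∂P := by
  simp [fiberMean, ProbabilityTheory.cond, integral_smul_measure, Measure.real]

theorem fiberMean_congr {V : X → γ} {f g : X → ℝ} {v : γ} (h : ∀ x, V x = v → f x = g x) :
    fiberMean P V f v = fiberMean P V g v := by
  rw [fiberMean_eq, fiberMean_eq, setIntegral_congr_fun (s := {x | V x = v}) MeasurableSet.of_discrete fun x hx => h x hx]

theorem fiber_pos (hpos : ∀ x, 0 < P.real {x}) (V : X → γ) (x : X) :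
    0 < P.real {y | V y = V x} :=
  (hpos x).trans_le (measureReal_mono (by simp))

theorem fiberMean_const_of (hpos : ∀ x, 0 < P.real {x}) {V : X → γ} {f : X → ℝ} {k : ℝ} (x : X)
    (h : ∀ y, V y = V x → f y = k) : fiberMean P V f (V x) = k := by
  rw [fiberMean_congr (g := fun _ => k) h, fiberMean_eq]
  have := fiber_pos hpos V x
  simp [this.ne']

theorem integrable_cond (V : X → γ) (v : γ) {f : X → ℝ} (hf : Integrable f P) :
    Integrable f (ProbabilityTheory.cond P {x | V x = v}) := by
  by_cases h : P {x | V x = v} = 0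
  · simp [ProbabilityTheory.cond, Measure.restrict_eq_zero.2 h]
  · exact hf.restrict.smul_measure (ENNReal.inv_ne_top.2 h)

theorem integrable_cond_congr {V : X → γ} {v : γ} {f g : X → ℝ} (h : ∀ x, V x = v → f x = g x)
    (hf : Integrable f (ProbabilityTheory.cond P {x | V x = v})) : Integrable g (ProbabilityTheory.cond P {x | V x = v}) := by
  refine hf.congr ?_
  filter_upwards [ae_cond_mem (μ := P) (s := {x | V x = v}) MeasurableSet.of_discrete] with x hx
  exact h x hx

theorem fiberMean_const_mul (V : X → γ) (f : X → ℝ) (k : ℝ) (v : γ) :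
    fiberMean P V (fun x => k * f x) v = k * fiberMean P V f v := integral_const_mul _ _

theorem fiberMean_mul_of {V : X → γ} {f g : X → ℝ} {v : γ} {k : ℝ} (h : ∀ x, V x = v → g x = k) :
    fiberMean P V (fun x => f x * g x) v = fiberMean P V f v * k := by
  rw [mul_comm, ← fiberMean_const_mul]
  exact fiberMean_congr fun x hx => by rw [h x hx, mul_comm]

theorem fiberMean_add {V : X → γ} {f g : X → ℝ} {v : γ} (hf : Integrable f P)
    (hg : Integrable g P) :
    fiberMean P V (fun x => f x + g x) v = fiberMean P V f v + fiberMean P V g v :=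
  integral_add (integrable_cond V v hf) (integrable_cond V v hg)

theorem fiberMean_sub {V : X → γ} {f g : X → ℝ} {v : γ} (hf : Integrable f P)
    (hg : Integrable g P) :
    fiberMean P V (fun x => f x - g x) v = fiberMean P V f v - fiberMean P V g v :=
  integral_sub (integrable_cond V v hf) (integrable_cond V v hg)

theorem measureReal_mul_fiberMean (V : X → γ) (f : X → ℝ) (v : γ) :
    P.real {x | V x = v} * fiberMean P V f v = ∫ x in {x | V x = v}, f x ∂P := by
  rw [fiberMean_eq]
  by_cases h : P.real {x | V x = v} = 0
  · have : P {x | V x = v} = 0 := by simpa [Measure.real, ENNReal.toReal_eq_zero_iff] using h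
    simp [h, Measure.restrict_eq_zero.2 this]
  · rw [mul_inv_cancel_left₀ h]

theorem hasSum_fiberMean [Countable γ] (V : X → γ) {f : X → ℝ} (hf : Integrable f P) :
    HasSum (fun v => P.real {x | V x = v} * fiberMean P V f v) (∫ x, f x ∂P) := by
  simp_rw [measureReal_mul_fiberMean]
  have hU : (⋃ v, {x | V x = v}) = Set.univ := by ext x; simp
  have := hasSum_integral_iUnion (μ := P) (f := f) (s := fun v => {x | V x = v})
    (fun _ => MeasurableSet.of_discrete)
    (fun v w hvw => Set.disjoint_left.2 fun x hx hx' => hvw (hx.symm.trans hx'))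
    (by rw [hU]; exact hf.integrableOn)
  rwa [hU, setIntegral_univ] at this

theorem hasSum_measureReal_fiber [Countable γ] (V : X → γ) (s : Set X) :
    HasSum (fun v => P.real {x | V x = v ∧ x ∈ s}) (P.real s) := by
  have := hasSum_fiberMean (P := P) V (f := s.indicator 1)
    ((integrable_const (1 : ℝ)).indicator MeasurableSet.of_discrete)
  rw [integral_indicator_one MeasurableSet.of_discrete] at this
  convert this using 2 with v
  rw [measureReal_mul_fiberMean, setIntegral_indicator MeasurableSet.of_discrete]
  simp [Set.inter_def]

/-- The sigma-algebra generated by `V`. -/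
abbrev sigmaOf (V : X → γ) : MeasurableSpace X := MeasurableSpace.comap V ⊤

theorem sigmaOf_le (V : X → γ) : sigmaOf V ≤ (inferInstance : MeasurableSpace X) :=
  fun _ _ => MeasurableSet.of_discrete

/-- The level set of g through y is the preimage under V of some set, so it contains the whole fibre
of V. This holds everywhere, not just almost everywhere. -/
theorem factorsThrough_of_stronglyMeasurable {V : X → γ} {g : X → ℝ}
    (hg : StronglyMeasurable[sigmaOf V] g) : g.FactorsThrough V := by
  intro x y hxy
  obtain ⟨s, -, hs⟩ := hg.measurable (measurableSet_singleton (g y))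
  have hy : y ∈ V ⁻¹' s := by rw [hs]; simp
  have hx : x ∈ V ⁻¹' s := by simpa [hxy] using hy
  rw [hs] at hx
  exact hx

/-- The equality is pointwise because every fibre has positive mass and the conditional expectation
is constant on it. It gives elementary conditional means the integrability, the L² bound and the
tower property of `condExp`. -/
theorem condExp_eq_fiberMean (hpos : ∀ x, 0 < P.real {x}) (V : X → γ) {f : X → ℝ}
    (hf : Integrable f P) : P[f|sigmaOf V] = fun x => fiberMean P V f (V x) := by
  funext x
  have h1 : ∫ y in {y | V y = V x}, (P[f|sigmaOf V]) y ∂P = ∫ y in {y | V y = V x}, f y ∂P :=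
    setIntegral_condExp (sigmaOf_le V) hf ⟨{V x}, trivial, rfl⟩
  have h2 := factorsThrough_of_stronglyMeasurable
    (stronglyMeasurable_condExp (m := sigmaOf V) (f := f) (μ := P))
  have h3 : fiberMean P V (P[f|sigmaOf V]) (V x) = (P[f|sigmaOf V]) x :=
    fiberMean_const_of hpos x fun y hy => h2 hy
  rw [fiberMean_eq, ← h1, ← fiberMean_eq, h3]

theorem integrable_fiberMean (hpos : ∀ x, 0 < P.real {x}) (V : X → γ) {f : X → ℝ}
    (hf : Integrable f P) : Integrable (fun x => fiberMean P V f (V x)) P := by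
  rw [← condExp_eq_fiberMean hpos V hf]
  exact integrable_condExp

theorem memLp_fiberMean (hpos : ∀ x, 0 < P.real {x}) (V : X → γ) {f : X → ℝ}
    (hf : MemLp f 2 P) : MemLp (fun x => fiberMean P V f (V x)) 2 P := by
  rw [← condExp_eq_fiberMean hpos V (hf.integrable (by norm_num))]
  exact hf.condExp (by norm_num)

theorem abs_fiberMean_le {V : X → γ} {f : X → ℝ} {K : ℝ} (hK : 0 ≤ K) (hf : ∀ x, |f x| ≤ K)
    (v : γ) : |fiberMean P V f v| ≤ K := by
  unfold fiberMean
  by_cases h : P {x | V x = v} = 0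
  · simp [ProbabilityTheory.cond, Measure.restrict_eq_zero.2 h, hK]
  · have := cond_isProbabilityMeasure h
    simpa using norm_integral_le_of_norm_le_const (μ := ProbabilityTheory.cond P {x | V x = v}) (f := f) (C := K)
      (ae_of_all _ hf)

theorem integral_fiberMean (hpos : ∀ x, 0 < P.real {x}) (V : X → γ) {f : X → ℝ}
    (hf : Integrable f P) : ∫ x, fiberMean P V f (V x) ∂P = ∫ x, f x ∂P := by
  rw [← condExp_eq_fiberMean hpos V hf]
  exact integral_condExp (sigmaOf_le V)

theorem integral_fiberMean_mul (hpos : ∀ x, 0 < P.real {x}) {V : X → γ} {f g : X → ℝ}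
    (hfg : Integrable (fun x => f x * g x) P) (hg : g.FactorsThrough V) :
    ∫ x, fiberMean P V f (V x) * g x ∂P = ∫ x, f x * g x ∂P := by
  rw [← integral_fiberMean hpos V hfg]
  congr 1; funext x
  exact (fiberMean_mul_of fun y hy => hg hy).symm

/-- The source of all orthogonality relations below. Only the product has to be integrable, so it
applies to L² pairings and to integrable functions paired with bounded ones. -/
theorem integral_mul_eq_zero (hpos : ∀ x, 0 < P.real {x}) {V : X → γ} {f g : X → ℝ}
    (hfg : Integrable (fun x => f x * g x) P) (hg : g.FactorsThrough V)
    (hV : ∀ x, fiberMean P V f (V x) = 0) : ∫ x, f x * g x ∂P = 0 := by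
  rw [← integral_fiberMean hpos V hfg]
  simp_rw [fun x => fiberMean_mul_of (P := P) (V := V) (f := f) (g := g) (v := V x) (k := g x)
    fun y hy => hg hy]
  simp [hV]

theorem fiberMean_fiberMean (hpos : ∀ x, 0 < P.real {x}) (V : X → γ) (W : X → δ) (F : γ → δ)
    (hF : ∀ x, W x = F (V x)) {f : X → ℝ} (hf : Integrable f P) (x : X) :
    fiberMean P W (fun y => fiberMean P V f (V y)) (W x) = fiberMean P W f (W x) := by
  rw [fiberMean_eq, fiberMean_eq, ← condExp_eq_fiberMean hpos V hf]
  congr 1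
  refine setIntegral_condExp (sigmaOf_le V) hf ⟨{v | F v = W x}, trivial, ?_⟩
  ext y; simp [hF]

/-- The conditional mean is self-adjoint. -/
theorem integral_mul_fiberMean_comm (hpos : ∀ x, 0 < P.real {x}) (V : X → γ) {f g : X → ℝ} {K : ℝ}
    (hf : Integrable f P) (hK : 0 ≤ K) (hg : ∀ x, |g x| ≤ K) :
    ∫ x, f x * fiberMean P V g (V x) ∂P = ∫ x, fiberMean P V f (V x) * g x ∂P := by
  have hgi : Integrable g P := Integrable.of_bound (aestronglyMeasurable_discrete _) K (ae_of_all _ hg)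
  rw [← integral_fiberMean_mul hpos (V := V)]
  · simp_rw [mul_comm (fiberMean P V f _)]
    rw [integral_fiberMean_mul hpos (V := V)]
    · exact (integrable_fiberMean hpos V hf).bdd_mul (c := K) (aestronglyMeasurable_discrete _) (ae_of_all _ hg)
    · intro x y h; simp only [h]
  · exact hf.mul_bdd (c := K) (aestronglyMeasurable_discrete _) (ae_of_all _ fun x => abs_fiberMean_le hK hg _)
  · intro x y h; simp only [h]

theorem memLp_of_bdd {g : X → ℝ} {K : ℝ} (hg : ∀ x, |g x| ≤ K) : MemLp g 2 P :=
  MemLp.of_bound (aestronglyMeasurable_discrete _) K (ae_of_all _ hg)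

/-- Bounded functions with vanishing conditional mean, obtained by truncating and recentring `s`,
approximate `s` in mean square. -/
theorem exists_bounded_approx (hpos : ∀ x, 0 < P.real {x}) (V : X → γ) {s : X → ℝ}
    (hs : MemLp s 2 P) (hV : ∀ x, fiberMean P V s (V x) = 0) {ε : ℝ} (hε : 0 < ε) :
    ∃ (n : ℝ) (h : γ → ℝ), 0 ≤ n ∧
      (∀ x, |(if |s x| ≤ n then s x else 0) - h (V x)| ≤ 2 * n) ∧
      (∀ x, fiberMean P V (fun y => (if |s y| ≤ n then s y else 0) - h (V y)) (V x) = 0) ∧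
      ∫ x, (s x - ((if |s x| ≤ n then s x else 0) - h (V x))) ^ 2 ∂P < ε := by
  let τ : ℕ → X → ℝ := fun n x => if |s x| ≤ n then s x else 0
  have hτle : ∀ n x, |τ n x| ≤ n := by
    intro n x; simp only [τ]; split_ifs with h
    · exact h
    · simp
  -- The truncation error is dominated by s² and vanishes at x as soon as n ≥ |s x|.
  have hlim : Tendsto (fun n => ∫ x, (s x - τ n x) ^ 2 ∂P) atTop (𝓝 (∫ _, (0 : ℝ) ∂P)) := by
    refine tendsto_integral_of_dominated_convergence (fun x => s x ^ 2)
      (fun n => aestronglyMeasurable_discrete _) hs.integrable_sq (fun n => ae_of_all _ fun x => ?_)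
      (ae_of_all _ fun x => ?_)
    · simp only [τ]; split_ifs <;> simp [sq_nonneg]
    · refine tendsto_const_nhds.congr' ?_
      filter_upwards [eventually_ge_atTop ⌈|s x|⌉₊] with n hn
      have : |s x| ≤ n := (Nat.le_ceil _).trans (by exact_mod_cast hn)
      simp [τ, this]
  rw [integral_zero] at hlim
  obtain ⟨n, hn⟩ := (hlim.eventually (gt_mem_nhds (show (0 : ℝ) < ε / 4 by positivity))).exists
  have hτ2 : MemLp (τ n) 2 P := memLp_of_bdd (hτle n)
  have hτi : Integrable (τ n) P := hτ2.integrable (by norm_num)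
  have hsi : Integrable s P := hs.integrable (by norm_num)
  refine ⟨n, fiberMean P V (τ n), by positivity, fun x => ?_, fun x => ?_, ?_⟩
  · have h1 := hτle n x
    have h2 := abs_fiberMean_le (P := P) (V := V) (Nat.cast_nonneg n) (hτle n) (V x)
    calc _ ≤ |τ n x| + |fiberMean P V (τ n) (V x)| := abs_sub _ _
      _ ≤ _ := by linarith
  · change fiberMean P V (fun y => τ n y - fiberMean P V (τ n) (V y)) (V x) = 0
    rw [fiberMean_sub hτi (integrable_fiberMean hpos V hτi),
      fiberMean_fiberMean hpos V V id (fun _ => rfl) hτi, sub_self]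
  · change ∫ x, (s x - (τ n x - fiberMean P V (τ n) (V x))) ^ 2 ∂P < ε
    let r : X → ℝ := fun x => s x - τ n x
    have hr : MemLp r 2 P := hs.sub hτ2
    have hri : Integrable r P := hr.integrable (by norm_num)
    have hEr := memLp_fiberMean hpos V hr
    -- As E(s|V) = 0, the error after recentring is r - E(r|V), the residual of a projection, whose
    -- norm is at most that of r.
    have e : ∀ x, s x - (τ n x - fiberMean P V (τ n) (V x)) = r x - fiberMean P V r (V x) := by
      intro x
      simp only [r]
      rw [fiberMean_sub hsi hτi, hV]; ring
    simp_rw [e]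
    have h1 : ∫ x, (fiberMean P V r (V x)) ^ 2 ∂P = ∫ x, r x * fiberMean P V r (V x) ∂P := by
      rw [← integral_fiberMean_mul hpos (V := V) (hr.integrable_mul hEr)
        (fun x y h => by simp only [h])]
      simp_rw [sq]
    have h2 : 0 ≤ ∫ x, (fiberMean P V r (V x)) ^ 2 ∂P := integral_nonneg fun _ => sq_nonneg _
    have h3 : ∫ x, (r x - fiberMean P V r (V x)) ^ 2 ∂P
        = ∫ x, r x ^ 2 ∂P - 2 * ∫ x, r x * fiberMean P V r (V x) ∂P
          + ∫ x, (fiberMean P V r (V x)) ^ 2 ∂P := by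
      have hi : Integrable (fun x => r x * fiberMean P V r (V x)) P := hr.integrable_mul hEr
      rw [← integral_const_mul, ← integral_sub hr.integrable_sq (hi.const_mul 2)]
      have hj : Integrable (fun x => r x ^ 2 - 2 * (r x * fiberMean P V r (V x))) P :=
        hr.integrable_sq.sub (hi.const_mul 2)
      rw [← integral_add hj hEr.integrable_sq]
      congr 1; funext x; ring
    rw [h3, ← h1]
    have : ∫ x, r x ^ 2 ∂P < ε / 4 := hn
    linarith

end FiberMean

/-- Differentiation under the integral for weights near `1`. -/
theorem hasDerivAt_integral_weight {X : Type*} [MeasurableSpace X] [DiscreteMeasurableSpace X]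
    {P : Measure X} {G S : X → ℝ} {w : ℝ → X → ℝ} {K : ℝ} (hG : Integrable G P)
    (h0 : ∀ x, w 0 x = 1) (hw : ∀ᶠ t in 𝓝 (0 : ℝ), ∀ x, |w t x - 1| ≤ K * |t|)
    (hd : ∀ x, HasDerivAt (fun t => w t x) (S x) 0) :
    HasDerivAt (fun t => ∫ x, G x * w t x ∂P) (∫ x, G x * S x ∂P) 0 := by
  rw [hasDerivAt_iff_tendsto_slope]
  have key : Tendsto (fun t => ∫ x, G x * slope (fun t => w t x) 0 t ∂P) (𝓝[≠] 0)
      (𝓝 (∫ x, G x * S x ∂P)) := by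
    -- The difference quotients of the weights are bounded by K uniformly in x, so |G| K dominates.
    refine tendsto_integral_filter_of_dominated_convergence (fun x => |G x| * K)
      (Eventually.of_forall fun t => hG.aestronglyMeasurable.mul (aestronglyMeasurable_discrete _)) ?_
      (hG.abs.mul_const K) (ae_of_all _ fun x => ?_)
    · filter_upwards [nhdsWithin_le_nhds hw, self_mem_nhdsWithin] with t ht ht0
      refine ae_of_all _ fun x => ?_
      rw [norm_mul, Real.norm_eq_abs]
      refine mul_le_mul_of_nonneg_left ?_ (abs_nonneg _)
      have htp : 0 < |t| := abs_pos.2 ht0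
      rw [slope_def_field, Real.norm_eq_abs, abs_div, sub_zero, h0, div_le_iff₀ htp]
      exact ht x
    · exact ((hasDerivAt_iff_tendsto_slope.1 (hd x))).const_mul _
  refine key.congr' ?_
  filter_upwards [nhdsWithin_le_nhds hw, self_mem_nhdsWithin] with t ht ht0
  have hi : Integrable (fun x => G x * w t x) P := by
    refine hG.mul_bdd (c := 1 + K * |t|) (aestronglyMeasurable_discrete _) (ae_of_all _ fun x => ?_)
    have := ht x
    rw [Real.norm_eq_abs]
    calc |w t x| = |1 + (w t x - 1)| := by congr 1; ring
      _ ≤ |1| + |w t x - 1| := abs_add_le _ _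
      _ ≤ _ := by simp; exact this
  simp only [slope_def_field, h0, sub_zero, mul_one]
  rw [← integral_sub hi hG, ← integral_div]
  congr 1; funext x; ring

/-! ### What the causal assumptions say about the observed law. -/

section ModelFacts

variable {𝒞 𝒜 𝒵 : Type*} {𝒴 : Set ℝ}
  [Countable 𝒞] [Countable 𝒜] [Countable 𝒵] [Countable 𝒴]
  [MeasurableSpace 𝒞] [MeasurableSpace 𝒜] [MeasurableSpace 𝒵]
  [DiscreteMeasurableSpace 𝒞] [DiscreteMeasurableSpace 𝒜] [DiscreteMeasurableSpace 𝒵]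

theorem measurable_obs : Measurable (obs : FullData 𝒞 𝒜 𝒵 𝒴 → Obs 𝒞 𝒜 𝒵 𝒴) := by
  unfold obs; fun_prop

theorem measurable_zPot (a : 𝒜) : Measurable (zPot a : FullData 𝒞 𝒜 𝒵 𝒴 → 𝒵) := by
  unfold zPot; fun_prop

theorem measurable_yPotMed (a : 𝒜) (z : 𝒵) :
    Measurable (yPotMed a z : FullData 𝒞 𝒜 𝒵 𝒴 → 𝒴) := by
  unfold yPotMed; fun_prop

/-- Evaluating a countable family of measurable maps at a measurable index is measurable. -/
theorem measurable_apply_countable {Ω ι β : Type*} [MeasurableSpace Ω] [MeasurableSpace β]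
    [Countable ι] [MeasurableSpace ι] [DiscreteMeasurableSpace ι] {g : Ω → ι} {F : ι → Ω → β}
    (hg : Measurable g) (hF : ∀ i, Measurable (F i)) : Measurable fun w => F (g w) w :=
  (measurable_from_prod_countable_left (f := fun p : Ω × ι => F p.2 p.1) hF).comp
    (measurable_id.prodMk hg)

theorem measurable_yPot (a : 𝒜) : Measurable (yPot a : FullData 𝒞 𝒜 𝒵 𝒴 → 𝒴) :=
  measurable_apply_countable (F := fun z => yPotMed a z) (measurable_zPot a) (measurable_yPotMed a)

variable {Q : Measure (FullData 𝒞 𝒜 𝒵 𝒴)}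

theorem obsLaw_real (Q : Measure (FullData 𝒞 𝒜 𝒵 𝒴)) (s : Set (Obs 𝒞 𝒜 𝒵 𝒴)) :
    (obsLaw Q).real s = Q.real {w | obs w ∈ s} :=
  map_measureReal_apply measurable_obs MeasurableSet.of_discrete

theorem isProbabilityMeasure_obsLaw (hQ : Q ∈ backDoorTwoDoorModel 𝒞 𝒜 𝒵 𝒴) :
    IsProbabilityMeasure (obsLaw Q) := by
  have := hQ.1
  exact Measure.isProbabilityMeasure_map measurable_obs.aemeasurable

/-- On {A = a} consistency replaces Y(a) by Y, so positivity taken at the potential outcome of the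
received treatment is positivity of the observed atoms. -/
theorem obsLaw_pos (hQ : Q ∈ backDoorTwoDoorModel 𝒞 𝒜 𝒵 𝒴) (x : Obs 𝒞 𝒜 𝒵 𝒴) :
    0 < (obsLaw Q).real {x} := by
  obtain ⟨hp, hc, hpos, -⟩ := hQ
  rw [obsLaw_real]
  refine (hpos (trt x) (outV x) (trt x) (med x) (cov x)).trans_le (le_of_eq ?_)
  refine measureReal_congr ?_
  filter_upwards [hc.outcome (trt x)] with w hw
  refine propext ⟨fun ⟨h1, h2, h3, h4⟩ => ?_, fun h => ?_⟩
  · exact Prod.ext h4 (Prod.ext h2 (Prod.ext h3 ((hw h2).trans h1)))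
  · have h : obs w = x := h
    have h2 : trt (obs w) = trt x := by rw [h]
    exact ⟨by rw [← hw h2, h], h2, by rw [h], by rw [h]⟩

/-- The observed outcome factorizes through a conditional law given mediator and covariate. -/
theorem exists_outcome_factor (hQ : Q ∈ backDoorTwoDoorModel 𝒞 𝒜 𝒵 𝒴) (y : 𝒴) (z : 𝒵) (c : 𝒞) :
    ∃ g : ℝ, ∀ b, (obsLaw Q).real {x | cov x = c} *
        (obsLaw Q).real {x | outV x = y ∧ trt x = b ∧ med x = z ∧ cov x = c} =
      g * (obsLaw Q).real {x | trt x = b ∧ med x = z ∧ cov x = c} := by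
  have hpos := obsLaw_pos hQ
  have hprob := isProbabilityMeasure_obsLaw hQ
  obtain ⟨hp, hc, -, hbd, htd⟩ := hQ
  rcases isEmpty_or_nonempty 𝒜 with hA | ⟨⟨b₀⟩⟩
  · exact ⟨0, fun b => hA.elim b⟩
  -- The factor is P(Y(b₀,z) = y, C = c) for an arbitrary reference treatment b₀; absence of a
  -- direct effect makes it the same for all b.
  refine ⟨Q.real {w | yPotMed b₀ z w = y ∧ cov (obs w) = c}, fun b => ?_⟩
  have hb : 0 < Q.real {w | (trt (obs w), cov (obs w)) = (b, c)} := by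
    refine (hpos (c, b, z, y)).trans_le ?_
    rw [obsLaw_real]
    refine measureReal_mono fun w hw => ?_
    have hw : obs w = (c, b, z, y) := hw
    simp [hw, trt, cov]
  have e1 := htd.outcome_indep b b z y z (b, c)
  have e2 := hbd.mediated b z y b c
  have e3 : Q.real {w | yPotMed b z w = y ∧ cov (obs w) = c}
      = Q.real {w | yPotMed b₀ z w = y ∧ cov (obs w) = c} := by
    refine measureReal_congr ?_
    filter_upwards [htd.no_direct_effect b b₀ z] with w hw
    change (_ ∧ _) = (_ ∧ _)
    rw [hw]
  have e4 : Q.real {w | yPotMed b z w = y ∧ zPot b w = z ∧ (trt (obs w), cov (obs w)) = (b, c)}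
      = Q.real {w | outV (obs w) = y ∧ trt (obs w) = b ∧ med (obs w) = z ∧ cov (obs w) = c} := by
    refine measureReal_congr ?_
    filter_upwards [hc.mediator b, hc.outcome_mediator b z] with w h1 h2
    refine propext ⟨?_, ?_⟩
    · rintro ⟨k1, k2, k3⟩
      obtain ⟨k3, k4⟩ := Prod.ext_iff.1 k3
      have k5 := (h1 k3).trans k2
      exact ⟨(h2 k3 k5).trans k1, k3, k5, k4⟩
    · rintro ⟨k1, k2, k3, k4⟩
      exact ⟨(h2 k2 k3).symm.trans k1, (h1 k2).symm.trans k3, Prod.ext k2 k4⟩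
  have e5 : Q.real {w | zPot b w = z ∧ (trt (obs w), cov (obs w)) = (b, c)}
      = Q.real {w | trt (obs w) = b ∧ med (obs w) = z ∧ cov (obs w) = c} := by
    refine measureReal_congr ?_
    filter_upwards [hc.mediator b] with w h1
    refine propext ⟨?_, ?_⟩
    · rintro ⟨k2, k3⟩
      obtain ⟨k3, k4⟩ := Prod.ext_iff.1 k3
      exact ⟨k3, (h1 k3).trans k2, k4⟩
    · rintro ⟨k2, k3, k4⟩
      exact ⟨(h1 k2).symm.trans k3, Prod.ext k2 k4⟩
  have e6 : {w : FullData 𝒞 𝒜 𝒵 𝒴 | (trt (obs w), cov (obs w)) = (b, c)}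
      = {w | trt (obs w) = b ∧ cov (obs w) = c} := by ext w; simp
  have e7 : {w : FullData 𝒞 𝒜 𝒵 𝒴 | yPotMed b z w = y ∧ (trt (obs w), cov (obs w)) = (b, c)}
      = {w | yPotMed b z w = y ∧ trt (obs w) = b ∧ cov (obs w) = c} := by ext w; simp
  rw [e4, e5, e7, e6] at e1
  rw [e3] at e2
  rw [e6] at hb
  simp only [obsLaw_real, Set.mem_ofPred_eq]
  -- `e1` splits Y(b,z) from Z(b) given (A,C), and `e2` removes A from Y(b,z) given C. Their
  -- combination carries the extra factor P(A = b, C = c) > 0.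
  refine mul_left_cancel₀ hb.ne' ?_
  linear_combination (Q.real {w | cov (obs w) = c}) * e1 +
    Q.real {w | trt (obs w) = b ∧ med (obs w) = z ∧ cov (obs w) = c} * e2

/-- The factor in `exists_outcome_factor` does not depend on the treatment. Summing that identity
over treatments and comparing the sum with a single term eliminates the factor. -/
theorem condIndep_outcome_treatment (hQ : Q ∈ backDoorTwoDoorModel 𝒞 𝒜 𝒵 𝒴) :
    CondIndepDiscrete (obsLaw Q) outV trt (fun x => (med x, cov x)) := by
  have hpos := obsLaw_pos hQ
  have hprob := isProbabilityMeasure_obsLaw hQ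
  rintro y b ⟨z, c⟩
  obtain ⟨g, hg⟩ := exists_outcome_factor hQ y z c
  set P := obsLaw Q
  have hcpos : 0 < P.real {x | cov x = c} := fiber_pos hpos cov (c, b, z, y)
  have h1 := hasSum_measureReal_fiber (P := P) trt {x | outV x = y ∧ med x = z ∧ cov x = c}
  have h2 := hasSum_measureReal_fiber (P := P) trt {x | med x = z ∧ cov x = c}
  have h3 : P.real {x | cov x = c} * P.real {x | outV x = y ∧ med x = z ∧ cov x = c}
      = g * P.real {x | med x = z ∧ cov x = c} := by
    refine (h1.mul_left _).unique ?_
    convert h2.mul_left g using 2 with b'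
    refine Eq.trans ?_ (hg b')
    congr 2
    ext x; simp only [Set.mem_ofPred_eq]; tauto
  simp only [Prod.mk.injEq]
  refine mul_left_cancel₀ hcpos.ne' ?_
  linear_combination (P.real {x | med x = z ∧ cov x = c}) * hg b -
    P.real {x | trt x = b ∧ med x = z ∧ cov x = c} * h3

theorem pA_eq (P : Measure (Obs 𝒞 𝒜 𝒵 𝒴)) (a : 𝒜) (c : 𝒞) :
    pA P a c = P.real {x | trt x = a ∧ cov x = c} / P.real {x | cov x = c} := by
  rw [pA, Measure.real, cond_apply MeasurableSet.of_discrete, ENNReal.toReal_mul,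
    ENNReal.toReal_inv, div_eq_inv_mul]
  congr 3
  ext x; simp [and_comm]

theorem ind_of_eq {a : 𝒜} {x : Obs 𝒞 𝒜 𝒵 𝒴} (h : trt x = a) : ind a x = 1 := by simp [ind, h]

theorem ind_of_ne {a : 𝒜} {x : Obs 𝒞 𝒜 𝒵 𝒴} (h : trt x ≠ a) : ind a x = 0 := by simp [ind, h]

theorem ind_nonneg (a : 𝒜) (x : Obs 𝒞 𝒜 𝒵 𝒴) : 0 ≤ ind a x := by
  by_cases h : trt x = a <;> simp [ind, h]

/-- Inverse probability weighting as an identity of measures: by (BD) and consistency, p(Y(a)=y, c)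
= p(y,a,c)/p(a|c). In this form it yields both the integrability criterion and the value of E Y(a)
by change of variables. -/
theorem map_yPot_cov (hQ : Q ∈ backDoorTwoDoorModel 𝒞 𝒜 𝒵 𝒴) (a : 𝒜) :
    Q.map (fun w => (yPot a w, cov (obs w))) =
      ((obsLaw Q).withDensity fun x =>
        ENNReal.ofReal (ind a x / pA (obsLaw Q) a (cov x))).map fun x => (outV x, cov x) := by
  have hpos := obsLaw_pos hQ
  have hprob := isProbabilityMeasure_obsLaw hQ
  have hprobQ := hQ.1
  refine Measure.ext_of_singleton fun ⟨y, c⟩ => ?_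
  have hm : Measurable fun w : FullData 𝒞 𝒜 𝒵 𝒴 => (yPot a w, cov (obs w)) :=
    (measurable_yPot a).prodMk ((Measurable.of_discrete (f := cov)).comp measurable_obs)
  rw [Measure.map_apply hm MeasurableSet.of_discrete,
    Measure.map_apply Measurable.of_discrete MeasurableSet.of_discrete,
    withDensity_apply _ MeasurableSet.of_discrete]
  obtain ⟨z⟩ : Nonempty 𝒵 := by
    obtain ⟨x⟩ := nonempty_of_isProbabilityMeasure (obsLaw Q)
    exact ⟨med x⟩
  have hac : 0 < (obsLaw Q).real {x | trt x = a ∧ cov x = c} :=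
    (hpos (c, a, z, y)).trans_le (measureReal_mono (by simp [trt, cov]))
  have hcp : 0 < (obsLaw Q).real {x | cov x = c} := fiber_pos hpos cov (c, a, z, y)
  have key := hQ.2.2.2.1.pair a a (y, y) a c
  have e1 : Q.real {w | (yPot a w, yPot a w) = (y, y) ∧ cov (obs w) = c}
      = Q.real ((fun w => (yPot a w, cov (obs w))) ⁻¹' {(y, c)}) := by
    congr 1; ext w; simp
  have e2 : Q.real {w | (yPot a w, yPot a w) = (y, y) ∧ trt (obs w) = a ∧ cov (obs w) = c}
      = (obsLaw Q).real {x | outV x = y ∧ trt x = a ∧ cov x = c} := by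
    rw [obsLaw_real]
    refine measureReal_congr ?_
    filter_upwards [hQ.2.1.outcome a] with w hw
    refine propext ⟨?_, ?_⟩
    · rintro ⟨h1, h2, h3⟩
      exact ⟨(hw h2).trans (Prod.ext_iff.1 h1).1, h2, h3⟩
    · rintro ⟨h1, h2, h3⟩
      have := (hw h2).symm.trans h1
      exact ⟨Prod.ext this this, h2, h3⟩
  have e3 : Q.real {w | cov (obs w) = c} = (obsLaw Q).real {x | cov x = c} :=
    (obsLaw_real Q {x | cov x = c}).symm
  have e4 : Q.real {w | trt (obs w) = a ∧ cov (obs w) = c}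
      = (obsLaw Q).real {x | trt x = a ∧ cov x = c} :=
    (obsLaw_real Q {x | trt x = a ∧ cov x = c}).symm
  rw [e1, e2, e3, e4] at key
  have hset : (fun x : Obs 𝒞 𝒜 𝒵 𝒴 => (outV x, cov x)) ⁻¹' {(y, c)}
      = {x | outV x = y ∧ cov x = c} := by ext x; simp
  replace key := (eq_div_iff hac.ne').2 key.symm
  rw [hset, ← ofReal_measureReal, key]
  have hint : ∫⁻ x in {x | outV x = y ∧ cov x = c},
        ENNReal.ofReal (ind a x / pA (obsLaw Q) a (cov x)) ∂(obsLaw Q)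
      = ∫⁻ x in {x | outV x = y ∧ cov x = c},
        {x | trt x = a}.indicator (fun _ => ENNReal.ofReal (1 / pA (obsLaw Q) a c)) x
          ∂(obsLaw Q) := by
    refine setLIntegral_congr_fun MeasurableSet.of_discrete fun x hx => ?_
    by_cases h : trt x = a
    · simp [ind, h, hx.2]
    · simp [ind, h]
  rw [hint, lintegral_indicator_const MeasurableSet.of_discrete,
    Measure.restrict_apply MeasurableSet.of_discrete, ← ofReal_measureReal,
    ← ENNReal.ofReal_mul (by rw [pA_eq]; positivity), pA_eq]
  have hset2 : {x : Obs 𝒞 𝒜 𝒵 𝒴 | trt x = a} ∩ {x | outV x = y ∧ cov x = c}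
      = {x | outV x = y ∧ trt x = a ∧ cov x = c} := by
    ext x; simp only [Set.mem_inter_iff, Set.mem_ofPred_eq]; tauto
  rw [hset2]
  congr 1
  field_simp

theorem integrable_yPot_iff (hQ : Q ∈ backDoorTwoDoorModel 𝒞 𝒜 𝒵 𝒴) (a : 𝒜) :
    Integrable (fun w => (yPot a w : ℝ)) Q ↔
      Integrable (fun x => out x * (ind a x / pA (obsLaw Q) a (cov x))) (obsLaw Q) := by
  have hm : Measurable fun w : FullData 𝒞 𝒜 𝒵 𝒴 => (yPot a w, cov (obs w)) :=
    (measurable_yPot a).prodMk ((Measurable.of_discrete (f := cov)).comp measurable_obs)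
  have h1 := integrable_map_measure (μ := Q) (g := fun p : 𝒴 × 𝒞 => (p.1 : ℝ)) (aestronglyMeasurable_discrete _)
    hm.aemeasurable
  have h2 := integrable_map_measure (μ := (obsLaw Q).withDensity fun x =>
        ENNReal.ofReal (ind a x / pA (obsLaw Q) a (cov x)))
    (f := fun x => (outV x, cov x)) (g := fun p : 𝒴 × 𝒞 => (p.1 : ℝ)) (aestronglyMeasurable_discrete _)
    Measurable.of_discrete.aemeasurable
  rw [map_yPot_cov hQ a] at h1
  refine h1.symm.trans (h2.trans ?_)
  rw [integrable_withDensity_iff_integrable_smul' Measurable.of_discrete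
    (ae_of_all _ fun x => ENNReal.ofReal_lt_top)]
  refine iff_of_eq (congrArg₂ _ (funext fun x => ?_) rfl)
  have : 0 ≤ ind a x / pA (obsLaw Q) a (cov x) :=
    div_nonneg (ind_nonneg a x) measureReal_nonneg
  simp [ENNReal.toReal_ofReal this, out, mul_comm]

theorem integral_yPot (hQ : Q ∈ backDoorTwoDoorModel 𝒞 𝒜 𝒵 𝒴) (a : 𝒜) :
    ∫ w, (yPot a w : ℝ) ∂Q =
      ∫ x, out x * (ind a x / pA (obsLaw Q) a (cov x)) ∂(obsLaw Q) := by
  have hm : Measurable fun w : FullData 𝒞 𝒜 𝒵 𝒴 => (yPot a w, cov (obs w)) :=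
    (measurable_yPot a).prodMk ((Measurable.of_discrete (f := cov)).comp measurable_obs)
  have h1 := integral_map (μ := Q) hm.aemeasurable (f := fun p : 𝒴 × 𝒞 => (p.1 : ℝ)) (aestronglyMeasurable_discrete _)
  have h2 := integral_map (μ := (obsLaw Q).withDensity fun x =>
        ENNReal.ofReal (ind a x / pA (obsLaw Q) a (cov x)))
    (φ := fun x => (outV x, cov x)) Measurable.of_discrete.aemeasurable
    (f := fun p : 𝒴 × 𝒞 => (p.1 : ℝ)) (aestronglyMeasurable_discrete _)
  rw [map_yPot_cov hQ a] at h1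
  refine h1.symm.trans (h2.trans ?_)
  rw [integral_withDensity_eq_integral_toReal_smul Measurable.of_discrete
    (ae_of_all _ fun x => ENNReal.ofReal_lt_top)]
  congr 1; funext x
  have : 0 ≤ ind a x / pA (obsLaw Q) a (cov x) :=
    div_nonneg (ind_nonneg a x) measureReal_nonneg
  simp [ENNReal.toReal_ofReal this, out, mul_comm]

end ModelFacts

/-! ### Realizing a prescribed factorization by a full-data law of the model. -/

section Canonical

variable {𝒞 𝒜 𝒵 : Type*} {𝒴 : Set ℝ}

/-- Full data built from `(C, A)`, a table of mediators and a table of outcomes. -/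
def canonicalData (ω : (𝒞 × 𝒜) × ((𝒜 × 𝒞 → 𝒵) × (𝒵 × 𝒞 → 𝒴))) : FullData 𝒞 𝒜 𝒵 𝒴 :=
  (ω.1.1, ω.1.2, ω.2.1 (ω.1.2, ω.1.1), ω.2.2 (ω.2.1 (ω.1.2, ω.1.1), ω.1.1),
    fun a => ω.2.1 (a, ω.1.1), fun _ z => ω.2.2 (z, ω.1.1))

variable [Countable 𝒞] [Countable 𝒜] [Countable 𝒵] [Countable 𝒴]
  [MeasurableSpace 𝒞] [MeasurableSpace 𝒜] [MeasurableSpace 𝒵]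
  [DiscreteMeasurableSpace 𝒞] [DiscreteMeasurableSpace 𝒜] [DiscreteMeasurableSpace 𝒵]

theorem measurable_canonicalData :
    Measurable (canonicalData : _ → FullData 𝒞 𝒜 𝒵 𝒴) := by
  refine measurable_from_prod_countable_right fun p => ?_
  have h : Measurable fun r : (𝒜 × 𝒞 → 𝒵) × (𝒵 × 𝒞 → 𝒴) => r.2 (r.1 (p.2, p.1), p.1) :=
    measurable_apply_countable (g := fun r : (𝒜 × 𝒞 → 𝒵) × (𝒵 × 𝒞 → 𝒴) => r.1 (p.2, p.1))
      (F := fun z r => r.2 (z, p.1)) (by fun_prop) (by fun_prop)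
  have h1 : Measurable fun r : (𝒜 × 𝒞 → 𝒵) × (𝒵 × 𝒞 → 𝒴) => r.1 (p.2, p.1) := by fun_prop
  have h2 : Measurable fun (r : (𝒜 × 𝒞 → 𝒵) × (𝒵 × 𝒞 → 𝒴)) (a : 𝒜) => r.1 (a, p.1) := by
    fun_prop
  have h3 : Measurable fun (r : (𝒜 × 𝒞 → 𝒵) × (𝒵 × 𝒞 → 𝒴)) (_ : 𝒜) (z : 𝒵) => r.2 (z, p.1) := by
    fun_prop
  exact (measurable_const (a := p.1)).prodMk ((measurable_const (a := p.2)).prodMk (h1.prodMk (h.prodMk (h2.prodMk h3))))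

variable (μ : Measure (𝒞 × 𝒜)) (ν : 𝒜 × 𝒞 → Measure 𝒵) (ρ : 𝒵 × 𝒞 → Measure 𝒴)

/-- The law of the canonical full data with independent entries of the tables. -/
def canonicalLaw : Measure (FullData 𝒞 𝒜 𝒵 𝒴) :=
  (μ.prod ((Measure.infinitePi ν).prod (Measure.infinitePi ρ))).map canonicalData

variable [IsProbabilityMeasure μ] [∀ i, IsProbabilityMeasure (ν i)]
  [∀ i, IsProbabilityMeasure (ρ i)]

/-- The pair (C,A), the mediator table and the outcome table are independent, so rectangular events
have product probability. The primed version keeps the two tables together, for events such as {Y(a)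
= y} that mix them. -/
theorem canonicalLaw_real {p : FullData 𝒞 𝒜 𝒵 𝒴 → Prop} (hp : MeasurableSet {w | p w})
    {s : Set (𝒞 × 𝒜)} {t : Set (𝒜 × 𝒞 → 𝒵)} {u : Set (𝒵 × 𝒞 → 𝒴)}
    (h : ∀ r f g, p (canonicalData (r, f, g)) ↔ r ∈ s ∧ f ∈ t ∧ g ∈ u) :
    (canonicalLaw μ ν ρ).real {w | p w} =
      μ.real s * ((Measure.infinitePi ν).real t * (Measure.infinitePi ρ).real u) := by
  rw [canonicalLaw, map_measureReal_apply measurable_canonicalData hp, ← measureReal_prod_prod,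
    ← measureReal_prod_prod]
  congr 1
  ext ⟨r, f, g⟩
  simpa using h r f g

theorem canonicalLaw_real' {p : FullData 𝒞 𝒜 𝒵 𝒴 → Prop} (hp : MeasurableSet {w | p w})
    {s : Set (𝒞 × 𝒜)} {t : Set ((𝒜 × 𝒞 → 𝒵) × (𝒵 × 𝒞 → 𝒴))}
    (h : ∀ r f, p (canonicalData (r, f)) ↔ r ∈ s ∧ f ∈ t) :
    (canonicalLaw μ ν ρ).real {w | p w} =
      μ.real s * ((Measure.infinitePi ν).prod (Measure.infinitePi ρ)).real t := by
  rw [canonicalLaw, map_measureReal_apply measurable_canonicalData hp, ← measureReal_prod_prod]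
  congr 1
  ext ⟨r, f⟩
  simpa using h r f

theorem measurable_cov_obs : Measurable fun w : FullData 𝒞 𝒜 𝒵 𝒴 => cov (obs w) := by
  unfold cov obs; fun_prop

theorem measurable_trt_obs : Measurable fun w : FullData 𝒞 𝒜 𝒵 𝒴 => trt (obs w) := by
  unfold trt obs; fun_prop

theorem measurable_med_obs : Measurable fun w : FullData 𝒞 𝒜 𝒵 𝒴 => med (obs w) := by
  unfold med obs; fun_prop

theorem measurableSet_eq_value {Ω α : Type*} [MeasurableSpace Ω] [MeasurableSpace α]
    [DiscreteMeasurableSpace α] {f : Ω → α} (hf : Measurable f) (v : α) :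
    MeasurableSet {w | f w = v} := hf (MeasurableSet.of_discrete (s := {v}))

theorem measurableSet_eq_fun_of_discrete {Ω α : Type*} [MeasurableSpace Ω] [MeasurableSpace α]
    [Countable α] [DiscreteMeasurableSpace α] {f g : Ω → α} (hf : Measurable f)
    (hg : Measurable g) : MeasurableSet {w | f w = g w} :=
  (hf.prodMk hg) (MeasurableSet.of_discrete (s := {p : α × α | p.1 = p.2}))

theorem measurableSet_and {Ω : Type*} [MeasurableSpace Ω] {p q : Ω → Prop}
    (hp : MeasurableSet {w | p w}) (hq : MeasurableSet {w | q w}) :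
    MeasurableSet {w | p w ∧ q w} := hp.inter hq

/-- Functions of the covariate and the tables are independent of the treatment given the
covariate. -/
theorem canonicalLaw_condIndep {α : Type*} [MeasurableSpace α] [DiscreteMeasurableSpace α]
    {X : FullData 𝒞 𝒜 𝒵 𝒴 → α} (hX : Measurable X)
    (F : 𝒞 → ((𝒜 × 𝒞 → 𝒵) × (𝒵 × 𝒞 → 𝒴)) → α)
    (hF : ∀ r f, X (canonicalData (r, f)) = F r.1 f) :
    CondIndepDiscrete (canonicalLaw μ ν ρ) X (fun w => trt (obs w)) (fun w => cov (obs w)) := by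
  intro x b c
  beta_reduce
  have mX := measurableSet_eq_value hX x
  have mA := measurableSet_eq_value (measurable_trt_obs (𝒞 := 𝒞) (𝒜 := 𝒜) (𝒵 := 𝒵) (𝒴 := 𝒴)) b
  have mC := measurableSet_eq_value (measurable_cov_obs (𝒞 := 𝒞) (𝒜 := 𝒜) (𝒵 := 𝒵) (𝒴 := 𝒴)) c
  rw [canonicalLaw_real' μ ν ρ mC (s := {r | r.1 = c}) (t := Set.univ),
    canonicalLaw_real' μ ν ρ (measurableSet_and mX (measurableSet_and mA mC)) (s := {r | r.2 = b ∧ r.1 = c})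
      (t := {f | F c f = x}),
    canonicalLaw_real' μ ν ρ (measurableSet_and mX mC) (s := {r | r.1 = c}) (t := {f | F c f = x}),
    canonicalLaw_real' μ ν ρ (measurableSet_and mA mC) (s := {r | r.2 = b ∧ r.1 = c}) (t := Set.univ)]
  · ring
  · intro r f; simp [canonicalData, obs, trt, cov]
  · intro r f
    simp only [hF]
    constructor
    · rintro ⟨h1, h2⟩; obtain rfl : r.1 = c := h2; exact ⟨rfl, h1⟩
    · rintro ⟨h1, h2⟩; obtain rfl : r.1 = c := h1; exact ⟨h2, rfl⟩
  · intro r f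
    simp only [hF]
    constructor
    · rintro ⟨h1, h3, h2⟩; obtain rfl : r.1 = c := h2; exact ⟨⟨h3, rfl⟩, h1⟩
    · rintro ⟨⟨h3, h1⟩, h2⟩; obtain rfl : r.1 = c := h1; exact ⟨h2, h3, rfl⟩
  · intro r f; simp [canonicalData, obs, cov]

/-- Consistency and the lack of a direct effect hold identically by construction; the independence
requirements follow from independence of the tables from (C,A) and from each other. -/
theorem canonicalLaw_mem (hμ : ∀ r, 0 < μ.real {r}) (hν : ∀ i z, 0 < (ν i).real {z})
    (hρ : ∀ i y, 0 < (ρ i).real {y}) :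
    canonicalLaw μ ν ρ ∈ backDoorTwoDoorModel 𝒞 𝒜 𝒵 𝒴 := by
  have hprob : IsProbabilityMeasure (canonicalLaw μ ν ρ) :=
    Measure.isProbabilityMeasure_map measurable_canonicalData.aemeasurable
  have hae : ∀ {p : FullData 𝒞 𝒜 𝒵 𝒴 → Prop}, MeasurableSet {w | p w} →
      (∀ ω, p (canonicalData ω)) → ∀ᵐ w ∂(canonicalLaw μ ν ρ), p w := fun hp h =>
    (ae_map_iff measurable_canonicalData.aemeasurable hp).2 (ae_of_all _ h)
  have mA := fun b => measurableSet_eq_value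
    (measurable_trt_obs (𝒞 := 𝒞) (𝒜 := 𝒜) (𝒵 := 𝒵) (𝒴 := 𝒴)) b
  have mZ := fun b => measurableSet_eq_value
    (measurable_med_obs (𝒞 := 𝒞) (𝒜 := 𝒜) (𝒵 := 𝒵) (𝒴 := 𝒴)) b
  have mC := fun b => measurableSet_eq_value
    (measurable_cov_obs (𝒞 := 𝒞) (𝒜 := 𝒜) (𝒵 := 𝒵) (𝒴 := 𝒴)) b
  have mO : Measurable fun w : FullData 𝒞 𝒜 𝒵 𝒴 => outV (obs w) :=
    (Measurable.of_discrete (f := outV)).comp measurable_obs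
  refine ⟨hprob, ⟨fun a => ?_, fun a => ?_, fun a z => ?_⟩, ?_, ⟨fun a a' => ?_, fun a z => ?_⟩,
    ⟨fun a a' z => ?_, fun a => ?_, ?_⟩⟩
  · refine hae (MeasurableSet.imp (mA a) (measurableSet_eq_fun_of_discrete mO (measurable_yPot a))) ?_
    rintro ⟨⟨c, b⟩, f, g⟩ rfl
    rfl
  · refine hae (MeasurableSet.imp (mA a) (measurableSet_eq_fun_of_discrete measurable_med_obs (measurable_zPot a))) ?_
    rintro ⟨⟨c, b⟩, f, g⟩ rfl
    rfl
  · refine hae (MeasurableSet.imp (mA a) (MeasurableSet.imp (mZ z) (measurableSet_eq_fun_of_discrete mO (measurable_yPotMed a z)))) ?_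
    rintro ⟨⟨c, b⟩, f, g⟩ rfl rfl
    rfl
  · intro a y a' z c
    classical
    -- Requiring in addition Z(a) = z turns the event into a cylinder: mediator entries (a,c) and
    -- (a',c), outcome entry (z,c). A finite set of indices covers the case a = a' as well.
    have hle : (canonicalLaw μ ν ρ).real
        {w | zPot a w = z ∧ yPotMed a z w = y ∧ trt (obs w) = a' ∧ med (obs w) = z
          ∧ cov (obs w) = c} ≤
        (canonicalLaw μ ν ρ).real
          {w | yPot a w = y ∧ trt (obs w) = a' ∧ med (obs w) = z ∧ cov (obs w) = c} := by
      refine measureReal_mono ?_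
      rintro w ⟨h1, h2, h3⟩
      refine ⟨?_, h3⟩
      rw [yPot, h1, h2]
    refine lt_of_lt_of_le ?_ hle
    rw [canonicalLaw_real μ ν ρ (measurableSet_and
      (measurableSet_eq_value (measurable_zPot a) z) (measurableSet_and
        (measurableSet_eq_value (measurable_yPotMed a z) y)
        (measurableSet_and (mA a') (measurableSet_and (mZ z) (mC c)))))
      (s := {(c, a')}) (t := Set.pi ({(a, c), (a', c)} : Finset (𝒜 × 𝒞)) fun _ => {z})
      (u := Set.pi ({(z, c)} : Finset (𝒵 × 𝒞)) fun _ => {y})]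
    · rw [Measure.real, Measure.real, Measure.real,
        Measure.infinitePi_pi _ (fun _ _ => MeasurableSet.of_discrete),
        Measure.infinitePi_pi _ (fun _ _ => MeasurableSet.of_discrete), ENNReal.toReal_prod,
        ENNReal.toReal_prod]
      exact mul_pos (hμ _) (mul_pos (Finset.prod_pos fun i _ => hν i z)
        (Finset.prod_pos fun i _ => hρ i y))
    · rintro ⟨c', b⟩ f g
      simp only [canonicalData, zPot, yPotMed, obs, trt, med, cov, Set.mem_singleton_iff,
        Prod.mk.injEq, Set.mem_pi, Finset.coe_insert, Finset.coe_singleton, Set.mem_insert_iff,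
        forall_eq_or_imp, forall_eq]
      constructor
      · rintro ⟨h1, h2, rfl, h3, rfl⟩; exact ⟨⟨rfl, rfl⟩, ⟨h1, h3⟩, h2⟩
      · rintro ⟨⟨rfl, rfl⟩, ⟨h1, h3⟩, h2⟩; exact ⟨h1, h2, rfl, h3, rfl⟩
  · exact canonicalLaw_condIndep μ ν ρ ((measurable_yPot a).prodMk (measurable_yPot a'))
      (fun c f => (f.2 (f.1 (a, c), c), f.2 (f.1 (a', c), c))) fun r f => rfl
  · exact canonicalLaw_condIndep μ ν ρ (measurable_yPotMed a z)
      (fun c f => f.2 (z, c)) fun r f => rfl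
  · exact hae (measurableSet_eq_fun_of_discrete (measurable_yPotMed a z) (measurable_yPotMed a' z))
      fun _ => rfl
  · exact canonicalLaw_condIndep μ ν ρ (measurable_zPot a)
      (fun c f => f.1 (a, c)) fun r f => rfl
  · rintro a a' z y z' ⟨b, c⟩
    beta_reduce
    have mX := measurableSet_eq_value
      (measurable_yPotMed (𝒞 := 𝒞) (𝒜 := 𝒜) (𝒵 := 𝒵) (𝒴 := 𝒴) a z) y
    have mW := measurableSet_eq_value
      (measurable_zPot (𝒞 := 𝒞) (𝒜 := 𝒜) (𝒵 := 𝒵) (𝒴 := 𝒴) a') z'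
    have mV := measurableSet_eq_value ((measurable_trt_obs (𝒞 := 𝒞) (𝒜 := 𝒜) (𝒵 := 𝒵)
      (𝒴 := 𝒴)).prodMk measurable_cov_obs) (b, c)
    rw [canonicalLaw_real μ ν ρ mV (s := {(c, b)}) (t := Set.univ) (u := Set.univ),
      canonicalLaw_real μ ν ρ (measurableSet_and mX (measurableSet_and mW mV)) (s := {(c, b)})
        (t := {f | f (a', c) = z'}) (u := {g | g (z, c) = y}),
      canonicalLaw_real μ ν ρ (measurableSet_and mX mV) (s := {(c, b)}) (t := Set.univ)
        (u := {g | g (z, c) = y}),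
      canonicalLaw_real μ ν ρ (measurableSet_and mW mV) (s := {(c, b)})
        (t := {f | f (a', c) = z'}) (u := Set.univ)]
    · simp only [probReal_univ]; ring
    all_goals
      rintro ⟨c', b'⟩ f g
      simp only [canonicalData, zPot, yPotMed, obs, trt, cov, Set.mem_singleton_iff,
        Prod.mk.injEq, Set.mem_univ, Set.mem_ofPred_eq]
      constructor <;> (intro h; casesm* _ ∧ _; subst_vars; simp)

/-- An observation reads a single entry of each table, so only the marginal laws of those entries
appear, and the factors can be chosen freely. -/
theorem obsLaw_canonicalLaw_real (x : Obs 𝒞 𝒜 𝒵 𝒴) :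
    (obsLaw (canonicalLaw μ ν ρ)).real {x} =
      μ.real {(cov x, trt x)} * ((ν (trt x, cov x)).real {med x} *
        (ρ (med x, cov x)).real {outV x}) := by
  rw [obsLaw_real, canonicalLaw_real μ ν ρ (measurable_obs MeasurableSet.of_discrete)
    (s := {(cov x, trt x)}) (t := (fun f => f (trt x, cov x)) ⁻¹' {med x})
    (u := (fun g => g (med x, cov x)) ⁻¹' {outV x})]
  · rw [← map_measureReal_apply (by fun_prop) MeasurableSet.of_discrete,
      ← map_measureReal_apply (by fun_prop) MeasurableSet.of_discrete]
    congr 3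
    · exact Measure.infinitePi_map_eval ν _
    · exact Measure.infinitePi_map_eval ρ _
  · obtain ⟨c, b, z, y⟩ := x
    rintro ⟨c', b'⟩ f g
    simp only [canonicalData, obs, trt, cov, med, outV, Set.mem_singleton_iff, Prod.mk.injEq,
      Set.mem_preimage]
    constructor
    · rintro ⟨rfl, rfl, rfl, rfl⟩; simp
    · rintro ⟨⟨rfl, rfl⟩, rfl, rfl⟩; simp

end Canonical

/-! ### Cell probabilities and the conditional law of treatment given (Y,Z,C). -/

section Weights

theorem hasSum_integral_comp {X γ : Type*} [MeasurableSpace X] [DiscreteMeasurableSpace X]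
    [Countable γ] {ρ : Measure X} [IsProbabilityMeasure ρ] {V : X → γ} {g : γ → ℝ}
    (hg : Integrable (fun x => g (V x)) ρ) :
    HasSum (fun v => g v * ρ.real {x | V x = v}) (∫ x, g (V x) ∂ρ) := by
  convert hasSum_fiberMean V hg using 2 with v
  rw [measureReal_mul_fiberMean, setIntegral_congr_fun (s := {x | V x = v})
    (g := fun _ => g v) MeasurableSet.of_discrete fun x hx => congrArg g hx, setIntegral_const,
    smul_eq_mul, mul_comm]

theorem cond_real {X : Type*} [MeasurableSpace X] [DiscreteMeasurableSpace X] (P : Measure X)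
    (s t : Set X) : (ProbabilityTheory.cond P s).real t = P.real (s ∩ t) / P.real s := by
  rw [Measure.real, cond_apply MeasurableSet.of_discrete, ENNReal.toReal_mul,
    ENNReal.toReal_inv, div_eq_inv_mul]
  rfl

theorem isProbabilityMeasure_cond_of_pos {X : Type*} [MeasurableSpace X] {P : Measure X}
    [IsProbabilityMeasure P] {s : Set X} (h : 0 < P.real s) :
    IsProbabilityMeasure (ProbabilityTheory.cond P s) :=
  cond_isProbabilityMeasure fun h0 => by simp [Measure.real, h0] at h

variable {𝒞 𝒜 𝒵 : Type*} {𝒴 : Set ℝ}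

/-- Treatment and covariate. -/
def trtCov (x : Obs 𝒞 𝒜 𝒵 𝒴) : 𝒜 × 𝒞 := (trt x, cov x)

/-- Treatment, mediator and covariate. -/
def trtMedCov (x : Obs 𝒞 𝒜 𝒵 𝒴) : 𝒜 × 𝒵 × 𝒞 := (trt x, med x, cov x)

/-- Mediator and covariate. -/
def medCov (x : Obs 𝒞 𝒜 𝒵 𝒴) : 𝒵 × 𝒞 := (med x, cov x)

/-- Outcome, mediator and covariate. -/
def outMedCov (x : Obs 𝒞 𝒜 𝒵 𝒴) : 𝒴 × 𝒵 × 𝒞 := (outV x, med x, cov x)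

theorem trtCov_fiber (a : 𝒜) (c : 𝒞) :
    {x : Obs 𝒞 𝒜 𝒵 𝒴 | trtCov x = (a, c)} = {x | trt x = a ∧ cov x = c} := by
  ext x; simp [trtCov]

theorem trtMedCov_fiber (a : 𝒜) (z : 𝒵) (c : 𝒞) :
    {x : Obs 𝒞 𝒜 𝒵 𝒴 | trtMedCov x = (a, z, c)} = {x | trt x = a ∧ med x = z ∧ cov x = c} := by
  ext x; simp [trtMedCov]

theorem medCov_fiber (z : 𝒵) (c : 𝒞) :
    {x : Obs 𝒞 𝒜 𝒵 𝒴 | medCov x = (z, c)} = {x | med x = z ∧ cov x = c} := by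
  ext x; simp [medCov]

theorem outMedCov_fiber (y : 𝒴) (z : 𝒵) (c : 𝒞) :
    {x : Obs 𝒞 𝒜 𝒵 𝒴 | outMedCov x = (y, z, c)} = {x | outV x = y ∧ med x = z ∧ cov x = c} := by
  ext x; simp [outMedCov]

variable [Countable 𝒞] [Countable 𝒜] [Countable 𝒵] [Countable 𝒴]
  [MeasurableSpace 𝒞] [MeasurableSpace 𝒜] [MeasurableSpace 𝒵]
  [DiscreteMeasurableSpace 𝒞] [DiscreteMeasurableSpace 𝒜] [DiscreteMeasurableSpace 𝒵]
  {P : Measure (Obs 𝒞 𝒜 𝒵 𝒴)} [IsProbabilityMeasure P]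

theorem meanAC_eq (a : 𝒜) (c : 𝒞) : meanAC P a c = fiberMean P trtCov out (a, c) := by
  rw [meanAC, fiberMean, trtCov_fiber]

theorem meanAZC_eq (a : 𝒜) (z : 𝒵) (c : 𝒞) :
    meanAZC P a z c = fiberMean P trtMedCov out (a, z, c) := by
  rw [meanAZC, fiberMean, trtMedCov_fiber]

theorem meanZC_eq (z : 𝒵) (c : 𝒞) : meanZC P z c = fiberMean P medCov out (z, c) := by
  rw [meanZC, fiberMean, medCov_fiber]

theorem pZ_eq (z : 𝒵) (a : 𝒜) (c : 𝒞) :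
    pZ P z a c = P.real {x | trt x = a ∧ med x = z ∧ cov x = c} /
      P.real {x | trt x = a ∧ cov x = c} := by
  rw [pZ, cond_real]
  congr 2
  ext x; simp only [Set.mem_inter_iff, Set.mem_ofPred_eq]; tauto

variable (hpos : ∀ x, 0 < P.real {x})
include hpos

theorem covariate_pos (c : 𝒞) : 0 < P.real {x | cov x = c} := by
  obtain ⟨x⟩ := nonempty_of_isProbabilityMeasure P
  exact fiber_pos hpos cov (c, trt x, med x, outV x)

theorem trtCov_pos (a : 𝒜) (c : 𝒞) : 0 < P.real {x | trt x = a ∧ cov x = c} := by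
  obtain ⟨x⟩ := nonempty_of_isProbabilityMeasure P
  rw [← trtCov_fiber]
  exact fiber_pos hpos trtCov (c, a, med x, outV x)

theorem medCov_pos (z : 𝒵) (c : 𝒞) : 0 < P.real {x | med x = z ∧ cov x = c} := by
  obtain ⟨x⟩ := nonempty_of_isProbabilityMeasure P
  rw [← medCov_fiber]
  exact fiber_pos hpos medCov (c, trt x, z, outV x)

theorem trtMedCov_pos (a : 𝒜) (z : 𝒵) (c : 𝒞) :
    0 < P.real {x | trt x = a ∧ med x = z ∧ cov x = c} := by
  obtain ⟨x⟩ := nonempty_of_isProbabilityMeasure P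
  rw [← trtMedCov_fiber]
  exact fiber_pos hpos trtMedCov (c, a, z, outV x)

theorem outMedCov_pos (y : 𝒴) (z : 𝒵) (c : 𝒞) :
    0 < P.real {x | outV x = y ∧ med x = z ∧ cov x = c} := by
  obtain ⟨x⟩ := nonempty_of_isProbabilityMeasure P
  rw [← outMedCov_fiber]
  exact fiber_pos hpos outMedCov (c, trt x, z, y)

theorem pA_pos (a : 𝒜) (c : 𝒞) : 0 < pA P a c := by
  rw [pA_eq]; exact div_pos (trtCov_pos hpos a c) (covariate_pos hpos c)

theorem pZ_pos (z : 𝒵) (a : 𝒜) (c : 𝒞) : 0 < pZ P z a c := by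
  rw [pZ_eq]; exact div_pos (trtMedCov_pos hpos a z c) (trtCov_pos hpos a c)

theorem pZ_mul_pA (z : 𝒵) (a : 𝒜) (c : 𝒞) :
    pZ P z a c * pA P a c = P.real {x | trt x = a ∧ med x = z ∧ cov x = c} /
      P.real {x | cov x = c} := by
  rw [pZ_eq, pA_eq, div_mul_div_cancel₀ (trtCov_pos hpos a c).ne']

theorem hasSum_pA (c : 𝒞) : HasSum (fun b => pA P b c) 1 := by
  have h := (hasSum_measureReal_fiber (P := P) trt {x | cov x = c}).div_const
    (P.real {x | cov x = c})
  rw [div_self (covariate_pos hpos c).ne'] at h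
  simp_rw [pA_eq]
  exact h

theorem hasSum_pZ_mul_pA (z : 𝒵) (c : 𝒞) :
    HasSum (fun b => pZ P z b c * pA P b c)
      (P.real {x | med x = z ∧ cov x = c} / P.real {x | cov x = c}) := by
  simp_rw [pZ_mul_pA hpos]
  exact (hasSum_measureReal_fiber (P := P) trt {x | med x = z ∧ cov x = c}).div_const _

theorem tsum_pZ_mul_pA_pos (z : 𝒵) (c : 𝒞) : 0 < ∑' b, pZ P z b c * pA P b c := by
  rw [(hasSum_pZ_mul_pA hpos z c).tsum_eq]
  exact div_pos (medCov_pos hpos z c) (covariate_pos hpos c)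

theorem fiberMean_cov_ind (a : 𝒜) (c : 𝒞) : fiberMean P cov (ind a) c = pA P a c := by
  rw [fiberMean, show (ind a : Obs 𝒞 𝒜 𝒵 𝒴 → ℝ) = Set.indicator {x | trt x = a} 1 from rfl,
    integral_indicator_one MeasurableSet.of_discrete]
  rfl

variable (hind : CondIndepDiscrete P outV trt (fun x => (med x, cov x)))
include hind

theorem outcome_indep_treatment (y : 𝒴) (b : 𝒜) (z : 𝒵) (c : 𝒞) :
    P.real {x | med x = z ∧ cov x = c} *
        P.real {x | outV x = y ∧ trt x = b ∧ med x = z ∧ cov x = c} =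
      P.real {x | outV x = y ∧ med x = z ∧ cov x = c} *
        P.real {x | trt x = b ∧ med x = z ∧ cov x = c} := by
  simpa only [Prod.mk.injEq] using hind y b (z, c)

/-- Given mediator and covariate, the law of the outcome does not depend on the treatment. -/
theorem map_outV_cond (b : 𝒜) (z : 𝒵) (c : 𝒞) :
    (ProbabilityTheory.cond P {x | trtMedCov x = (b, z, c)}).map outV =
      (ProbabilityTheory.cond P {x | medCov x = (z, c)}).map outV := by
  rw [trtMedCov_fiber, medCov_fiber]
  have h1 := trtMedCov_pos hpos b z c
  have h2 := medCov_pos hpos z c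
  have i1 := isProbabilityMeasure_cond_of_pos h1
  have i2 := isProbabilityMeasure_cond_of_pos h2
  refine Measure.ext_of_singleton fun y => ?_
  rw [Measure.map_apply Measurable.of_discrete MeasurableSet.of_discrete,
    Measure.map_apply Measurable.of_discrete MeasurableSet.of_discrete,
    ← ofReal_measureReal, ← ofReal_measureReal, cond_real, cond_real]
  have e1 : {x : Obs 𝒞 𝒜 𝒵 𝒴 | trt x = b ∧ med x = z ∧ cov x = c} ∩ outV ⁻¹' {y}
      = {x | outV x = y ∧ trt x = b ∧ med x = z ∧ cov x = c} := by
    ext x; simp; tauto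
  have e2 : {x : Obs 𝒞 𝒜 𝒵 𝒴 | med x = z ∧ cov x = c} ∩ outV ⁻¹' {y}
      = {x | outV x = y ∧ med x = z ∧ cov x = c} := by
    ext x; simp; tauto
  rw [e1, e2]
  congr 1
  rw [div_eq_div_iff h1.ne' h2.ne', mul_comm, outcome_indep_treatment hpos hind y b z c]

theorem fiberMean_outV_eq (g : 𝒴 → ℝ) (b : 𝒜) (z : 𝒵) (c : 𝒞) :
    fiberMean P trtMedCov (fun x => g (outV x)) (b, z, c) =
      fiberMean P medCov (fun x => g (outV x)) (z, c) := by
  have h1 := integral_map (μ := ProbabilityTheory.cond P {x | trtMedCov x = (b, z, c)})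
    (φ := outV) Measurable.of_discrete.aemeasurable (f := g) (aestronglyMeasurable_discrete _)
  have h2 := integral_map (μ := ProbabilityTheory.cond P {x | medCov x = (z, c)})
    (φ := outV) Measurable.of_discrete.aemeasurable (f := g) (aestronglyMeasurable_discrete _)
  rw [map_outV_cond hpos hind] at h1
  exact h1.symm.trans h2

theorem integrable_outV_iff (g : 𝒴 → ℝ) (b : 𝒜) (z : 𝒵) (c : 𝒞) :
    Integrable (fun x => g (outV x))
        (ProbabilityTheory.cond P {x | trtMedCov x = (b, z, c)}) ↔
      Integrable (fun x => g (outV x)) (ProbabilityTheory.cond P {x | medCov x = (z, c)}) := by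
  have h1 := integrable_map_measure (μ := ProbabilityTheory.cond P {x | trtMedCov x = (b, z, c)})
    (f := outV) (g := g) (aestronglyMeasurable_discrete _) Measurable.of_discrete.aemeasurable
  have h2 := integrable_map_measure (μ := ProbabilityTheory.cond P {x | medCov x = (z, c)})
    (f := outV) (g := g) (aestronglyMeasurable_discrete _) Measurable.of_discrete.aemeasurable
  rw [map_outV_cond hpos hind] at h1
  exact h1.symm.trans h2

theorem meanAZC_eq_meanZC (b : 𝒜) (z : 𝒵) (c : 𝒞) : meanAZC P b z c = meanZC P z c := by
  rw [meanAZC_eq, meanZC_eq]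
  exact fiberMean_outV_eq hpos hind (fun y => (y : ℝ)) b z c

/-- The conditional law of the treatment given outcome, mediator and covariate. -/
theorem cond_outMedCov_real (y : 𝒴) (b : 𝒜) (z : 𝒵) (c : 𝒞) :
    (ProbabilityTheory.cond P {x | outMedCov x = (y, z, c)}).real {x | trt x = b} =
      pZ P z b c * pA P b c / ∑' b, pZ P z b c * pA P b c := by
  rw [(hasSum_pZ_mul_pA hpos z c).tsum_eq, pZ_mul_pA hpos, outMedCov_fiber, cond_real]
  have h0 := covariate_pos hpos c
  have h1 := medCov_pos hpos z c
  have h2 := outMedCov_pos hpos y z c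
  have e : {x : Obs 𝒞 𝒜 𝒵 𝒴 | outV x = y ∧ med x = z ∧ cov x = c} ∩ {x | trt x = b}
      = {x | outV x = y ∧ trt x = b ∧ med x = z ∧ cov x = c} := by
    ext x; simp; tauto
  rw [e, div_div_div_cancel_right₀ h0.ne', div_eq_div_iff h2.ne' h1.ne', mul_comm,
    outcome_indep_treatment hpos hind y b z c, mul_comm]

/-- Given (y,z,c), treatment b has probability p(z|b,c)p(b|c)/q with q = ∑ p(z|b,c)p(b|c).
Multiplying by 1/p(z|b,c) leaves p(b|c)/q, with sum 1/q. Lower integrals are used since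
integrability of 1/p(z|A,c) is a consequence, not an assumption. -/
theorem fiberMean_inv_pZ (y : 𝒴) (z : 𝒵) (c : 𝒞) :
    fiberMean P outMedCov (fun x => (pZ P z (trt x) c)⁻¹) (y, z, c) =
      (∑' b, pZ P z b c * pA P b c)⁻¹ := by
  have hq := tsum_pZ_mul_pA_pos hpos z c
  have hprob : IsProbabilityMeasure (ProbabilityTheory.cond P {x | outMedCov x = (y, z, c)}) := by
    rw [outMedCov_fiber]
    exact isProbabilityMeasure_cond_of_pos (outMedCov_pos hpos y z c)
  rw [fiberMean, integral_eq_lintegral_of_nonneg_ae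
    (ae_of_all _ fun x => (inv_pos.2 (pZ_pos hpos z (trt x) c)).le) (aestronglyMeasurable_discrete _)]
  have h := lintegral_map (μ := ProbabilityTheory.cond P {x | outMedCov x = (y, z, c)})
    (f := fun b => ENNReal.ofReal (pZ P z b c)⁻¹) (g := trt) Measurable.of_discrete
    Measurable.of_discrete
  rw [← h, lintegral_countable']
  have e : ∀ b, ENNReal.ofReal (pZ P z b c)⁻¹ *
      ((ProbabilityTheory.cond P {x | outMedCov x = (y, z, c)}).map trt) {b} =
      ENNReal.ofReal (pA P b c * (∑' b, pZ P z b c * pA P b c)⁻¹) := by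
    intro b
    have hz := pZ_pos hpos z b c
    rw [Measure.map_apply Measurable.of_discrete MeasurableSet.of_discrete,
      ← ofReal_measureReal, ← ENNReal.ofReal_mul (inv_pos.2 hz).le,
      show trt ⁻¹' {b} = {x : Obs 𝒞 𝒜 𝒵 𝒴 | trt x = b} from rfl,
      cond_outMedCov_real hpos hind]
    congr 1
    field_simp
  simp_rw [e]
  have hs := (hasSum_pA hpos c).mul_right (∑' b, pZ P z b c * pA P b c)⁻¹
  rw [one_mul] at hs
  rw [← ENNReal.ofReal_tsum_of_nonneg (fun b => mul_nonneg (pA_pos hpos b c).le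
    (inv_pos.2 hq).le) hs.summable, hs.tsum_eq, ENNReal.toReal_ofReal (inv_pos.2 hq).le]

theorem fiberMean_outMedCov_ind (a : 𝒜) (y : 𝒴) (z : 𝒵) (c : 𝒞) :
    fiberMean P outMedCov (ind a) (y, z, c) =
      pZ P z a c * pA P a c / ∑' b, pZ P z b c * pA P b c := by
  rw [← cond_outMedCov_real hpos hind y a z c, fiberMean,
    show (ind a : Obs 𝒞 𝒜 𝒵 𝒴 → ℝ) = Set.indicator {x | trt x = a} 1 from rfl,
    integral_indicator_one MeasurableSet.of_discrete]

end Weights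

/-! ### Means of the outcome when integrability is known in one treatment arm only. -/

section Arm

variable {𝒞 𝒜 𝒵 : Type*} {𝒴 : Set ℝ}
  [Countable 𝒞] [Countable 𝒜] [Countable 𝒵] [Countable 𝒴]
  [MeasurableSpace 𝒞] [MeasurableSpace 𝒜] [MeasurableSpace 𝒵]
  [DiscreteMeasurableSpace 𝒞] [DiscreteMeasurableSpace 𝒜] [DiscreteMeasurableSpace 𝒵]
  {P : Measure (Obs 𝒞 𝒜 𝒵 𝒴)} [IsProbabilityMeasure P]
  (hpos : ∀ x, 0 < P.real {x})
  (hind : CondIndepDiscrete P outV trt (fun x => (med x, cov x))) {a : 𝒜}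
  (hG : Integrable (fun x => out x * (ind a x / pA P a (cov x))) P)
include hpos hG

theorem fiberMean_cov_arm (c : 𝒞) :
    fiberMean P cov (fun x => out x * (ind a x / pA P a (cov x))) c = meanAC P a c := by
  have hp := pA_pos hpos a c
  obtain ⟨x₀⟩ := nonempty_of_isProbabilityMeasure P
  have h := fiberMean_fiberMean hpos trtCov cov Prod.snd (fun _ => rfl) hG
    (c, a, med x₀, outV x₀)
  change fiberMean P cov _ c = fiberMean P cov _ c at h
  rw [← h]
  have e : ∀ y : Obs 𝒞 𝒜 𝒵 𝒴, cov y = c →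
      fiberMean P trtCov (fun x => out x * (ind a x / pA P a (cov x))) (trtCov y)
        = ind a y * (meanAC P a c / pA P a c) := by
    intro y hy
    rw [fiberMean_mul_of (k := ind a y / pA P a c)]
    · by_cases ht : trt y = a
      · have : trtCov y = (a, c) := Prod.ext ht hy
        rw [this, ind_of_eq ht, meanAC_eq]; ring
      · rw [ind_of_ne ht]; ring
    · intro x hx
      obtain ⟨h1, h2⟩ := Prod.ext_iff.1 hx
      have h1 : trt x = trt y := h1
      have h2 : cov x = cov y := h2
      rw [h2, hy]
      by_cases ht : trt y = a
      · rw [ind_of_eq ht, ind_of_eq (h1.trans ht)]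
      · rw [ind_of_ne ht, ind_of_ne (h1 ▸ ht)]
  rw [fiberMean_congr e, fiberMean_mul_of (k := meanAC P a c / pA P a c) (fun _ _ => rfl),
    fiberMean_cov_ind hpos]
  field_simp

include hind

/-- Y itself need not be integrable. It is integrable on the cells of arm a, and Y ⊥ A | Z, C
transfers this to the cells of (Z,C). -/
theorem integrable_out_cond_medCov (z : 𝒵) (c : 𝒞) :
    Integrable out (ProbabilityTheory.cond P {x | medCov x = (z, c)}) := by
  have hp := pA_pos hpos a c
  refine (integrable_outV_iff hpos hind (fun y => (y : ℝ)) a z c).1 ?_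
  refine integrable_cond_congr (fun x hx => ?_)
    ((integrable_cond trtMedCov (a, z, c) hG).mul_const (pA P a c))
  simp only [trtMedCov, Prod.mk.injEq] at hx
  rw [ind_of_eq hx.1, hx.2.2, out]
  field_simp

theorem fiberMean_trtMedCov_arm (x : Obs 𝒞 𝒜 𝒵 𝒴) :
    fiberMean P trtMedCov (fun x => out x * (ind a x / pA P a (cov x))) (trtMedCov x)
      = meanZC P (med x) (cov x) * (ind a x / pA P a (cov x)) := by
  rw [fiberMean_mul_of (k := ind a x / pA P a (cov x))]
  · rw [← meanAZC_eq_meanZC hpos hind (trt x), meanAZC_eq]; rfl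
  · intro y hy
    simp only [trtMedCov, Prod.mk.injEq] at hy
    rw [hy.2.2]
    by_cases ht : trt x = a
    · rw [ind_of_eq ht, ind_of_eq (hy.1.trans ht)]
    · rw [ind_of_ne ht, ind_of_ne (hy.1 ▸ ht)]

/-- Tower property inside arm a, with E(Y|a,z,c) = E(Y|z,c). Integrability of E(Y|Z,c) on the arm
comes from conditioning the weighted outcome on (A,Z,C). -/
theorem hasSum_meanZC_mul_pZ (c : 𝒞) :
    HasSum (fun z => meanZC P z c * pZ P z a c) (meanAC P a c) := by
  have hp := pA_pos hpos a c
  obtain ⟨x₀⟩ := nonempty_of_isProbabilityMeasure P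
  have hM := integrable_fiberMean hpos trtMedCov hG
  simp_rw [fiberMean_trtMedCov_arm hpos hind hG] at hM
  have hi : Integrable (fun x => meanZC P (med x) c)
      (ProbabilityTheory.cond P {x | trtCov x = (a, c)}) := by
    refine integrable_cond_congr (fun x hx => ?_)
      ((integrable_cond trtCov (a, c) hM).mul_const (pA P a c))
    simp only [trtCov, Prod.mk.injEq] at hx
    rw [ind_of_eq hx.1, hx.2]
    field_simp
  have hprob : IsProbabilityMeasure (ProbabilityTheory.cond P {x | trtCov x = (a, c)}) := by
    rw [trtCov_fiber]; exact isProbabilityMeasure_cond_of_pos (trtCov_pos hpos a c)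
  have hs := hasSum_integral_comp (V := med) (g := fun z => meanZC P z c) hi
  have e : ∫ x, meanZC P (med x) c ∂(ProbabilityTheory.cond P {x | trtCov x = (a, c)})
      = meanAC P a c := by
    have h := fiberMean_fiberMean hpos trtMedCov trtCov (fun p => (p.1, p.2.2)) (fun _ => rfl) hG
      (c, a, med x₀, outV x₀)
    simp_rw [fiberMean_trtMedCov_arm hpos hind hG] at h
    have hw : ∀ y : Obs 𝒞 𝒜 𝒵 𝒴, trtCov y = (a, c) → ind a y / pA P a (cov y) = (pA P a c)⁻¹ := by
      intro y hy
      simp only [trtCov, Prod.mk.injEq] at hy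
      rw [ind_of_eq hy.1, hy.2, one_div]
    change fiberMean P trtCov _ (a, c) = fiberMean P trtCov _ (a, c) at h
    rw [fiberMean_mul_of hw, fiberMean_mul_of hw, ← meanAC_eq] at h
    rw [← mul_right_cancel₀ (inv_ne_zero hp.ne') h]
    exact fiberMean_congr fun y hy => by
      simp only [trtCov, Prod.mk.injEq] at hy
      rw [hy.2]
  rw [e, trtCov_fiber] at hs
  exact hs

end Arm

/-! ### Cauchy–Schwarz and orthogonality to mean-square limits. -/

theorem sq_integral_mul_le {X : Type*} [MeasurableSpace X] {P : Measure X} {f g : X → ℝ}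
    (hf : MemLp f 2 P) (hg : MemLp g 2 P) :
    (∫ x, f x * g x ∂P) ^ 2 ≤ (∫ x, f x ^ 2 ∂P) * ∫ x, g x ^ 2 ∂P := by
  have hfg : Integrable (fun x => f x * g x) P := hf.integrable_mul hg
  -- The quadratic t ↦ E(f + tg)² is nonnegative, so its discriminant is at most 0.
  have h : ∀ t : ℝ, 0 ≤ (∫ x, g x ^ 2 ∂P) * (t * t) + (2 * ∫ x, f x * g x ∂P) * t
      + ∫ x, f x ^ 2 ∂P := by
    intro t
    have h0 : 0 ≤ ∫ x, (f x + t * g x) ^ 2 ∂P := integral_nonneg fun _ => sq_nonneg _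
    have e : ∫ x, (f x + t * g x) ^ 2 ∂P = (∫ x, f x ^ 2 ∂P) + (2 * t) * (∫ x, f x * g x ∂P)
        + t ^ 2 * ∫ x, g x ^ 2 ∂P := by
      have i1 : Integrable (fun x => f x ^ 2 + 2 * t * (f x * g x)) P :=
        hf.integrable_sq.add (hfg.const_mul _)
      rw [← integral_const_mul, ← integral_const_mul, ← integral_add hf.integrable_sq
        (hfg.const_mul _), ← integral_add i1 (hg.integrable_sq.const_mul _)]
      congr 1; funext x; ring
    rw [e] at h0
    linarith
  have := discrim_le_zero h
  rw [discrim] at this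
  nlinarith

theorem integral_mul_eq_zero_of_approx {X : Type*} [MeasurableSpace X] {P : Measure X}
    {f g : X → ℝ} (hg : MemLp g 2 P) (hf : MemLp f 2 P)
    (h : ∀ ε > 0, ∃ s, MemLp s 2 P ∧ ∫ x, (f x - s x) ^ 2 ∂P < ε ∧ ∫ x, g x * s x ∂P = 0) :
    ∫ x, g x * f x ∂P = 0 := by
  have hle : ∀ ε > 0, (∫ x, g x * f x ∂P) ^ 2 ≤ (∫ x, g x ^ 2 ∂P) * ε := by
    intro ε hε
    obtain ⟨s, hs, hlt, h0⟩ := h ε hε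
    have e : ∫ x, g x * f x ∂P = ∫ x, g x * (f x - s x) ∂P := by
      simp_rw [mul_sub]
      have i1 : Integrable (fun x => g x * f x) P := hg.integrable_mul hf
      have i2 : Integrable (fun x => g x * s x) P := hg.integrable_mul hs
      rw [integral_sub i1 i2, h0, sub_zero]
    rw [e]
    exact (sq_integral_mul_le hg (hf.sub hs)).trans
      (mul_le_mul_of_nonneg_left hlt.le (integral_nonneg fun _ => sq_nonneg _))
  have h0 : (∫ x, g x * f x ∂P) ^ 2 ≤ 0 := by
    refine le_of_forall_pos_le_add fun ε hε => ?_
    have hn : 0 ≤ ∫ x, g x ^ 2 ∂P := integral_nonneg fun _ => sq_nonneg _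
    -- The added 1 keeps the denominator positive when g vanishes almost everywhere.
    refine (hle (ε / (∫ x, g x ^ 2 ∂P + 1)) (by positivity)).trans ?_
    rw [zero_add, mul_div_assoc', div_le_iff₀ (by positivity)]
    nlinarith
  exact pow_eq_zero_iff (two_ne_zero) |>.1 (le_antisymm h0 (sq_nonneg _))

/-! ### The tangent space of the factorization: intrinsic description and closedness. -/

section FactorTangent

variable {𝒞 𝒜 𝒵 : Type*} {𝒴 : Set ℝ}
  [Countable 𝒞] [Countable 𝒜] [Countable 𝒵] [Countable 𝒴]
  [MeasurableSpace 𝒞] [MeasurableSpace 𝒜] [MeasurableSpace 𝒵]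
  [DiscreteMeasurableSpace 𝒞] [DiscreteMeasurableSpace 𝒜] [DiscreteMeasurableSpace 𝒵]
  {P : Measure (Obs 𝒞 𝒜 𝒵 𝒴)} [IsProbabilityMeasure P]

theorem cov_factorsThrough_trtCov {u : Obs 𝒞 𝒜 𝒵 𝒴 → ℝ} (h : u.FactorsThrough cov) :
    u.FactorsThrough trtCov := fun _ _ hxy => h (Prod.ext_iff.1 hxy).2

theorem trtCov_factorsThrough_trtMedCov {u : Obs 𝒞 𝒜 𝒵 𝒴 → ℝ} (h : u.FactorsThrough trtCov) :
    u.FactorsThrough trtMedCov := fun _ _ hxy => by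
  simp only [trtMedCov, Prod.mk.injEq] at hxy
  exact h (Prod.ext hxy.1 hxy.2.2)

/-- A decomposition of `f` into square-integrable scores of the four factors. -/
structure FactorDecomposition (P : Measure (Obs 𝒞 𝒜 𝒵 𝒴)) (f u₁ u₂ u₃ u₄ : Obs 𝒞 𝒜 𝒵 𝒴 → ℝ) :
    Prop where
  sum : ∀ x, f x = u₁ x + u₂ x + u₃ x + u₄ x
  factors₁ : u₁.FactorsThrough cov
  factors₂ : u₂.FactorsThrough trtCov
  factors₃ : u₃.FactorsThrough trtMedCov
  factors₄ : u₄.FactorsThrough outMedCov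
  memLp₁ : MemLp u₁ 2 P
  memLp₂ : MemLp u₂ 2 P
  memLp₃ : MemLp u₃ 2 P
  memLp₄ : MemLp u₄ 2 P
  mean₁ : ∫ x, u₁ x ∂P = 0
  mean₂ : ∀ x : Obs 𝒞 𝒜 𝒵 𝒴, fiberMean P cov u₂ (cov x) = 0
  mean₃ : ∀ x : Obs 𝒞 𝒜 𝒵 𝒴, fiberMean P trtCov u₃ (trtCov x) = 0
  mean₄ : ∀ x : Obs 𝒞 𝒜 𝒵 𝒴, fiberMean P medCov u₄ (medCov x) = 0

theorem FactorDecomposition.mem {f u₁ u₂ u₃ u₄ : Obs 𝒞 𝒜 𝒵 𝒴 → ℝ}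
    (h : FactorDecomposition P f u₁ u₂ u₃ u₄) : f ∈ factorTangentSpace P := by
  -- A base point fills in the coordinates on which a given component does not depend.
  obtain ⟨⟨c₀, b₀, z₀, y₀⟩⟩ := nonempty_of_isProbabilityMeasure P
  have e₁ : (fun x => u₁ (cov x, b₀, z₀, y₀)) = u₁ := funext fun x => h.factors₁ rfl
  have e₂ : (fun x => u₂ (cov x, trt x, z₀, y₀)) = u₂ := funext fun x => h.factors₂ rfl
  have e₃ : (fun x => u₃ (cov x, trt x, med x, y₀)) = u₃ := funext fun x => h.factors₃ rfl
  have e₄ : (fun x => u₄ (cov x, b₀, med x, outV x)) = u₄ := funext fun x => h.factors₄ rfl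
  refine ⟨fun c => u₁ (c, b₀, z₀, y₀), fun b c => u₂ (c, b, z₀, y₀),
    fun z b c => u₃ (c, b, z, y₀), fun y z c => u₄ (c, b₀, z, y), fun x => ?_, ?_, ?_, ?_, ?_,
    ?_, fun c => ?_, fun b c => ?_, fun z c => ?_⟩
  · rw [h.sum, ← congrFun e₁ x, ← congrFun e₂ x, ← congrFun e₃ x, ← congrFun e₄ x]
  · rw [e₁]; exact h.memLp₁
  · rw [e₂]; exact h.memLp₂
  · rw [e₃]; exact h.memLp₃
  · rw [e₄]; exact h.memLp₄
  · rw [e₁]; exact h.mean₁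
  · rw [← h.mean₂ (c, b₀, z₀, y₀)]
    exact fiberMean_congr (V := cov) (v := c) fun x hx => h.factors₂ (Prod.ext rfl hx.symm)
  · rw [← h.mean₃ (c, b, z₀, y₀), ← trtCov_fiber]
    refine fiberMean_congr (V := trtCov) (v := (b, c)) fun x hx => h.factors₃ ?_
    simp only [trtCov, Prod.mk.injEq] at hx
    exact Prod.ext hx.1.symm (Prod.ext rfl hx.2.symm)
  · rw [← h.mean₄ (c, b₀, z, y₀), ← medCov_fiber]
    refine fiberMean_congr (V := medCov) (v := (z, c)) fun x hx => h.factors₄ ?_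
    simp only [medCov, Prod.mk.injEq] at hx
    exact Prod.ext rfl (Prod.ext hx.1.symm hx.2.symm)

theorem exists_factorDecomposition {f : Obs 𝒞 𝒜 𝒵 𝒴 → ℝ} (hf : f ∈ factorTangentSpace P) :
    ∃ u₁ u₂ u₃ u₄, FactorDecomposition P f u₁ u₂ u₃ u₄ := by
  obtain ⟨s₁, s₂, s₃, s₄, hs, m₁, m₂, m₃, m₄, i₁, i₂, i₃, i₄⟩ := hf
  refine ⟨_, _, _, _, hs, fun x y h => ?_, fun x y h => ?_, fun x y h => ?_, fun x y h => ?_,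
    m₁, m₂, m₃, m₄, i₁, fun x => ?_, fun x => ?_, fun x => ?_⟩
  · simp only [h]
  · simp only [trtCov, Prod.mk.injEq] at h
    simp only [h.1, h.2]
  · simp only [trtMedCov, Prod.mk.injEq] at h
    simp only [h.1, h.2.1, h.2.2]
  · simp only [outMedCov, Prod.mk.injEq] at h
    simp only [h.1, h.2.1, h.2.2]
  · rw [← i₂ (cov x)]
    exact fiberMean_congr (V := cov) fun y hy => by rw [hy]
  · rw [← i₃ (trt x) (cov x), ← trtCov_fiber]
    refine fiberMean_congr (V := trtCov) fun y hy => ?_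
    simp only [trtCov, Prod.mk.injEq] at hy
    rw [hy.1, hy.2]
  · rw [← i₄ (med x) (cov x), ← medCov_fiber]
    refine fiberMean_congr (V := medCov) fun y hy => ?_
    simp only [medCov, Prod.mk.injEq] at hy
    rw [hy.1, hy.2]

variable (hpos : ∀ x, 0 < P.real {x})
  (hind : CondIndepDiscrete P outV trt (fun x => (med x, cov x)))
include hpos

/-- Functions whose residual given treatment, mediator and covariate does not involve the
treatment lie in the factor tangent space. -/
theorem factorDecomposition_of_residual {f : Obs 𝒞 𝒜 𝒵 𝒴 → ℝ} (hf : MemLp f 2 P)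
    (h0 : ∫ x, f x ∂P = 0)
    (hr : (fun x => f x - fiberMean P trtMedCov f (trtMedCov x)).FactorsThrough outMedCov) :
    FactorDecomposition P f (fun x => fiberMean P cov f (cov x))
      (fun x => fiberMean P trtCov f (trtCov x) - fiberMean P cov f (cov x))
      (fun x => fiberMean P trtMedCov f (trtMedCov x) - fiberMean P trtCov f (trtCov x))
      (fun x => f x - fiberMean P trtMedCov f (trtMedCov x)) := by
  have hi : Integrable f P := hf.integrable (by norm_num)
  have m₁ := memLp_fiberMean hpos cov hf
  have m₂ := memLp_fiberMean hpos trtCov hf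
  have m₃ := memLp_fiberMean hpos trtMedCov hf
  have i₁ := integrable_fiberMean hpos cov hi
  have i₂ := integrable_fiberMean hpos trtCov hi
  have i₃ := integrable_fiberMean hpos trtMedCov hi
  refine ⟨fun x => by ring, fun x y h => by simp only [h], fun x y h => ?_, fun x y h => ?_, hr,
    m₁, m₂.sub m₁, m₃.sub m₂, hf.sub m₃, ?_, fun x => ?_, fun x => ?_, fun x => ?_⟩
  · have h' : cov x = cov y := (Prod.ext_iff.1 h).2
    simp only [h, h']
  · have h' : trtCov x = trtCov y := by
      simp only [trtMedCov, Prod.mk.injEq] at h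
      exact Prod.ext h.1 h.2.2
    simp only [h, h']
  · rw [integral_fiberMean hpos cov hi, h0]
  · rw [fiberMean_sub i₂ i₁, fiberMean_fiberMean hpos trtCov cov Prod.snd (fun _ => rfl) hi,
      fiberMean_fiberMean hpos cov cov id (fun _ => rfl) hi, sub_self]
  · rw [fiberMean_sub i₃ i₂, fiberMean_fiberMean hpos trtMedCov trtCov (fun p => (p.1, p.2.2))
      (fun _ => rfl) hi, fiberMean_fiberMean hpos trtCov trtCov id (fun _ => rfl) hi, sub_self]
  · rw [fiberMean_sub hi i₃, fiberMean_fiberMean hpos trtMedCov medCov Prod.snd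
      (fun _ => rfl) hi, sub_self]

omit hpos in
/-- The kernel representing evaluation at `x` of the residual given treatment, mediator and
covariate. -/
def residualKernel (P : Measure (Obs 𝒞 𝒜 𝒵 𝒴)) (x : Obs 𝒞 𝒜 𝒵 𝒴) : Obs 𝒞 𝒜 𝒵 𝒴 → ℝ := fun w =>
  ({x} : Set (Obs 𝒞 𝒜 𝒵 𝒴)).indicator (fun _ => (P.real {x})⁻¹) w -
    {w | trtMedCov w = trtMedCov x}.indicator
      (fun _ => (P.real {w | trtMedCov w = trtMedCov x})⁻¹) w

omit hpos in
theorem memLp_residualKernel (x : Obs 𝒞 𝒜 𝒵 𝒴) : MemLp (residualKernel P x) 2 P := by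
  have h1 : MemLp (({x} : Set (Obs 𝒞 𝒜 𝒵 𝒴)).indicator fun _ => (P.real {x})⁻¹) 2 P :=
    (memLp_const _).indicator MeasurableSet.of_discrete
  have h2 : MemLp ({w | trtMedCov w = trtMedCov x}.indicator
      fun _ => (P.real {w | trtMedCov w = trtMedCov x})⁻¹) 2 P :=
    (memLp_const _).indicator MeasurableSet.of_discrete
  exact h1.sub h2

theorem integral_residualKernel_mul {f : Obs 𝒞 𝒜 𝒵 𝒴 → ℝ} (hf : MemLp f 2 P)
    (x : Obs 𝒞 𝒜 𝒵 𝒴) : ∫ w, residualKernel P x w * f w ∂P =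
      f x - fiberMean P trtMedCov f (trtMedCov x) := by
  have hi : Integrable f P := hf.integrable (by norm_num)
  have e : ∀ (s : Set (Obs 𝒞 𝒜 𝒵 𝒴)) (k : ℝ),
      (fun w => s.indicator (fun _ => k) w * f w) = s.indicator (fun w => k * f w) := by
    intro s k; funext w
    by_cases hw : w ∈ s <;> simp [hw]
  simp_rw [residualKernel, sub_mul]
  rw [integral_sub, e, e, integral_indicator MeasurableSet.of_discrete,
    integral_indicator MeasurableSet.of_discrete, integral_const_mul, integral_const_mul,
    fiberMean_eq, integral_singleton, smul_eq_mul, inv_mul_cancel_left₀ (hpos x).ne']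
  · rw [e]; exact (hi.const_mul _).indicator MeasurableSet.of_discrete
  · rw [e]; exact (hi.const_mul _).indicator MeasurableSet.of_discrete

theorem integral_residualKernel_sub_mul {f : Obs 𝒞 𝒜 𝒵 𝒴 → ℝ} (hf : MemLp f 2 P)
    (x y : Obs 𝒞 𝒜 𝒵 𝒴) : ∫ w, (residualKernel P x w - residualKernel P y w) * f w ∂P =
      (f x - fiberMean P trtMedCov f (trtMedCov x)) -
        (f y - fiberMean P trtMedCov f (trtMedCov y)) := by
  have i1 : Integrable (fun w => residualKernel P x w * f w) P :=
    (memLp_residualKernel x).integrable_mul hf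
  have i2 : Integrable (fun w => residualKernel P y w * f w) P :=
    (memLp_residualKernel y).integrable_mul hf
  simp_rw [sub_mul]
  rw [integral_sub i1 i2, integral_residualKernel_mul hpos hf, integral_residualKernel_mul hpos hf]

include hind

/-- This is the conditional independence Y ⊥ A | Z, C, in the form in which it acts on scores of the
outcome factor. -/
theorem fiberMean_trtMedCov_outMedCov {u : Obs 𝒞 𝒜 𝒵 𝒴 → ℝ} (hu : u.FactorsThrough outMedCov)
    (x : Obs 𝒞 𝒜 𝒵 𝒴) :
    fiberMean P trtMedCov u (trtMedCov x) = fiberMean P medCov u (medCov x) := by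
  have h := fiberMean_outV_eq hpos hind (fun y => u (cov x, trt x, med x, y)) (trt x) (med x)
    (cov x)
  refine Eq.trans ?_ (h.trans ?_)
  · refine fiberMean_congr fun y hy => hu ?_
    simp only [trtMedCov, Prod.mk.injEq] at hy
    exact Prod.ext rfl (Prod.ext hy.2.1 hy.2.2)
  · refine fiberMean_congr fun y hy => hu ?_
    simp only [Prod.mk.injEq, medCov] at hy
    exact Prod.ext rfl (Prod.ext hy.1.symm hy.2.symm)

/-- The first three components are functions of (A,Z,C) and drop out; the fourth has mean zero given
(Z,C), hence also given (A,Z,C). -/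
theorem FactorDecomposition.residual {f u₁ u₂ u₃ u₄ : Obs 𝒞 𝒜 𝒵 𝒴 → ℝ}
    (h : FactorDecomposition P f u₁ u₂ u₃ u₄) (x : Obs 𝒞 𝒜 𝒵 𝒴) :
    f x - fiberMean P trtMedCov f (trtMedCov x) = u₄ x := by
  have i₁ : Integrable u₁ P := h.memLp₁.integrable (by norm_num)
  have i₂ : Integrable u₂ P := h.memLp₂.integrable (by norm_num)
  have i₃ : Integrable u₃ P := h.memLp₃.integrable (by norm_num)
  have i₄ : Integrable u₄ P := h.memLp₄.integrable (by norm_num)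
  have j : Integrable (fun x => u₁ x + u₂ x + u₃ x) P := (i₁.add i₂).add i₃
  have e : fiberMean P trtMedCov (fun x => u₁ x + u₂ x + u₃ x) (trtMedCov x)
      = u₁ x + u₂ x + u₃ x := fiberMean_const_of hpos x fun y hy => by
    rw [h.factors₃ hy, trtCov_factorsThrough_trtMedCov h.factors₂ hy,
      trtCov_factorsThrough_trtMedCov (cov_factorsThrough_trtCov h.factors₁) hy]
  rw [show f = fun x => (u₁ x + u₂ x + u₃ x) + u₄ x from funext h.sum, fiberMean_add j i₄, e,
    fiberMean_trtMedCov_outMedCov hpos hind h.factors₄, h.mean₄]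
  ring

/-- Replaces the existential decomposition by linear conditions on f, from which linearity and
closedness can be read off. The components are recovered as the successive differences of E(f|C),
E(f|A,C), E(f|A,Z,C) and f. -/
theorem mem_factorTangentSpace_iff {f : Obs 𝒞 𝒜 𝒵 𝒴 → ℝ} :
    f ∈ factorTangentSpace P ↔ MemLp f 2 P ∧ ∫ x, f x ∂P = 0 ∧
      (fun x => f x - fiberMean P trtMedCov f (trtMedCov x)).FactorsThrough outMedCov := by
  refine ⟨fun hf => ?_, fun ⟨h1, h2, h3⟩ => (factorDecomposition_of_residual hpos h1 h2 h3).mem⟩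
  obtain ⟨u₁, u₂, u₃, u₄, h⟩ := exists_factorDecomposition hf
  have i₁ : Integrable u₁ P := h.memLp₁.integrable (by norm_num)
  have i₂ : Integrable u₂ P := h.memLp₂.integrable (by norm_num)
  have i₃ : Integrable u₃ P := h.memLp₃.integrable (by norm_num)
  have i₄ : Integrable u₄ P := h.memLp₄.integrable (by norm_num)
  have e : f = fun x => u₁ x + u₂ x + u₃ x + u₄ x := funext h.sum
  refine ⟨?_, ?_, fun x y hxy => ?_⟩
  · rw [e]
    exact ((h.memLp₁.add h.memLp₂).add h.memLp₃).add h.memLp₄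
  · have j₁₂ : Integrable (fun x => u₁ x + u₂ x) P := i₁.add i₂
    have j : Integrable (fun x => u₁ x + u₂ x + u₃ x) P := j₁₂.add i₃
    rw [e, integral_add j i₄, integral_add j₁₂ i₃, integral_add i₁ i₂, h.mean₁,
      ← integral_fiberMean hpos cov i₂, ← integral_fiberMean hpos trtCov i₃,
      ← integral_fiberMean hpos medCov i₄]
    simp [h.mean₂, h.mean₃, h.mean₄]
  · simp only [h.residual hpos hind]
    exact h.factors₄ hxy

/-- The factor tangent space is a linear subspace. -/
def factorSubmodule : Submodule ℝ (Obs 𝒞 𝒜 𝒵 𝒴 → ℝ) where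
  carrier := factorTangentSpace P
  zero_mem' := by
    refine (mem_factorTangentSpace_iff hpos hind).2 ⟨MemLp.zero', by simp, ?_⟩
    intro x y _
    simp [fiberMean]
  add_mem' := by
    intro f g hf hg
    obtain ⟨f1, f2, f3⟩ := (mem_factorTangentSpace_iff hpos hind).1 hf
    obtain ⟨g1, g2, g3⟩ := (mem_factorTangentSpace_iff hpos hind).1 hg
    have fi : Integrable f P := f1.integrable (by norm_num)
    have gi : Integrable g P := g1.integrable (by norm_num)
    refine (mem_factorTangentSpace_iff hpos hind).2 ⟨f1.add g1, ?_, fun x y hxy => ?_⟩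
    · rw [show (∫ x, (f + g) x ∂P) = ∫ x, (f x + g x) ∂P from rfl, integral_add fi gi, f2, g2,
        add_zero]
    · have k := congrArg₂ (· + ·) (f3 hxy) (g3 hxy)
      rw [show f + g = fun x => f x + g x from rfl]
      simp only [fiberMean_add fi gi] at k ⊢
      linarith
  smul_mem' := by
    intro r f hf
    obtain ⟨f1, f2, f3⟩ := (mem_factorTangentSpace_iff hpos hind).1 hf
    refine (mem_factorTangentSpace_iff hpos hind).2 ⟨f1.const_smul r, ?_, fun x y hxy => ?_⟩
    · rw [show (∫ x, (r • f) x ∂P) = ∫ x, r * f x ∂P from rfl, integral_const_mul, f2, mul_zero]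
    · have k := congrArg (r * ·) (f3 hxy)
      rw [show r • f = fun x => r * f x from rfl]
      simp only [fiberMean_const_mul] at k ⊢
      linarith

/-- The factor tangent space is closed in mean square. -/
theorem mem_factorTangentSpace_of_approx {f : Obs 𝒞 𝒜 𝒵 𝒴 → ℝ} (hf : MemLp f 2 P)
    (h : ∀ ε > 0, ∃ s ∈ factorTangentSpace P, ∫ x, (f x - s x) ^ 2 ∂P < ε) :
    f ∈ factorTangentSpace P := by
  have key : ∀ g : Obs 𝒞 𝒜 𝒵 𝒴 → ℝ, MemLp g 2 P →
      (∀ s ∈ factorTangentSpace P, ∫ x, g x * s x ∂P = 0) → ∫ x, g x * f x ∂P = 0 := by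
    intro g hg hgs
    refine integral_mul_eq_zero_of_approx hg hf fun ε hε => ?_
    obtain ⟨s, hs, hlt⟩ := h ε hε
    exact ⟨s, ((mem_factorTangentSpace_iff hpos hind).1 hs).1, hlt, hgs s hs⟩
  refine (mem_factorTangentSpace_iff hpos hind).2 ⟨hf, ?_, fun x y hxy => ?_⟩
  · have := key (fun _ => 1) (memLp_const 1) fun s hs => by
      simpa using ((mem_factorTangentSpace_iff hpos hind).1 hs).2.1
    simpa using this
  · have h1 := key (fun w => residualKernel P x w - residualKernel P y w)
      ((memLp_residualKernel x).sub (memLp_residualKernel y)) fun s hs => by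
        obtain ⟨s1, -, s3⟩ := (mem_factorTangentSpace_iff hpos hind).1 hs
        have := s3 hxy
        rw [integral_residualKernel_sub_mul hpos s1]
        exact sub_eq_zero.2 this
    rw [integral_residualKernel_sub_mul hpos hf] at h1
    exact sub_eq_zero.1 h1

end FactorTangent

/-! ### The common form of the three influence functions. -/

section Influence

variable {𝒞 𝒜 𝒵 : Type*} {𝒴 : Set ℝ}
  [Countable 𝒞] [Countable 𝒜] [Countable 𝒵] [Countable 𝒴]
  [MeasurableSpace 𝒞] [MeasurableSpace 𝒜] [MeasurableSpace 𝒵]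
  [DiscreteMeasurableSpace 𝒞] [DiscreteMeasurableSpace 𝒜] [DiscreteMeasurableSpace 𝒵]

/-- `Y - E(Y | Z, C)`. -/
def outcomeResidual (P : Measure (Obs 𝒞 𝒜 𝒵 𝒴)) (x : Obs 𝒞 𝒜 𝒵 𝒴) : ℝ :=
  out x - meanZC P (med x) (cov x)

/-- The weight of the outcome residual in `phiBD`. -/
def weightBD (P : Measure (Obs 𝒞 𝒜 𝒵 𝒴)) (aStar a : 𝒜) (x : Obs 𝒞 𝒜 𝒵 𝒴) : ℝ :=
  (ind aStar x - ind a x) / pA P (trt x) (cov x)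

/-- The weight of the outcome residual in `phiTD`. -/
def weightTD (P : Measure (Obs 𝒞 𝒜 𝒵 𝒴)) (aStar a : 𝒜) (x : Obs 𝒞 𝒜 𝒵 𝒴) : ℝ :=
  (pZ P (med x) aStar (cov x) - pZ P (med x) a (cov x)) / pZ P (med x) (trt x) (cov x)

/-- The weight of the outcome residual in `phiBDTD`. -/
def weightBDTD (P : Measure (Obs 𝒞 𝒜 𝒵 𝒴)) (aStar a : 𝒜) (x : Obs 𝒞 𝒜 𝒵 𝒴) : ℝ :=
  (pZ P (med x) aStar (cov x) - pZ P (med x) a (cov x)) /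
    ∑' b, pZ P (med x) b (cov x) * pA P b (cov x)

/-- The score of the mediator factor in the influence functions. -/
def mediatorPart (P : Measure (Obs 𝒞 𝒜 𝒵 𝒴)) (aStar a : 𝒜) (x : Obs 𝒞 𝒜 𝒵 𝒴) : ℝ :=
  (meanZC P (med x) (cov x) - meanAC P (trt x) (cov x)) * weightBD P aStar a x

/-- The conditional effect given the covariate. -/
def covariatePart (P : Measure (Obs 𝒞 𝒜 𝒵 𝒴)) (aStar a : 𝒜) (x : Obs 𝒞 𝒜 𝒵 𝒴) : ℝ :=
  meanAC P aStar (cov x) - meanAC P a (cov x)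

variable {P : Measure (Obs 𝒞 𝒜 𝒵 𝒴)} {aStar a : 𝒜}

theorem ind_congr (b : 𝒜) {x y : Obs 𝒞 𝒜 𝒵 𝒴} (h : trt x = trt y) : ind b x = ind b y := by
  by_cases hb : trt x = b
  · rw [ind_of_eq hb, ind_of_eq (h.symm.trans hb)]
  · rw [ind_of_ne hb, ind_of_ne (h ▸ hb)]

theorem weightBD_factorsThrough :
    (weightBD P aStar a : Obs 𝒞 𝒜 𝒵 𝒴 → ℝ).FactorsThrough trtCov := by
  intro x y h
  simp only [trtCov, Prod.mk.injEq] at h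
  rw [weightBD, weightBD, ind_congr aStar h.1, ind_congr a h.1, h.1, h.2]

theorem weightTD_factorsThrough :
    (weightTD P aStar a : Obs 𝒞 𝒜 𝒵 𝒴 → ℝ).FactorsThrough trtMedCov := by
  intro x y h
  simp only [trtMedCov, Prod.mk.injEq] at h
  rw [weightTD, weightTD, h.1, h.2.1, h.2.2]

theorem weightBDTD_factorsThrough_medCov :
    (weightBDTD P aStar a : Obs 𝒞 𝒜 𝒵 𝒴 → ℝ).FactorsThrough medCov := by
  intro x y h
  simp only [medCov, Prod.mk.injEq] at h
  rw [weightBDTD, weightBDTD, h.1, h.2]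

theorem weightBDTD_factorsThrough :
    (weightBDTD P aStar a : Obs 𝒞 𝒜 𝒵 𝒴 → ℝ).FactorsThrough trtMedCov := fun _ _ h =>
  weightBDTD_factorsThrough_medCov (Prod.ext_iff.1 h).2

theorem outcomeResidual_factorsThrough :
    (outcomeResidual P : Obs 𝒞 𝒜 𝒵 𝒴 → ℝ).FactorsThrough outMedCov := by
  intro x y h
  simp only [outMedCov, Prod.mk.injEq] at h
  rw [outcomeResidual, outcomeResidual, out, out, h.1, h.2.1, h.2.2]

theorem mediatorPart_factorsThrough :
    (mediatorPart P aStar a : Obs 𝒞 𝒜 𝒵 𝒴 → ℝ).FactorsThrough trtMedCov := by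
  intro x y h
  have h' := h
  simp only [trtMedCov, Prod.mk.injEq] at h
  rw [mediatorPart, mediatorPart, trtCov_factorsThrough_trtMedCov weightBD_factorsThrough h',
    h.1, h.2.1, h.2.2]

theorem covariatePart_factorsThrough :
    (covariatePart P aStar a : Obs 𝒞 𝒜 𝒵 𝒴 → ℝ).FactorsThrough cov := by
  intro x y h
  rw [covariatePart, covariatePart, h]

theorem weightBD_of_ne {x : Obs 𝒞 𝒜 𝒵 𝒴} (h1 : trt x ≠ aStar) (h2 : trt x ≠ a) :
    weightBD P aStar a x = 0 := by
  simp [weightBD, ind_of_ne h1, ind_of_ne h2]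

theorem ind_div_pA (b : 𝒜) (x : Obs 𝒞 𝒜 𝒵 𝒴) :
    ind b x / pA P b (cov x) = ind b x / pA P (trt x) (cov x) := by
  by_cases hb : trt x = b
  · rw [hb]
  · simp [ind_of_ne hb]

/-- Y - E(Y|A,C) is split as R + (E(Y|Z,C) - E(Y|A,C)); the second term times the weight is the
mediator part. This is algebra, valid for any law. -/
theorem phiBD_eq (θ : ℝ) (x : Obs 𝒞 𝒜 𝒵 𝒴) :
    phiBD P aStar a θ x = outcomeResidual P x * weightBD P aStar a x
      + mediatorPart P aStar a x + (covariatePart P aStar a x - θ) := by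
  have e : ∀ b, ind b x / pA P b (cov x) * meanAC P b (cov x)
      = ind b x / pA P (trt x) (cov x) * meanAC P (trt x) (cov x) := by
    intro b
    by_cases hb : trt x = b
    · rw [hb]
    · simp [ind_of_ne hb]
  rw [phiBD, mul_sub, mul_sub, e, e, ind_div_pA, ind_div_pA, outcomeResidual, mediatorPart,
    covariatePart, weightBD]
  ring

variable [IsProbabilityMeasure P] (hpos : ∀ x, 0 < P.real {x})
  (hind : CondIndepDiscrete P outV trt (fun x => (med x, cov x)))
  (hGs : Integrable (fun x => out x * (ind aStar x / pA P aStar (cov x))) P)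
  (hG : Integrable (fun x => out x * (ind a x / pA P a (cov x))) P)
include hpos hind

/-- With (y,z,c) fixed, only the denominator p(z|A,c) is random, and its reciprocal averages to 1/q
by `fiberMean_inv_pZ`. -/
theorem fiberMean_outMedCov_weightTD (x : Obs 𝒞 𝒜 𝒵 𝒴) :
    fiberMean P outMedCov (weightTD P aStar a) (outMedCov x) = weightBDTD P aStar a x := by
  rw [weightBDTD, div_eq_mul_inv, ← fiberMean_inv_pZ hpos hind (outV x), ← fiberMean_const_mul]
  refine fiberMean_congr fun y hy => ?_
  simp only [outMedCov, Prod.mk.injEq] at hy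
  rw [weightTD, hy.2.1, hy.2.2, div_eq_mul_inv]

/-- By Bayes, P(A=a|y,z,c)/p(a|c) = p(z|a,c)/q, and likewise for a*. So the back-door weight has the
same conditional mean as the two-door weight. -/
theorem fiberMean_outMedCov_weightBD (x : Obs 𝒞 𝒜 𝒵 𝒴) :
    fiberMean P outMedCov (weightBD P aStar a) (outMedCov x) = weightBDTD P aStar a x := by
  have hI : ∀ b : 𝒜, Integrable (ind b : Obs 𝒞 𝒜 𝒵 𝒴 → ℝ) P := fun b =>
    (integrable_const (1 : ℝ)).indicator MeasurableSet.of_discrete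
  have e : fiberMean P outMedCov (weightBD P aStar a) (outMedCov x) =
      fiberMean P outMedCov (fun y => (pA P aStar (cov x))⁻¹ * ind aStar y
        - (pA P a (cov x))⁻¹ * ind a y) (outMedCov x) := by
    refine fiberMean_congr fun y hy => ?_
    simp only [outMedCov, Prod.mk.injEq] at hy
    rw [weightBD, sub_div, ← ind_div_pA, ← ind_div_pA, hy.2.2]
    ring
  have h1 := pA_pos hpos aStar (cov x)
  have h2 := pA_pos hpos a (cov x)
  rw [e, fiberMean_sub ((hI _).const_mul _) ((hI _).const_mul _), fiberMean_const_mul,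
    fiberMean_const_mul, outMedCov, fiberMean_outMedCov_ind hpos hind,
    fiberMean_outMedCov_ind hpos hind, weightBDTD]
  field_simp

include hGs hG

/-- The series is known to sum to E(Y|A,C) only in the arms a* and a; elsewhere the weight is 0 and
the value of the series is irrelevant. -/
theorem tsum_meanZC_mul_pZ_mul_weightBD (x : Obs 𝒞 𝒜 𝒵 𝒴) :
    (∑' z, meanZC P z (cov x) * pZ P z (trt x) (cov x)) * weightBD P aStar a x
      = meanAC P (trt x) (cov x) * weightBD P aStar a x := by
  by_cases h1 : trt x = aStar
  · rw [h1, (hasSum_meanZC_mul_pZ hpos hind hGs (cov x)).tsum_eq]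
  by_cases h2 : trt x = a
  · rw [h2, (hasSum_meanZC_mul_pZ hpos hind hG (cov x)).tsum_eq]
  · rw [weightBD_of_ne h1 h2, mul_zero, mul_zero]

theorem tsum_meanZC_mul_pZ_sub (c : 𝒞) :
    ∑' z, meanZC P z c * (pZ P z aStar c - pZ P z a c) = meanAC P aStar c - meanAC P a c := by
  simp_rw [mul_sub]
  exact ((hasSum_meanZC_mul_pZ hpos hind hGs c).sub (hasSum_meanZC_mul_pZ hpos hind hG c)).tsum_eq

theorem phiBDTD_eq (θ : ℝ) (x : Obs 𝒞 𝒜 𝒵 𝒴) :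
    phiBDTD P aStar a θ x = outcomeResidual P x * weightBDTD P aStar a x
      + mediatorPart P aStar a x + (covariatePart P aStar a x - θ) := by
  have e := tsum_meanZC_mul_pZ_mul_weightBD hpos hind hGs hG x
  rw [weightBD] at e
  rw [phiBDTD, tsum_meanZC_mul_pZ_sub hpos hind hGs hG, outcomeResidual, mediatorPart,
    covariatePart, weightBDTD, sub_mul (meanZC P _ _), sub_mul (meanZC P _ _), weightBD, e]
  ring

theorem phiTD_eq (θ : ℝ) (x : Obs 𝒞 𝒜 𝒵 𝒴) :
    phiTD P aStar a θ x = outcomeResidual P x * weightTD P aStar a x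
      + mediatorPart P aStar a x + (covariatePart P aStar a x - θ) := by
  have e := tsum_meanZC_mul_pZ_mul_weightBD hpos hind hGs hG x
  rw [weightBD] at e
  simp only [phiTD, meanAZC_eq_meanZC hpos hind, tsum_mul_left, tsum_mul_right,
    (hasSum_pA hpos (cov x)).tsum_eq, mul_one]
  rw [tsum_meanZC_mul_pZ_sub hpos hind hGs hG, outcomeResidual, mediatorPart,
    covariatePart, weightTD, sub_mul (meanZC P _ _), sub_mul (meanZC P _ _), weightBD, e]
  ring

omit hpos hind [IsProbabilityMeasure P] in
theorem integrable_out_mul_weightBD : Integrable (fun x => out x * weightBD P aStar a x) P := by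
  refine (hGs.sub hG).congr (ae_of_all _ fun x => ?_)
  simp only [Pi.sub_apply, ind_div_pA, weightBD]
  ring

omit hGs in
theorem fiberMean_trtMedCov_outcomeResidual (x : Obs 𝒞 𝒜 𝒵 𝒴) :
    fiberMean P trtMedCov (outcomeResidual P) (trtMedCov x) = 0 := by
  have hi : Integrable out (ProbabilityTheory.cond P
      {y | trtMedCov y = (trt x, med x, cov x)}) := (integrable_outV_iff hpos hind (fun y => (y : ℝ)) (trt x) (med x) (cov x)).2
    (integrable_out_cond_medCov hpos hind hG (med x) (cov x))
  have e : fiberMean P trtMedCov (outcomeResidual P) (trtMedCov x)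
      = fiberMean P trtMedCov (fun y => out y - meanZC P (med x) (cov x)) (trtMedCov x) := by
    refine fiberMean_congr fun y hy => ?_
    simp only [trtMedCov, Prod.mk.injEq] at hy
    rw [outcomeResidual, hy.2.1, hy.2.2]
  have hp : IsProbabilityMeasure
      (ProbabilityTheory.cond P {y | trtMedCov y = (trt x, med x, cov x)}) := by
    rw [trtMedCov_fiber]; exact isProbabilityMeasure_cond_of_pos (trtMedCov_pos hpos _ _ _)
  rw [e, fiberMean, trtMedCov, integral_sub hi (integrable_const _), integral_const]
  rw [show ∫ y, out y ∂(ProbabilityTheory.cond P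
    {y | trtMedCov y = (trt x, med x, cov x)}) = meanAZC P (trt x) (med x) (cov x) from
      (meanAZC_eq _ _ _).symm, meanAZC_eq_meanZC hpos hind]
  simp

omit hGs in
theorem fiberMean_trtMedCov_residual_mul {w : Obs 𝒞 𝒜 𝒵 𝒴 → ℝ} (hw : w.FactorsThrough trtMedCov)
    (x : Obs 𝒞 𝒜 𝒵 𝒴) :
    fiberMean P trtMedCov (fun y => outcomeResidual P y * w y) (trtMedCov x) = 0 := by
  rw [fiberMean_mul_of fun y hy => hw hy, fiberMean_trtMedCov_outcomeResidual hpos hind hG,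
    zero_mul]

omit hGs in
theorem fiberMean_medCov_outcomeResidual (x : Obs 𝒞 𝒜 𝒵 𝒴) :
    fiberMean P medCov (outcomeResidual P) (medCov x) = 0 := by
  rw [← fiberMean_trtMedCov_outMedCov hpos hind outcomeResidual_factorsThrough]
  exact fiberMean_trtMedCov_outcomeResidual hpos hind hG x

omit hGs hG hind hpos in
-- R is a function of (Y,Z,C), so conditioning acts on the weight alone.
theorem fiberMean_outMedCov_residual_mul {w : Obs 𝒞 𝒜 𝒵 𝒴 → ℝ}
    (hw : ∀ x, fiberMean P outMedCov w (outMedCov x) = weightBDTD P aStar a x)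
    (x : Obs 𝒞 𝒜 𝒵 𝒴) :
    fiberMean P outMedCov (fun y => outcomeResidual P y * w y) (outMedCov x)
      = outcomeResidual P x * weightBDTD P aStar a x := by
  rw [← hw, mul_comm, ← fiberMean_mul_of fun y hy => outcomeResidual_factorsThrough hy]
  exact fiberMean_congr fun y _ => mul_comm _ _

theorem fiberMean_trtMedCov_out_mul (x : Obs 𝒞 𝒜 𝒵 𝒴) :
    fiberMean P trtMedCov (fun y => out y * weightBD P aStar a y) (trtMedCov x)
      = meanZC P (med x) (cov x) * weightBD P aStar a x := by
  rw [fiberMean_mul_of fun y hy => trtCov_factorsThrough_trtMedCov weightBD_factorsThrough hy,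
    ← meanAZC_eq_meanZC hpos hind (trt x), meanAZC_eq]
  rfl

omit hind hGs hG hpos in
theorem fiberMean_trtCov_out_mul (x : Obs 𝒞 𝒜 𝒵 𝒴) :
    fiberMean P trtCov (fun y => out y * weightBD P aStar a y) (trtCov x)
      = meanAC P (trt x) (cov x) * weightBD P aStar a x := by
  rw [fiberMean_mul_of fun y hy => weightBD_factorsThrough hy, meanAC_eq]
  rfl

omit hind in
theorem fiberMean_cov_out_mul (x : Obs 𝒞 𝒜 𝒵 𝒴) :
    fiberMean P cov (fun y => out y * weightBD P aStar a y) (cov x) = covariatePart P aStar a x := by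
  rw [covariatePart, ← fiberMean_cov_arm hpos hGs, ← fiberMean_cov_arm hpos hG,
    ← fiberMean_sub hGs hG]
  refine fiberMean_congr fun y _ => ?_
  rw [ind_div_pA, ind_div_pA, weightBD]
  ring

omit hind in
theorem integrable_covariatePart : Integrable (covariatePart P aStar a) P := by
  have h := integrable_fiberMean hpos cov (integrable_out_mul_weightBD hGs hG)
  simpa only [fiberMean_cov_out_mul hpos hGs hG] using h

omit hind in
theorem integral_covariatePart :
    ∫ x, covariatePart P aStar a x ∂P = ∫ x, out x * weightBD P aStar a x ∂P := by
  have h := integral_fiberMean hpos cov (integrable_out_mul_weightBD hGs hG)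
  simpa only [fiberMean_cov_out_mul hpos hGs hG] using h

theorem mediatorPart_eq (x : Obs 𝒞 𝒜 𝒵 𝒴) : mediatorPart P aStar a x =
    fiberMean P trtMedCov (fun y => out y * weightBD P aStar a y) (trtMedCov x)
      - fiberMean P trtCov (fun y => out y * weightBD P aStar a y) (trtCov x) := by
  rw [fiberMean_trtMedCov_out_mul hpos hind hGs hG, fiberMean_trtCov_out_mul, mediatorPart]
  ring

theorem integrable_mediatorPart : Integrable (mediatorPart P aStar a) P := by
  have h := integrable_out_mul_weightBD hGs hG
  rw [funext (mediatorPart_eq hpos hind hGs hG)]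
  exact (integrable_fiberMean hpos trtMedCov h).sub (integrable_fiberMean hpos trtCov h)

theorem fiberMean_trtCov_mediatorPart (x : Obs 𝒞 𝒜 𝒵 𝒴) :
    fiberMean P trtCov (mediatorPart P aStar a) (trtCov x) = 0 := by
  have h := integrable_out_mul_weightBD hGs hG
  rw [funext (mediatorPart_eq hpos hind hGs hG), fiberMean_sub
    (integrable_fiberMean hpos trtMedCov h) (integrable_fiberMean hpos trtCov h),
    fiberMean_fiberMean hpos trtMedCov trtCov (fun p => (p.1, p.2.2)) (fun _ => rfl) h,
    fiberMean_fiberMean hpos trtCov trtCov id (fun _ => rfl) h, sub_self]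

theorem integrable_residual_mul_weightBD :
    Integrable (fun x => outcomeResidual P x * weightBD P aStar a x) P := by
  have h := integrable_out_mul_weightBD hGs hG
  have h2 := integrable_fiberMean hpos trtMedCov h
  simp only [fiberMean_trtMedCov_out_mul hpos hind hGs hG] at h2
  refine (h.sub h2).congr (ae_of_all _ fun x => ?_)
  simp only [Pi.sub_apply, outcomeResidual]
  ring

/-- Rw has mean zero given (A,Z,C), the mediator part has mean zero given (A,C), and the covariate
part has mean θ. -/
theorem integral_influence {w : Obs 𝒞 𝒜 𝒵 𝒴 → ℝ} (hw : w.FactorsThrough trtMedCov)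
    (hi : Integrable (fun x => outcomeResidual P x * w x) P) {θ : ℝ}
    (hθ : θ = ∫ x, out x * weightBD P aStar a x ∂P) :
    ∫ x, (outcomeResidual P x * w x + mediatorPart P aStar a x
      + (covariatePart P aStar a x - θ)) ∂P = 0 := by
  have hm := integrable_mediatorPart hpos hind hGs hG
  have hc := integrable_covariatePart hpos hGs hG
  have hrm : Integrable (fun x => outcomeResidual P x * w x + mediatorPart P aStar a x) P :=
    hi.add hm
  have hcθ : Integrable (fun x => covariatePart P aStar a x - θ) P := hc.sub (integrable_const θ)
  rw [integral_add hrm hcθ, integral_add hi hm, ← integral_fiberMean hpos trtMedCov hi,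
    ← integral_fiberMean hpos trtCov hm, integral_sub hc (integrable_const θ),
    integral_covariatePart hpos hGs hG, ← hθ]
  simp [fiberMean_trtMedCov_residual_mul hpos hind hG hw,
    fiberMean_trtCov_mediatorPart hpos hind hGs hG]

/-- The three parts of a square-integrable influence function are square integrable. -/
theorem memLp_influence_parts {w : Obs 𝒞 𝒜 𝒵 𝒴 → ℝ} (hw : w.FactorsThrough trtMedCov) {θ : ℝ}
    (hψ : MemLp (fun x => outcomeResidual P x * w x + mediatorPart P aStar a x
      + (covariatePart P aStar a x - θ)) 2 P) :
    MemLp (fun x => outcomeResidual P x * w x) 2 P ∧ MemLp (mediatorPart P aStar a) 2 P ∧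
      MemLp (fun x => covariatePart P aStar a x - θ) 2 P := by
  have hm := integrable_mediatorPart hpos hind hGs hG
  have hc := integrable_covariatePart hpos hGs hG
  have hcθ : Integrable (fun x => covariatePart P aStar a x - θ) P := hc.sub (integrable_const θ)
  have hb : Integrable (fun x => mediatorPart P aStar a x + (covariatePart P aStar a x - θ)) P :=
    hm.add hcθ
  have hψi := hψ.integrable (by norm_num : (1 : ENNReal) ≤ 2)
  have hi : Integrable (fun x => outcomeResidual P x * w x) P := by
    refine (hψi.sub hb).congr (ae_of_all _ fun x => ?_)
    simp only [Pi.sub_apply]; ring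
  have hcFT : (fun x => covariatePart P aStar a x - θ).FactorsThrough cov := fun x y h => by
    simp only [covariatePart_factorsThrough h]
  -- Conditioning on (A,Z,C) removes Rw, and conditioning the rest on (A,C) removes the mediator
  -- part. Conditional means preserve L², so the parts are differences of L² functions.
  have h1 : MemLp (fun x => mediatorPart P aStar a x + (covariatePart P aStar a x - θ)) 2 P := by
    have h := memLp_fiberMean hpos trtMedCov hψ
    convert h using 2 with x
    simp only [add_assoc]
    rw [fiberMean_add hi hb, fiberMean_trtMedCov_residual_mul hpos hind hG hw, zero_add]
    refine (fiberMean_const_of hpos x fun y hy => ?_).symm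
    rw [mediatorPart_factorsThrough hy, covariatePart_factorsThrough (Prod.ext_iff.1
      (Prod.ext_iff.1 hy).2).2]
  have h2 : MemLp (fun x => covariatePart P aStar a x - θ) 2 P := by
    have h := memLp_fiberMean hpos trtCov h1
    convert h using 2 with x
    rw [fiberMean_add hm hcθ, fiberMean_trtCov_mediatorPart hpos hind hGs hG, zero_add]
    exact (fiberMean_const_of (V := trtCov) hpos x fun y hy =>
      cov_factorsThrough_trtCov hcFT hy).symm
  refine ⟨(hψ.sub h1).ae_eq (ae_of_all _ fun x => ?_), (h1.sub h2).ae_eq (ae_of_all _ fun x => ?_),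
    h2⟩
  · simp only [Pi.sub_apply]; ring
  · simp only [Pi.sub_apply]; ring

theorem memLp_residual_mul_weightBDTD {w : Obs 𝒞 𝒜 𝒵 𝒴 → ℝ}
    (hw : ∀ x, fiberMean P outMedCov w (outMedCov x) = weightBDTD P aStar a x)
    (hm : MemLp (fun x => outcomeResidual P x * w x) 2 P) :
    MemLp (fun x => outcomeResidual P x * weightBDTD P aStar a x) 2 P := by
  have h := memLp_fiberMean hpos outMedCov hm
  simpa only [fiberMean_outMedCov_residual_mul hw] using h

/-- Replacing the weight by its conditional mean given outcome, mediator and covariate leaves the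
pairing with sums of functions of `(A, Z, C)` and of `(Y, Z, C)` unchanged. -/
theorem integral_residual_mul_sub_eq_zero {w u v : Obs 𝒞 𝒜 𝒵 𝒴 → ℝ}
    (hw : w.FactorsThrough trtMedCov)
    (hw' : ∀ x, fiberMean P outMedCov w (outMedCov x) = weightBDTD P aStar a x)
    (hi : Integrable (fun x => outcomeResidual P x * w x) P)
    (hi' : Integrable (fun x => outcomeResidual P x * weightBDTD P aStar a x) P)
    (hu : u.FactorsThrough trtMedCov) (hv : v.FactorsThrough outMedCov)
    (hiu : Integrable (fun x => (outcomeResidual P x * w x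
      - outcomeResidual P x * weightBDTD P aStar a x) * u x) P)
    (hiv : Integrable (fun x => (outcomeResidual P x * w x
      - outcomeResidual P x * weightBDTD P aStar a x) * v x) P) :
    ∫ x, (outcomeResidual P x * w x - outcomeResidual P x * weightBDTD P aStar a x)
      * (u x + v x) ∂P = 0 := by
  simp_rw [mul_add]
  rw [integral_add hiu hiv, integral_mul_eq_zero hpos hiu hu fun x => ?_,
    integral_mul_eq_zero hpos hiv hv fun x => ?_, add_zero]
  · rw [fiberMean_sub hi hi', fiberMean_outMedCov_residual_mul hw', sub_eq_zero]
    refine (fiberMean_const_of hpos x fun y hy => ?_).symm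
    rw [outcomeResidual_factorsThrough hy,
      weightBDTD_factorsThrough_medCov (Prod.ext_iff.1 hy).2]
  · rw [fiberMean_sub hi hi', fiberMean_trtMedCov_residual_mul hpos hind hG hw,
      fiberMean_trtMedCov_residual_mul hpos hind hG weightBDTD_factorsThrough, sub_self]

/-- The decomposition of the efficient influence function into scores of the four factors. -/
theorem factorDecomposition_efficient {θ : ℝ}
    (hθ : θ = ∫ x, out x * weightBD P aStar a x ∂P)
    (h1 : MemLp (fun x => outcomeResidual P x * weightBDTD P aStar a x) 2 P)
    (h2 : MemLp (mediatorPart P aStar a) 2 P)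
    (h3 : MemLp (fun x => covariatePart P aStar a x - θ) 2 P) :
    FactorDecomposition P (phiBDTD P aStar a θ) (fun x => covariatePart P aStar a x - θ)
      (fun _ => 0) (mediatorPart P aStar a)
      (fun x => outcomeResidual P x * weightBDTD P aStar a x) where
  sum x := by rw [phiBDTD_eq hpos hind hGs hG]; ring
  factors₁ x y h := by simp only [covariatePart_factorsThrough h]
  factors₂ x y h := rfl
  factors₃ := mediatorPart_factorsThrough
  factors₄ x y h := by
    simp only [outcomeResidual_factorsThrough h,
      weightBDTD_factorsThrough_medCov (Prod.ext_iff.1 h).2]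
  memLp₁ := h3
  memLp₂ := memLp_const 0
  memLp₃ := h2
  memLp₄ := h1
  mean₁ := by
    rw [integral_sub (integrable_covariatePart hpos hGs hG) (integrable_const θ),
      integral_covariatePart hpos hGs hG, ← hθ]
    simp
  mean₂ x := by simp [fiberMean]
  mean₃ := fiberMean_trtCov_mediatorPart hpos hind hGs hG
  mean₄ x := by
    rw [fiberMean_mul_of fun y hy => weightBDTD_factorsThrough_medCov hy,
      fiberMean_medCov_outcomeResidual hpos hind hG, zero_mul]

end Influence

/-! ### Differentiating integrals of exponential weights. -/

section LogWeight

variable {X : Type*}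

/-- Logarithmic weights vanishing at `0`, differentiable there and uniformly `O(t)`. -/
structure IsLogWeight (l : ℝ → X → ℝ) (S : X → ℝ) (K : ℝ) : Prop where
  zero : ∀ x, l 0 x = 0
  bound : ∀ᶠ t in 𝓝 (0 : ℝ), ∀ x, |l t x| ≤ K * |t|
  deriv : ∀ x, HasDerivAt (fun t => l t x) (S x) 0

theorem IsLogWeight.add {l l' : ℝ → X → ℝ} {S S' : X → ℝ} {K K' : ℝ} (h : IsLogWeight l S K)
    (h' : IsLogWeight l' S' K') :
    IsLogWeight (fun t x => l t x + l' t x) (fun x => S x + S' x) (K + K') where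
  zero x := by simp [h.zero, h'.zero]
  bound := by
    filter_upwards [h.bound, h'.bound] with t h1 h2 x
    exact (abs_add_le _ _).trans (by linarith [h1 x, h2 x])
  deriv x := (h.deriv x).add (h'.deriv x)

theorem IsLogWeight.neg {l : ℝ → X → ℝ} {S : X → ℝ} {K : ℝ} (h : IsLogWeight l S K) :
    IsLogWeight (fun t x => -l t x) (fun x => -S x) K where
  zero x := by simp [h.zero]
  bound := by simpa using h.bound
  deriv x := (h.deriv x).neg

theorem IsLogWeight.hasDerivAt_integral [MeasurableSpace X] [DiscreteMeasurableSpace X]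
    {P : Measure X} {l : ℝ → X → ℝ} {S : X → ℝ} {K : ℝ} (h : IsLogWeight l S K) {G : X → ℝ}
    (hG : Integrable G P) :
    HasDerivAt (fun t => ∫ x, G x * Real.exp (l t x) ∂P) (∫ x, G x * S x ∂P) 0 := by
  refine hasDerivAt_integral_weight (K := 2 * K) hG (fun x => by simp [h.zero]) ?_ fun x => ?_
  · have hs : ∀ᶠ t in 𝓝 (0 : ℝ), K * |t| ≤ 1 := by
      have : Tendsto (fun t : ℝ => K * |t|) (𝓝 0) (𝓝 (K * |0|)) :=
        (continuous_const.mul continuous_abs).tendsto 0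
      rw [abs_zero, mul_zero] at this
      filter_upwards [this.eventually (gt_mem_nhds one_pos)] with t ht using ht.le
    filter_upwards [h.bound, hs] with t h1 h2 x
    have := Real.abs_exp_sub_one_le ((h1 x).trans h2)
    linarith [h1 x]
  · have := (h.deriv x).exp
    simpa [h.zero] using this

end LogWeight

/-! ### Paths of laws with bounded scores, and the scores of their marginals. -/

section LikelihoodPath

variable {X : Type*} [MeasurableSpace X] [DiscreteMeasurableSpace X] [Countable X]

/-- A path of probability measures of full support through `P` whose log-likelihood is
differentiable at `0` with uniformly bounded difference quotients. -/
structure IsLikelihoodPath (P : Measure X) (Pt : ℝ → Measure X) (S : X → ℝ) (K : ℝ) : Prop where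
  nonneg : 0 ≤ K
  base : Pt 0 = P
  prob : ∀ᶠ t in 𝓝 (0 : ℝ), IsProbabilityMeasure (Pt t)
  pos : ∀ᶠ t in 𝓝 (0 : ℝ), ∀ x, 0 < (Pt t).real {x}
  logWeight : IsLogWeight (fun t x => Real.log ((Pt t).real {x}) - Real.log (P.real {x})) S K

/-- The logarithmic likelihood ratio of the law of `V`. -/
def logRatio {γ : Type*} (P : Measure X) (Pt : ℝ → Measure X) (V : X → γ) (t : ℝ) (x : X) : ℝ :=
  Real.log ((Pt t).real {y | V y = V x}) - Real.log (P.real {y | V y = V x})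

variable {P : Measure X} {Pt : ℝ → Measure X} {S : X → ℝ} {K : ℝ}

theorem IsLikelihoodPath.abs_score_le (h : IsLikelihoodPath P Pt S K) (x : X) : |S x| ≤ K := by
  refine (h.logWeight.deriv x).le_of_lip' h.nonneg ?_
  filter_upwards [h.logWeight.bound] with t ht
  rw [h.logWeight.zero, sub_zero, sub_zero]
  exact ht x

theorem IsLikelihoodPath.pos_base (h : IsLikelihoodPath P Pt S K) (x : X) : 0 < P.real {x} := by
  rw [← h.base]
  exact h.pos.self_of_nhds x

theorem IsLikelihoodPath.prob_base (h : IsLikelihoodPath P Pt S K) : IsProbabilityMeasure P := by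
  rw [← h.base]
  exact h.prob.self_of_nhds

theorem exp_log_sub_log {u v : ℝ} (hu : 0 < u) (hv : 0 < v) :
    Real.exp (Real.log u - Real.log v) = u / v := by
  rw [Real.exp_sub, Real.exp_log hu, Real.exp_log hv]

/-- All atoms are positive, so the law at t has density exp of the log-likelihood ratio with respect
to P. The neighbourhood of 0 serves all g at once. -/
theorem IsLikelihoodPath.integral_eq (h : IsLikelihoodPath P Pt S K) :
    ∀ᶠ t in 𝓝 (0 : ℝ), ∀ g : X → ℝ, ∫ x, g x ∂(Pt t) =
      ∫ x, g x * Real.exp (Real.log ((Pt t).real {x}) - Real.log (P.real {x})) ∂P := by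
  have hp := h.prob_base
  filter_upwards [h.prob, h.pos] with t h1 h2 g
  have e : Pt t = P.withDensity fun x => ENNReal.ofReal
      (Real.exp (Real.log ((Pt t).real {x}) - Real.log (P.real {x}))) := by
    refine Measure.ext_of_singleton fun x => ?_
    rw [withDensity_apply _ MeasurableSet.of_discrete, lintegral_singleton,
      exp_log_sub_log (h2 x) (h.pos_base x), ← ofReal_measureReal (μ := P) (s := {x}),
      ← ENNReal.ofReal_mul (by positivity), div_mul_cancel₀ _ (h.pos_base x).ne',
      ofReal_measureReal]
  conv_lhs => rw [e]
  rw [integral_withDensity_eq_integral_toReal_smul Measurable.of_discrete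
    (ae_of_all _ fun x => ENNReal.ofReal_lt_top)]
  congr 1; funext x
  rw [ENNReal.toReal_ofReal (Real.exp_pos _).le, smul_eq_mul, mul_comm]

theorem IsLikelihoodPath.measureReal_eq (h : IsLikelihoodPath P Pt S K) :
    ∀ᶠ t in 𝓝 (0 : ℝ), ∀ A : Set X, (Pt t).real A = ∫ x, A.indicator 1 x *
      Real.exp (Real.log ((Pt t).real {x}) - Real.log (P.real {x})) ∂P := by
  filter_upwards [h.integral_eq] with t ht A
  rw [← ht, integral_indicator_one MeasurableSet.of_discrete]

theorem IsLikelihoodPath.hasDerivAt_measureReal (h : IsLikelihoodPath P Pt S K) (A : Set X) :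
    HasDerivAt (fun t => (Pt t).real A) (∫ x in A, S x ∂P) 0 := by
  have hp := h.prob_base
  have hi : Integrable (A.indicator (1 : X → ℝ)) P :=
    (integrable_const (1 : ℝ)).indicator MeasurableSet.of_discrete
  have := h.logWeight.hasDerivAt_integral hi
  rw [← integral_indicator MeasurableSet.of_discrete]
  have e : (fun x => A.indicator 1 x * S x) = A.indicator S := by
    funext x; by_cases hx : x ∈ A <;> simp [hx]
  rw [e] at this
  refine this.congr_of_eventuallyEq ?_
  filter_upwards [h.measureReal_eq] with t ht using ht A

/-- The pointwise bound on the likelihood ratio integrates to the same bound for every event. This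
makes the log ratio of any marginal uniformly O(t) with the same constant. -/
theorem IsLikelihoodPath.fiber_bounds (h : IsLikelihoodPath P Pt S K) :
    ∀ᶠ t in 𝓝 (0 : ℝ), ∀ A : Set X,
      (Pt t).real A ≤ P.real A * Real.exp (K * |t|) ∧
      P.real A * Real.exp (-(K * |t|)) ≤ (Pt t).real A := by
  have hp := h.prob_base
  filter_upwards [h.measureReal_eq, h.logWeight.bound] with t ht hb A
  have hi : Integrable (A.indicator (1 : X → ℝ)) P :=
    (integrable_const (1 : ℝ)).indicator MeasurableSet.of_discrete
  have h0 : ∀ x, 0 ≤ A.indicator (1 : X → ℝ) x := fun x =>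
    Set.indicator_nonneg (fun _ _ => zero_le_one) x
  have hi2 : Integrable (fun x => A.indicator (1 : X → ℝ) x *
      Real.exp (Real.log ((Pt t).real {x}) - Real.log (P.real {x}))) P := by
    refine hi.mul_bdd (c := Real.exp (K * |t|)) (aestronglyMeasurable_discrete _) (ae_of_all _ fun x => ?_)
    rw [Real.norm_eq_abs, abs_of_pos (Real.exp_pos _)]
    exact Real.exp_le_exp.2 ((abs_le.1 (hb x)).2)
  rw [ht A, ← integral_indicator_one (μ := P) (s := A) MeasurableSet.of_discrete,
    ← integral_mul_const, ← integral_mul_const]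
  constructor
  · exact integral_mono hi2 (hi.mul_const _) fun x => mul_le_mul_of_nonneg_left
      (Real.exp_le_exp.2 ((abs_le.1 (hb x)).2)) (h0 x)
  · exact integral_mono (hi.mul_const _) hi2 fun x => mul_le_mul_of_nonneg_left
      (Real.exp_le_exp.2 ((abs_le.1 (hb x)).1)) (h0 x)

/-- The law of `V` along a likelihood path has score `E(S | V)`. -/
theorem IsLikelihoodPath.isLogWeight_logRatio (h : IsLikelihoodPath P Pt S K) {γ : Type*}
    (V : X → γ) : IsLogWeight (logRatio P Pt V) (fun x => fiberMean P V S (V x)) K where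
  zero x := by rw [logRatio, h.base, sub_self]
  bound := by
    have hp := h.prob_base
    filter_upwards [h.fiber_bounds, h.prob, h.pos] with t hb h1 h2 x
    have p1 := fiber_pos h.pos_base V x
    have p2 := fiber_pos h2 V x
    obtain ⟨b1, b2⟩ := hb {y | V y = V x}
    have l1 := Real.log_le_log p2 b1
    have l2 := Real.log_le_log (mul_pos p1 (Real.exp_pos _)) b2
    rw [Real.log_mul p1.ne' (Real.exp_pos _).ne', Real.log_exp] at l1 l2
    rw [logRatio, abs_le]
    constructor <;> linarith
  deriv x := by
    have hp := h.prob_base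
    have p1 := fiber_pos h.pos_base V x
    have hd := h.hasDerivAt_measureReal {y | V y = V x}
    have := (hd.log (by rw [h.base]; exact p1.ne')).sub_const (Real.log (P.real {y | V y = V x}))
    rw [h.base] at this
    rw [fiberMean_eq, mul_comm, ← div_eq_mul_inv]
    exact this

theorem IsLikelihoodPath.integral_score (h : IsLikelihoodPath P Pt S K) :
    ∫ x, S x ∂P = 0 := by
  have hd := h.hasDerivAt_measureReal Set.univ
  rw [setIntegral_univ] at hd
  refine hd.unique ((hasDerivAt_const (0 : ℝ) (1 : ℝ)).congr_of_eventuallyEq ?_)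
  filter_upwards [h.prob] with t ht
  exact probReal_univ

end LikelihoodPath

/-! ### Scores of regular submodels and the derivative of the causal effect. -/

section Submodel

variable {𝒞 𝒜 𝒵 : Type*} {𝒴 : Set ℝ}
  [Countable 𝒞] [Countable 𝒜] [Countable 𝒵] [Countable 𝒴]
  [MeasurableSpace 𝒞] [MeasurableSpace 𝒜] [MeasurableSpace 𝒵]
  [DiscreteMeasurableSpace 𝒞] [DiscreteMeasurableSpace 𝒜] [DiscreteMeasurableSpace 𝒵]
  {Q₀ : Measure (FullData 𝒞 𝒜 𝒵 𝒴)} {Q : ℝ → Measure (FullData 𝒞 𝒜 𝒵 𝒴)}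
  {S : Obs 𝒞 𝒜 𝒵 𝒴 → ℝ}

theorem exists_isLikelihoodPath
    (h : IsRegularSubmodel (backDoorTwoDoorModel 𝒞 𝒜 𝒵 𝒴) Q₀ Q S) :
    ∃ K, IsLikelihoodPath (obsLaw Q₀) (fun t => obsLaw (Q t)) S K := by
  obtain ⟨K, hK⟩ := h.bound
  refine ⟨|K|, abs_nonneg K, by rw [h.base], ?_, ?_, ⟨fun x => by rw [h.base, sub_self], ?_,
    fun x => (h.score x).sub_const _⟩⟩
  · filter_upwards [h.mem] with t ht using isProbabilityMeasure_obsLaw ht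
  · filter_upwards [h.mem] with t ht using obsLaw_pos ht
  · filter_upwards [hK] with t ht x
    rw [← h.base]
    exact (ht x).trans (mul_le_mul_of_nonneg_right (le_abs_self K) (abs_nonneg t))

/-- The identity p(y|a,z,c) = p(y|z,c) in logarithmic form, ready to be differentiated along a
submodel. -/
theorem log_sub_log_trtMedCov {P : Measure (Obs 𝒞 𝒜 𝒵 𝒴)} [IsProbabilityMeasure P]
    (hpos : ∀ x, 0 < P.real {x})
    (hind : CondIndepDiscrete P outV trt (fun x => (med x, cov x))) (x : Obs 𝒞 𝒜 𝒵 𝒴) :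
    Real.log (P.real {x}) - Real.log (P.real {y | trtMedCov y = trtMedCov x}) =
      Real.log (P.real {y | outMedCov y = outMedCov x})
        - Real.log (P.real {y | medCov y = medCov x}) := by
  have h1 := hpos x
  have h2 := fiber_pos hpos trtMedCov x
  have h3 := fiber_pos hpos outMedCov x
  have h4 := fiber_pos hpos medCov x
  rw [← Real.log_div h1.ne' h2.ne', ← Real.log_div h3.ne' h4.ne']
  congr 1
  rw [div_eq_div_iff h2.ne' h4.ne']
  have key := outcome_indep_treatment hpos hind (outV x) (trt x) (med x) (cov x)
  rw [← medCov_fiber, ← outMedCov_fiber, ← trtMedCov_fiber] at key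
  have e : {y : Obs 𝒞 𝒜 𝒵 𝒴 | outV y = outV x ∧ trt y = trt x ∧ med y = med x ∧ cov y = cov x}
      = {x} := by
    ext y
    simp only [Set.mem_ofPred_eq, Set.mem_singleton_iff]
    constructor
    · rintro ⟨h1, h2, h3, h4⟩
      exact Prod.ext h4 (Prod.ext h2 (Prod.ext h3 h1))
    · rintro rfl; simp
  rw [e] at key
  rw [mul_comm]
  exact key

/-- Scores of regular submodels lie in the factor tangent space. -/
theorem score_mem_factorTangentSpace (hQ₀ : Q₀ ∈ backDoorTwoDoorModel 𝒞 𝒜 𝒵 𝒴)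
    (h : IsRegularSubmodel (backDoorTwoDoorModel 𝒞 𝒜 𝒵 𝒴) Q₀ Q S) :
    S ∈ factorTangentSpace (obsLaw Q₀) := by
  obtain ⟨K, hK⟩ := exists_isLikelihoodPath h
  have hp := hK.prob_base
  refine (mem_factorTangentSpace_iff (obsLaw_pos hQ₀) (condIndep_outcome_treatment hQ₀)).2
    ⟨memLp_of_bdd hK.abs_score_le, hK.integral_score, fun x y hxy => ?_⟩
  -- The derivative of log p_t(y|a,z,c) is the residual of the score. For each small t this
  -- logarithm depends on (y,z,c) only, hence so does the derivative.
  have hd : ∀ z, HasDerivAt (fun t => Real.log ((obsLaw (Q t)).real {z})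
      - Real.log ((obsLaw (Q t)).real {w | trtMedCov w = trtMedCov z}))
      (S z - fiberMean (obsLaw Q₀) trtMedCov S (trtMedCov z)) 0 := by
    intro z
    have h1 := (hK.logWeight.deriv z).add_const (Real.log ((obsLaw Q₀).real {z}))
    have h2 := ((hK.isLogWeight_logRatio trtMedCov).deriv z).add_const
      (Real.log ((obsLaw Q₀).real {w | trtMedCov w = trtMedCov z}))
    simp only [logRatio, sub_add_cancel] at h1 h2
    exact h1.sub h2
  refine (hd x).unique ((hd y).congr_of_eventuallyEq ?_)
  filter_upwards [h.mem] with t ht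
  have hp := isProbabilityMeasure_obsLaw ht
  rw [log_sub_log_trtMedCov (obsLaw_pos ht) (condIndep_outcome_treatment ht),
    log_sub_log_trtMedCov (obsLaw_pos ht) (condIndep_outcome_treatment ht), hxy,
    show medCov x = medCov y from (Prod.ext_iff.1 hxy).2]

/-- Under the law at t the weighted outcome involves p_t(x)/p_t(a|c), where p_t(a|c) =
p_t(a,c)/p_t(c). The three logarithms contribute S, -E(S|A,C) and E(S|C). -/
theorem hasDerivAt_integral_yPot
    (h : IsRegularSubmodel (backDoorTwoDoorModel 𝒞 𝒜 𝒵 𝒴) Q₀ Q S) {a : 𝒜}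
    (hG : Integrable (fun x => out x * (ind a x / pA (obsLaw Q₀) a (cov x))) (obsLaw Q₀)) :
    HasDerivAt (fun t => ∫ w, (yPot a w : ℝ) ∂(Q t))
      (∫ x, out x * (ind a x / pA (obsLaw Q₀) a (cov x)) *
        (S x + -fiberMean (obsLaw Q₀) trtCov S (trtCov x)
          + fiberMean (obsLaw Q₀) cov S (cov x)) ∂(obsLaw Q₀)) 0 := by
  obtain ⟨K, hK⟩ := exists_isLikelihoodPath h
  have hp := hK.prob_base
  have hw := (hK.logWeight.add (hK.isLogWeight_logRatio trtCov).neg).add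
    (hK.isLogWeight_logRatio cov)
  refine (hw.hasDerivAt_integral hG).congr_of_eventuallyEq ?_
  filter_upwards [h.mem, hK.integral_eq] with t ht hint
  have hpt := isProbabilityMeasure_obsLaw ht
  rw [integral_yPot ht, hint]
  congr 1; funext x
  by_cases hx : trt x = a
  · have hs : {y : Obs 𝒞 𝒜 𝒵 𝒴 | trtCov y = trtCov x} = {y | trt y = a ∧ cov y = cov x} := by
      rw [← hx, ← trtCov_fiber]; rfl
    have p1 := trtCov_pos (obsLaw_pos ht) a (cov x)
    have p2 := trtCov_pos hK.pos_base a (cov x)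
    have p3 := covariate_pos (obsLaw_pos ht) (cov x)
    have p4 := covariate_pos hK.pos_base (cov x)
    rw [Real.exp_add, Real.exp_add, Real.exp_neg, logRatio, logRatio, hs,
      exp_log_sub_log p1 p2, exp_log_sub_log p3 p4, pA_eq, pA_eq]
    field_simp
  · simp [ind_of_ne hx]

/-- The average causal effect is differentiable along regular submodels, with derivative given by
the back-door influence function. -/
theorem hasDerivAt_ace (hQ₀ : Q₀ ∈ backDoorTwoDoorModel 𝒞 𝒜 𝒵 𝒴)
    (h : IsRegularSubmodel (backDoorTwoDoorModel 𝒞 𝒜 𝒵 𝒴) Q₀ Q S) {aStar a : 𝒜}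
    (hGs : Integrable (fun x => out x * (ind aStar x / pA (obsLaw Q₀) aStar (cov x))) (obsLaw Q₀))
    (hG : Integrable (fun x => out x * (ind a x / pA (obsLaw Q₀) a (cov x))) (obsLaw Q₀))
    (θ : ℝ) :
    HasDerivAt (fun t => ace aStar a (Q t))
      (∫ x, (outcomeResidual (obsLaw Q₀) x * weightBD (obsLaw Q₀) aStar a x
        + mediatorPart (obsLaw Q₀) aStar a x + (covariatePart (obsLaw Q₀) aStar a x - θ)) * S x
          ∂(obsLaw Q₀)) 0 := by
  obtain ⟨K, hK⟩ := exists_isLikelihoodPath h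
  have hp := hK.prob_base
  have hpos := hK.pos_base
  have hind := condIndep_outcome_treatment hQ₀
  have hS := hK.abs_score_le
  set P := obsLaw Q₀
  have hSi : Integrable S P := (memLp_of_bdd (P := P) hS).integrable (by norm_num)
  have hd := (hasDerivAt_integral_yPot h hGs).sub (hasDerivAt_integral_yPot h hG)
  have hH := integrable_out_mul_weightBD hGs hG
  have hb : ∀ x, ‖S x + -fiberMean P trtCov S (trtCov x) + fiberMean P cov S (cov x)‖ ≤ 3 * K := by
    intro x
    have h1 := abs_fiberMean_le (P := P) (V := trtCov) hK.nonneg hS (trtCov x)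
    have h2 := abs_fiberMean_le (P := P) (V := cov) hK.nonneg hS (cov x)
    have h3 := hS x
    rw [abs_le] at h1 h2 h3
    rw [Real.norm_eq_abs, abs_le]
    constructor <;> linarith
  refine HasDerivAt.congr_deriv hd (Eq.symm ?_)
  change _ = ∫ x, out x * (ind aStar x / pA P aStar (cov x)) *
      (S x + -fiberMean P trtCov S (trtCov x) + fiberMean P cov S (cov x)) ∂P -
    ∫ x, out x * (ind a x / pA P a (cov x)) *
      (S x + -fiberMean P trtCov S (trtCov x) + fiberMean P cov S (cov x)) ∂P
  rw [← integral_sub (hGs.mul_bdd (aestronglyMeasurable_discrete _) (ae_of_all _ hb)) (hG.mul_bdd (aestronglyMeasurable_discrete _) (ae_of_all _ hb))]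
  have mS : ∀ {f : Obs 𝒞 𝒜 𝒵 𝒴 → ℝ}, Integrable f P → Integrable (fun x => f x * S x) P :=
    fun hf => hf.mul_bdd (aestronglyMeasurable_discrete _) (ae_of_all _ hS)
  have iA := integrable_fiberMean hpos trtCov hH
  have iC := integrable_fiberMean hpos cov hH
  have e1 : ∀ x, (outcomeResidual P x * weightBD P aStar a x + mediatorPart P aStar a x
      + (covariatePart P aStar a x - θ)) * S x =
      out x * weightBD P aStar a x * S x
        - fiberMean P trtCov (fun y => out y * weightBD P aStar a y) (trtCov x) * S x
        + fiberMean P cov (fun y => out y * weightBD P aStar a y) (cov x) * S x - θ * S x := by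
    intro x
    rw [fiberMean_trtCov_out_mul, fiberMean_cov_out_mul hpos hGs hG, mediatorPart,
      outcomeResidual]
    ring
  have e2 : ∀ x, out x * (ind aStar x / pA P aStar (cov x)) *
        (S x + -fiberMean P trtCov S (trtCov x) + fiberMean P cov S (cov x))
      - out x * (ind a x / pA P a (cov x)) *
        (S x + -fiberMean P trtCov S (trtCov x) + fiberMean P cov S (cov x)) =
      out x * weightBD P aStar a x * S x
        - out x * weightBD P aStar a x * fiberMean P trtCov S (trtCov x)
        + out x * weightBD P aStar a x * fiberMean P cov S (cov x) := by
    intro x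
    rw [ind_div_pA, ind_div_pA, weightBD]
    ring
  have jA : Integrable (fun x => out x * weightBD P aStar a x * fiberMean P trtCov S (trtCov x)) P :=
    hH.mul_bdd (aestronglyMeasurable_discrete _) (ae_of_all _ fun x => abs_fiberMean_le hK.nonneg hS _)
  have jC : Integrable (fun x => out x * weightBD P aStar a x * fiberMean P cov S (cov x)) P :=
    hH.mul_bdd (aestronglyMeasurable_discrete _) (ae_of_all _ fun x => abs_fiberMean_le hK.nonneg hS _)
  simp_rw [e1, e2]
  have k1 : Integrable (fun x => out x * weightBD P aStar a x * S x
      - out x * weightBD P aStar a x * fiberMean P trtCov S (trtCov x)) P := (mS hH).sub jA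
  have k2 : Integrable (fun x => out x * weightBD P aStar a x * S x
      - fiberMean P trtCov (fun y => out y * weightBD P aStar a y) (trtCov x) * S x) P :=
    (mS hH).sub (mS iA)
  have k3 : Integrable (fun x => out x * weightBD P aStar a x * S x
      - fiberMean P trtCov (fun y => out y * weightBD P aStar a y) (trtCov x) * S x
      + fiberMean P cov (fun y => out y * weightBD P aStar a y) (cov x) * S x) P :=
    k2.add (mS iC)
  -- Self-adjointness moves the conditional means from S to the weighted outcome, and E S = 0
  -- disposes of θ.
  rw [integral_sub k3 (hSi.const_mul θ), integral_add k2 (mS iC), integral_sub (mS hH) (mS iA),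
    integral_add k1 jC, integral_sub (mS hH) jA, integral_const_mul, hK.integral_score,
    integral_mul_fiberMean_comm hpos trtCov hH hK.nonneg hS,
    integral_mul_fiberMean_comm hpos cov hH hK.nonneg hS]
  ring

end Submodel

/-! ### Linear tilts of a probability measure. -/

section Tilt

variable {α : Type*} [MeasurableSpace α] [DiscreteMeasurableSpace α]

/-- The measure with density `1 + t s`. -/
def tilt (ν : Measure α) (s : α → ℝ) (t : ℝ) : Measure α :=
  ν.withDensity fun x => ENNReal.ofReal (1 + t * s x)

theorem abs_mul_le_half {K t v : ℝ} (ht : |t| * (4 * K) ≤ 1) (hv : |v| ≤ 2 * K) :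
    |t * v| ≤ 1 / 2 := by
  rw [abs_mul]
  nlinarith [abs_nonneg t]

variable {ν : Measure α} [IsProbabilityMeasure ν] {s : α → ℝ} {K t : ℝ}

theorem one_add_mul_pos (hs : ∀ x, |s x| ≤ 2 * K) (ht : |t| * (4 * K) ≤ 1) (x : α) :
    0 < 1 + t * s x := by
  have := (abs_le.1 (abs_mul_le_half ht (hs x))).1
  linarith

theorem isProbabilityMeasure_tilt (hs : ∀ x, |s x| ≤ 2 * K) (ht : |t| * (4 * K) ≤ 1)
    (h0 : ∫ x, s x ∂ν = 0) : IsProbabilityMeasure (tilt ν s t) := by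
  have hi : Integrable s ν := Integrable.of_bound (aestronglyMeasurable_discrete _) (2 * K) (ae_of_all _ hs)
  have hj : Integrable (fun x => 1 + t * s x) ν := (integrable_const 1).add (hi.const_mul t)
  refine ⟨?_⟩
  rw [tilt, withDensity_apply _ MeasurableSet.univ, setLIntegral_univ,
    ← ofReal_integral_eq_lintegral_ofReal hj
      (ae_of_all _ fun x => (one_add_mul_pos hs ht x).le),
    integral_add (integrable_const 1) (hi.const_mul t), integral_const_mul, h0]
  simp

omit [IsProbabilityMeasure ν] in
theorem tilt_real [IsFiniteMeasure ν] (hs : ∀ x, |s x| ≤ 2 * K) (ht : |t| * (4 * K) ≤ 1) (x : α) :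
    (tilt ν s t).real {x} = ν.real {x} * (1 + t * s x) := by
  rw [Measure.real, tilt, withDensity_apply _ MeasurableSet.of_discrete, lintegral_singleton,
    ENNReal.toReal_mul, ENNReal.toReal_ofReal (one_add_mul_pos hs ht x).le, mul_comm]
  rfl

theorem abs_log_one_add_le {v : ℝ} (hv : |v| ≤ 1 / 2) : |Real.log (1 + v)| ≤ 2 * |v| := by
  have h1 := (abs_le.1 hv).1
  have hp : 0 < 1 + v := by linarith
  have h2 := Real.log_le_sub_one_of_pos hp
  have h3 := Real.one_sub_inv_le_log_of_pos hp
  have h4 : -(2 * |v|) ≤ 1 - (1 + v)⁻¹ := by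
    have e : 1 - (1 + v)⁻¹ = v / (1 + v) := by field_simp; ring
    rw [e, le_div_iff₀ hp]
    rcases abs_cases v with ⟨h, _⟩ | ⟨h, _⟩ <;> rw [h] <;> nlinarith
  rw [abs_le]
  exact ⟨h4.trans h3, by linarith [le_abs_self v, abs_nonneg v]⟩

theorem hasDerivAt_log_one_add_mul (v : ℝ) : HasDerivAt (fun t => Real.log (1 + t * v)) v 0 := by
  have h : HasDerivAt (fun t : ℝ => 1 + t * v) v 0 := by
    simpa using ((hasDerivAt_id (0 : ℝ)).mul_const v).const_add 1
  simpa using h.log (by simp)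

end Tilt

/-! ### Bounded elements of the factor tangent space are scores. -/

section ScoresOfBounded

variable {𝒞 𝒜 𝒵 : Type*} {𝒴 : Set ℝ}
  [Countable 𝒞] [Countable 𝒜] [Countable 𝒵] [Countable 𝒴]
  [MeasurableSpace 𝒞] [MeasurableSpace 𝒜] [MeasurableSpace 𝒵]
  [DiscreteMeasurableSpace 𝒞] [DiscreteMeasurableSpace 𝒜] [DiscreteMeasurableSpace 𝒵]
  {Q₀ : Measure (FullData 𝒞 𝒜 𝒵 𝒴)}

theorem obs_factorization {P : Measure (Obs 𝒞 𝒜 𝒵 𝒴)} [IsProbabilityMeasure P]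
    (hpos : ∀ x, 0 < P.real {x})
    (hind : CondIndepDiscrete P outV trt (fun x => (med x, cov x))) (x : Obs 𝒞 𝒜 𝒵 𝒴) :
    P.real {x} = (P.map fun x => (cov x, trt x)).real {(cov x, trt x)} *
      (((ProbabilityTheory.cond P {y | trtCov y = (trt x, cov x)}).map med).real {med x} *
        ((ProbabilityTheory.cond P {y | medCov y = (med x, cov x)}).map outV).real {outV x}) := by
  rw [map_measureReal_apply Measurable.of_discrete MeasurableSet.of_discrete,
    map_measureReal_apply Measurable.of_discrete MeasurableSet.of_discrete,
    map_measureReal_apply Measurable.of_discrete MeasurableSet.of_discrete, cond_real, cond_real]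
  have e1 : (fun x : Obs 𝒞 𝒜 𝒵 𝒴 => (cov x, trt x)) ⁻¹' {(cov x, trt x)}
      = {y | trtCov y = (trt x, cov x)} := by
    ext y; simp [trtCov, and_comm]
  have e2 : {y : Obs 𝒞 𝒜 𝒵 𝒴 | trtCov y = (trt x, cov x)} ∩ med ⁻¹' {med x}
      = {y | trtMedCov y = trtMedCov x} := by
    ext y; simp [trtCov, trtMedCov]; tauto
  have e3 : {y : Obs 𝒞 𝒜 𝒵 𝒴 | medCov y = (med x, cov x)} ∩ outV ⁻¹' {outV x}
      = {y | outMedCov y = outMedCov x} := by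
    ext y; simp [medCov, outMedCov]; tauto
  rw [e1, e2, e3]
  have p1 := fiber_pos hpos trtCov x
  have p2 := fiber_pos hpos trtMedCov x
  have p3 := fiber_pos hpos outMedCov x
  have p4 := fiber_pos hpos medCov x
  have key := congrArg Real.exp (log_sub_log_trtMedCov hpos hind x)
  rw [exp_log_sub_log (hpos x) p2, exp_log_sub_log p3 p4, div_eq_iff p2.ne'] at key
  change _ = P.real {y | trtCov y = trtCov x} * (_ / P.real {y | trtCov y = trtCov x} *
    (_ / P.real {y | medCov y = medCov x}))
  rw [key]
  field_simp

/-- Bounded elements of the factor tangent space are scores of regular submodels. -/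
theorem mem_scores_of_bounded (hQ₀ : Q₀ ∈ backDoorTwoDoorModel 𝒞 𝒜 𝒵 𝒴)
    {f u₁ u₂ u₃ u₄ : Obs 𝒞 𝒜 𝒵 𝒴 → ℝ}
    (h : FactorDecomposition (obsLaw Q₀) f u₁ u₂ u₃ u₄) {K : ℝ}
    (b₁ : ∀ x, |u₁ x| ≤ K) (b₂ : ∀ x, |u₂ x| ≤ K) (b₃ : ∀ x, |u₃ x| ≤ K) (b₄ : ∀ x, |u₄ x| ≤ K) :
    f ∈ scores (backDoorTwoDoorModel 𝒞 𝒜 𝒵 𝒴) Q₀ := by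
  have hpos := obsLaw_pos hQ₀
  have hprob := isProbabilityMeasure_obsLaw hQ₀
  have hind := condIndep_outcome_treatment hQ₀
  set P := obsLaw Q₀ with hP
  obtain ⟨⟨c₀, a₀, z₀, y₀⟩⟩ := nonempty_of_isProbabilityMeasure P
  have hK : 0 ≤ K := (abs_nonneg _).trans (b₁ (c₀, a₀, z₀, y₀))
  let μ : Measure (𝒞 × 𝒜) := P.map fun x => (cov x, trt x)
  let ν : 𝒜 × 𝒞 → Measure 𝒵 := fun i =>
    (ProbabilityTheory.cond P {y | trtCov y = i}).map med
  let ρ : 𝒵 × 𝒞 → Measure 𝒴 := fun i =>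
    (ProbabilityTheory.cond P {y | medCov y = i}).map outV
  -- The factors p(c) and p(a|c) are tilted jointly, as the law of (C,A).
  let s : 𝒞 × 𝒜 → ℝ := fun r => u₁ (r.1, r.2, z₀, y₀) + u₂ (r.1, r.2, z₀, y₀)
  let s₃ : 𝒜 × 𝒞 → 𝒵 → ℝ := fun i z => u₃ (i.2, i.1, z, y₀)
  let s₄ : 𝒵 × 𝒞 → 𝒴 → ℝ := fun i y => u₄ (i.2, a₀, i.1, y)
  have es : ∀ x, s (cov x, trt x) = u₁ x + u₂ x := fun x =>
    congrArg₂ (· + ·) (h.factors₁ rfl) (h.factors₂ rfl)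
  have es₃ : ∀ x, s₃ (trt x, cov x) (med x) = u₃ x := fun x => h.factors₃ rfl
  have es₄ : ∀ x, s₄ (med x, cov x) (outV x) = u₄ x := fun x => h.factors₄ rfl
  have bs : ∀ r, |s r| ≤ 2 * K := fun r => by
    have h1 := b₁ (r.1, r.2, z₀, y₀)
    have h2 := b₂ (r.1, r.2, z₀, y₀)
    exact (abs_add_le _ _).trans (by linarith)
  have bs₃ : ∀ i z, |s₃ i z| ≤ 2 * K := fun i z => (b₃ _).trans (by linarith)
  have bs₄ : ∀ i y, |s₄ i y| ≤ 2 * K := fun i y => (b₄ _).trans (by linarith)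
  have pμ : IsProbabilityMeasure μ :=
    Measure.isProbabilityMeasure_map Measurable.of_discrete.aemeasurable
  have pν : ∀ i, IsProbabilityMeasure (ν i) := fun i => by
    have : IsProbabilityMeasure (ProbabilityTheory.cond P {y | trtCov y = i}) :=
      isProbabilityMeasure_cond_of_pos (fiber_pos hpos trtCov (i.2, i.1, z₀, y₀))
    exact Measure.isProbabilityMeasure_map Measurable.of_discrete.aemeasurable
  have pρ : ∀ i, IsProbabilityMeasure (ρ i) := fun i => by
    have : IsProbabilityMeasure (ProbabilityTheory.cond P {y | medCov y = i}) :=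
      isProbabilityMeasure_cond_of_pos (fiber_pos hpos medCov (i.2, a₀, i.1, y₀))
    exact Measure.isProbabilityMeasure_map Measurable.of_discrete.aemeasurable
  have is : ∫ r, s r ∂μ = 0 := by
    rw [integral_map Measurable.of_discrete.aemeasurable (aestronglyMeasurable_discrete _)]
    simp_rw [es]
    have i1 : Integrable u₁ P := h.memLp₁.integrable (by norm_num)
    have i2 : Integrable u₂ P := h.memLp₂.integrable (by norm_num)
    rw [integral_add i1 i2, h.mean₁, ← integral_fiberMean hpos cov i2]
    simp [h.mean₂]
  have is₃ : ∀ i, ∫ z, s₃ i z ∂(ν i) = 0 := by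
    rintro ⟨b, c⟩
    rw [integral_map Measurable.of_discrete.aemeasurable (aestronglyMeasurable_discrete _),
      ← h.mean₃ (c, b, z₀, y₀)]
    refine fiberMean_congr (V := trtCov) (v := (b, c)) fun x hx => h.factors₃ ?_
    simp only [trtCov, Prod.mk.injEq] at hx
    exact Prod.ext hx.1.symm (Prod.ext rfl hx.2.symm)
  have is₄ : ∀ i, ∫ y, s₄ i y ∂(ρ i) = 0 := by
    rintro ⟨z, c⟩
    rw [integral_map Measurable.of_discrete.aemeasurable (aestronglyMeasurable_discrete _),
      ← h.mean₄ (c, a₀, z, y₀)]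
    refine fiberMean_congr (V := medCov) (v := (z, c)) fun x hx => h.factors₄ ?_
    simp only [medCov, Prod.mk.injEq] at hx
    exact Prod.ext rfl (Prod.ext hx.1.symm hx.2.symm)
  have hfac : ∀ x, P.real {x} = μ.real {(cov x, trt x)} *
      ((ν (trt x, cov x)).real {med x} * (ρ (med x, cov x)).real {outV x}) :=
    obs_factorization hpos hind
  have hne : ∀ x : Obs 𝒞 𝒜 𝒵 𝒴, μ.real {(cov x, trt x)} *
      ((ν (trt x, cov x)).real {med x} * (ρ (med x, cov x)).real {outV x}) ≠ 0 := fun x =>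
    hfac x ▸ (hpos x).ne'
  have posμ : ∀ r, 0 < μ.real {r} := fun r => measureReal_nonneg.lt_of_ne'
    (left_ne_zero_of_mul (hne (r.1, r.2, z₀, y₀)))
  have posν : ∀ i z, 0 < (ν i).real {z} := fun i z => measureReal_nonneg.lt_of_ne'
    (left_ne_zero_of_mul (right_ne_zero_of_mul (hne (i.2, i.1, z, y₀))))
  have posρ : ∀ i y, 0 < (ρ i).real {y} := fun i y => measureReal_nonneg.lt_of_ne'
    (right_ne_zero_of_mul (right_ne_zero_of_mul (hne (i.2, a₀, i.1, y))))
  -- The canonical law at t = 0 has the observed law of `Q₀` but may be a different full-data law,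
  -- so the path is set to `Q₀` there. Regularity concerns only the observed law and does not see
  -- the jump.
  let Q : ℝ → Measure (FullData 𝒞 𝒜 𝒵 𝒴) := fun t =>
    if t = 0 then Q₀ else canonicalLaw (tilt μ s t) (fun i => tilt (ν i) (s₃ i) t)
      (fun i => tilt (ρ i) (s₄ i) t)
  have hsmall : ∀ᶠ t in 𝓝 (0 : ℝ), |t| * (4 * K) ≤ 1 := by
    have : Tendsto (fun t : ℝ => |t| * (4 * K)) (𝓝 0) (𝓝 (|0| * (4 * K))) :=
      (continuous_abs.mul continuous_const).tendsto 0
    rw [abs_zero, zero_mul] at this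
    filter_upwards [this.eventually (gt_mem_nhds one_pos)] with t ht using ht.le
  have hQ0 : Q 0 = Q₀ := if_pos rfl
  have hQmem : ∀ t, |t| * (4 * K) ≤ 1 → Q t ∈ backDoorTwoDoorModel 𝒞 𝒜 𝒵 𝒴 := by
    intro t ht
    by_cases h0 : t = 0
    · rw [h0, hQ0]; exact hQ₀
    have := isProbabilityMeasure_tilt bs ht is
    have := fun i => isProbabilityMeasure_tilt (bs₃ i) ht (is₃ i)
    have := fun i => isProbabilityMeasure_tilt (bs₄ i) ht (is₄ i)
    simp only [Q, if_neg h0]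
    refine canonicalLaw_mem _ _ _ (fun r => ?_) (fun i z => ?_) (fun i y => ?_)
    · rw [tilt_real bs ht]; exact mul_pos (posμ r) (one_add_mul_pos bs ht r)
    · rw [tilt_real (bs₃ i) ht]; exact mul_pos (posν i z) (one_add_mul_pos (bs₃ i) ht z)
    · rw [tilt_real (bs₄ i) ht]; exact mul_pos (posρ i y) (one_add_mul_pos (bs₄ i) ht y)
  have hlik : ∀ t, |t| * (4 * K) ≤ 1 → ∀ x, (obsLaw (Q t)).real {x} =
      P.real {x} * ((1 + t * (u₁ x + u₂ x)) * ((1 + t * u₃ x) * (1 + t * u₄ x))) := by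
    intro t ht x
    by_cases h0 : t = 0
    · rw [h0, hQ0]; simp [hP]
    have := isProbabilityMeasure_tilt bs ht is
    have := fun i => isProbabilityMeasure_tilt (bs₃ i) ht (is₃ i)
    have := fun i => isProbabilityMeasure_tilt (bs₄ i) ht (is₄ i)
    simp only [Q, if_neg h0]
    rw [obsLaw_canonicalLaw_real, tilt_real bs ht, tilt_real (bs₃ _) ht, tilt_real (bs₄ _) ht,
      es, es₃, es₄, hfac]
    ring
  have hlog : ∀ t, |t| * (4 * K) ≤ 1 → ∀ x, Real.log ((obsLaw (Q t)).real {x}) =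
      Real.log (1 + t * (u₁ x + u₂ x)) + (Real.log (1 + t * u₃ x) + Real.log (1 + t * u₄ x))
        + Real.log (P.real {x}) := by
    intro t ht x
    have p1 : 0 < 1 + t * (u₁ x + u₂ x) := es x ▸ one_add_mul_pos bs ht (cov x, trt x)
    have p3 : 0 < 1 + t * u₃ x := es₃ x ▸ one_add_mul_pos (bs₃ _) ht (med x)
    have p4 : 0 < 1 + t * u₄ x := es₄ x ▸ one_add_mul_pos (bs₄ _) ht (outV x)
    rw [hlik t ht, Real.log_mul (hpos x).ne' (mul_pos p1 (mul_pos p3 p4)).ne',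
      Real.log_mul p1.ne' (mul_pos p3 p4).ne', Real.log_mul p3.ne' p4.ne']
    ring
  -- The three tilts are bounded by 2K, K and K, and |log(1+v)| ≤ 2|v| for |v| ≤ 1/2, so the
  -- constant is 2(2K + K + K).
  refine ⟨Q, hQ0, ?_, fun x => ?_, 8 * K, ?_⟩
  · filter_upwards [hsmall] with t ht using hQmem t ht
  · have hd := ((hasDerivAt_log_one_add_mul (u₁ x + u₂ x)).add
      ((hasDerivAt_log_one_add_mul (u₃ x)).add (hasDerivAt_log_one_add_mul (u₄ x)))).add_const
        (Real.log (P.real {x}))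
    rw [show u₁ x + u₂ x + (u₃ x + u₄ x) = f x by rw [h.sum]; ring] at hd
    refine hd.congr_of_eventuallyEq ?_
    filter_upwards [hsmall] with t ht using hlog t ht x
  · filter_upwards [hsmall] with t ht x
    rw [hQ0, hlog t ht, add_sub_cancel_right]
    have k1 := abs_log_one_add_le (abs_mul_le_half ht (es x ▸ bs (cov x, trt x)))
    have k3 := abs_log_one_add_le (abs_mul_le_half ht (es₃ x ▸ bs₃ (trt x, cov x) (med x)))
    have k4 := abs_log_one_add_le (abs_mul_le_half ht (es₄ x ▸ bs₄ (med x, cov x) (outV x)))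
    rw [abs_mul] at k1 k3 k4
    have j1 := mul_le_mul_of_nonneg_left (es x ▸ bs (cov x, trt x)) (abs_nonneg t)
    have j3 := mul_le_mul_of_nonneg_left (b₃ x) (abs_nonneg t)
    have j4 := mul_le_mul_of_nonneg_left (b₄ x) (abs_nonneg t)
    refine (abs_add_le _ _).trans ((add_le_add_right (abs_add_le _ _) _).trans ?_)
    linarith

end ScoresOfBounded

/-! ### Density of the scores in the factor tangent space. -/

section TangentSpace

variable {𝒞 𝒜 𝒵 : Type*} {𝒴 : Set ℝ}
  [Countable 𝒞] [Countable 𝒜] [Countable 𝒵] [Countable 𝒴]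
  [MeasurableSpace 𝒞] [MeasurableSpace 𝒜] [MeasurableSpace 𝒵]
  [DiscreteMeasurableSpace 𝒞] [DiscreteMeasurableSpace 𝒜] [DiscreteMeasurableSpace 𝒵]
  {Q₀ : Measure (FullData 𝒞 𝒜 𝒵 𝒴)}

theorem factorsThrough_trunc_sub {X γ δ : Type*} {V : X → γ} {W : X → δ} {u : X → ℝ} (n : ℝ)
    (h : γ → ℝ) (hu : u.FactorsThrough W) (hVW : ∀ x y, W x = W y → V x = V y) :
    (fun x => (if |u x| ≤ n then u x else 0) - h (V x)).FactorsThrough W := fun x y hxy => by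
  simp only [hu hxy, hVW x y hxy]

/-- Elements of the factor tangent space are mean-square limits of scores. -/
theorem exists_score_approx (hQ₀ : Q₀ ∈ backDoorTwoDoorModel 𝒞 𝒜 𝒵 𝒴) {f : Obs 𝒞 𝒜 𝒵 𝒴 → ℝ}
    (hf : f ∈ factorTangentSpace (obsLaw Q₀)) {ε : ℝ} (hε : 0 < ε) :
    ∃ s ∈ scores (backDoorTwoDoorModel 𝒞 𝒜 𝒵 𝒴) Q₀,
      ∫ x, (f x - s x) ^ 2 ∂(obsLaw Q₀) < ε := by
  have hpos := obsLaw_pos hQ₀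
  have hprob := isProbabilityMeasure_obsLaw hQ₀
  set P := obsLaw Q₀
  obtain ⟨u₁, u₂, u₃, u₄, h⟩ := exists_factorDecomposition hf
  -- Conditioning on a trivial variable lets the first component be approximated by the same lemma
  -- as the other three.
  have e₁ : ∀ u : Obs 𝒞 𝒜 𝒵 𝒴 → ℝ, fiberMean P (fun _ => ()) u () = ∫ x, u x ∂P := by
    intro u
    have : {x : Obs 𝒞 𝒜 𝒵 𝒴 | () = ()} = Set.univ := by ext; simp
    rw [fiberMean_eq, this]; simp
  -- The square of a sum of four errors is at most 4 times the sum of their squares, and 4 · 4 ·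
  -- ε/16 = ε.
  have hε' : 0 < ε / 16 := by positivity
  obtain ⟨n₁, h₁, p₁, b₁, m₁, l₁⟩ := exists_bounded_approx hpos (fun _ => ()) h.memLp₁
    (fun x => (e₁ _).trans h.mean₁) hε'
  obtain ⟨n₂, h₂, p₂, b₂, m₂, l₂⟩ := exists_bounded_approx hpos cov h.memLp₂ h.mean₂ hε'
  obtain ⟨n₃, h₃, p₃, b₃, m₃, l₃⟩ := exists_bounded_approx hpos trtCov h.memLp₃ h.mean₃ hε'
  obtain ⟨n₄, h₄, p₄, b₄, m₄, l₄⟩ := exists_bounded_approx hpos medCov h.memLp₄ h.mean₄ hε'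
  set v₁ : Obs 𝒞 𝒜 𝒵 𝒴 → ℝ := fun x => (if |u₁ x| ≤ n₁ then u₁ x else 0) - h₁ ()
  set v₂ : Obs 𝒞 𝒜 𝒵 𝒴 → ℝ := fun x => (if |u₂ x| ≤ n₂ then u₂ x else 0) - h₂ (cov x)
  set v₃ : Obs 𝒞 𝒜 𝒵 𝒴 → ℝ := fun x => (if |u₃ x| ≤ n₃ then u₃ x else 0) - h₃ (trtCov x)
  set v₄ : Obs 𝒞 𝒜 𝒵 𝒴 → ℝ := fun x => (if |u₄ x| ≤ n₄ then u₄ x else 0) - h₄ (medCov x)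
  obtain ⟨x₀⟩ := nonempty_of_isProbabilityMeasure P
  have hd : FactorDecomposition P (fun x => v₁ x + v₂ x + v₃ x + v₄ x) v₁ v₂ v₃ v₄ :=
    ⟨fun _ => rfl,
      factorsThrough_trunc_sub (V := fun _ => ()) n₁ h₁ h.factors₁ fun _ _ _ => rfl,
      factorsThrough_trunc_sub n₂ h₂ h.factors₂ fun _ _ hxy => (Prod.ext_iff.1 hxy).2,
      factorsThrough_trunc_sub n₃ h₃ h.factors₃ fun _ _ hxy =>
        Prod.ext (Prod.ext_iff.1 hxy).1 (Prod.ext_iff.1 (Prod.ext_iff.1 hxy).2).2,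
      factorsThrough_trunc_sub n₄ h₄ h.factors₄ fun _ _ hxy => (Prod.ext_iff.1 hxy).2,
      memLp_of_bdd b₁, memLp_of_bdd b₂, memLp_of_bdd b₃, memLp_of_bdd b₄,
      (e₁ _).symm.trans (m₁ x₀), m₂, m₃, m₄⟩
  refine ⟨fun x => v₁ x + v₂ x + v₃ x + v₄ x, mem_scores_of_bounded hQ₀ hd
    (K := 2 * (n₁ + n₂ + n₃ + n₄)) (fun x => (b₁ x).trans (by linarith))
    (fun x => (b₂ x).trans (by linarith)) (fun x => (b₃ x).trans (by linarith))
    (fun x => (b₄ x).trans (by linarith)), ?_⟩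
  have i₁ := (h.memLp₁.sub hd.memLp₁).integrable_sq
  have i₂ := (h.memLp₂.sub hd.memLp₂).integrable_sq
  have i₃ := (h.memLp₃.sub hd.memLp₃).integrable_sq
  have i₄ := (h.memLp₄.sub hd.memLp₄).integrable_sq
  simp only [Pi.sub_apply] at i₁ i₂ i₃ i₄
  have j₂ : Integrable (fun x => (u₁ x - v₁ x) ^ 2 + (u₂ x - v₂ x) ^ 2) P := i₁.add i₂
  have j₃ : Integrable (fun x => (u₁ x - v₁ x) ^ 2 + (u₂ x - v₂ x) ^ 2 + (u₃ x - v₃ x) ^ 2) P :=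
    j₂.add i₃
  have j₄ : Integrable (fun x => (u₁ x - v₁ x) ^ 2 + (u₂ x - v₂ x) ^ 2 + (u₃ x - v₃ x) ^ 2
      + (u₄ x - v₄ x) ^ 2) P := j₃.add i₄
  have hle : ∫ x, (f x - (v₁ x + v₂ x + v₃ x + v₄ x)) ^ 2 ∂P ≤ ∫ x, 4 * ((u₁ x - v₁ x) ^ 2
      + (u₂ x - v₂ x) ^ 2 + (u₃ x - v₃ x) ^ 2 + (u₄ x - v₄ x) ^ 2) ∂P := by
    refine integral_mono_of_nonneg (ae_of_all _ fun _ => sq_nonneg _) (j₄.const_mul 4)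
      (ae_of_all _ fun x => ?_)
    simp only [h.sum]
    nlinarith [sq_nonneg ((u₁ x - v₁ x) - (u₂ x - v₂ x)), sq_nonneg ((u₁ x - v₁ x) - (u₃ x - v₃ x)),
      sq_nonneg ((u₁ x - v₁ x) - (u₄ x - v₄ x)), sq_nonneg ((u₂ x - v₂ x) - (u₃ x - v₃ x)),
      sq_nonneg ((u₂ x - v₂ x) - (u₄ x - v₄ x)), sq_nonneg ((u₃ x - v₃ x) - (u₄ x - v₄ x))]
  rw [integral_const_mul, integral_add j₃ i₄, integral_add j₂ i₃, integral_add i₁ i₂] at hle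
  linarith

/-- The tangent space of the model is the tangent space of the factorization. -/
theorem tangentSpace_eq (hQ₀ : Q₀ ∈ backDoorTwoDoorModel 𝒞 𝒜 𝒵 𝒴) :
    tangentSpace (backDoorTwoDoorModel 𝒞 𝒜 𝒵 𝒴) Q₀ = factorTangentSpace (obsLaw Q₀) := by
  have hpos := obsLaw_pos hQ₀
  have hprob := isProbabilityMeasure_obsLaw hQ₀
  have hind := condIndep_outcome_treatment hQ₀
  ext f
  constructor
  · rintro ⟨hf, happrox⟩
    refine mem_factorTangentSpace_of_approx hpos hind hf fun ε hε => ?_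
    obtain ⟨s, hs, hlt⟩ := happrox ε hε
    have hle : Submodule.span ℝ (scores (backDoorTwoDoorModel 𝒞 𝒜 𝒵 𝒴) Q₀) ≤
        factorSubmodule hpos hind :=
      Submodule.span_le.2 fun S ⟨Q, hQ⟩ => score_mem_factorTangentSpace hQ₀ hQ
    exact ⟨s, hle hs, hlt⟩
  · intro hf
    refine ⟨((mem_factorTangentSpace_iff hpos hind).1 hf).1, fun ε hε => ?_⟩
    obtain ⟨s, hs, hlt⟩ := exists_score_approx hQ₀ hf hε
    exact ⟨s, Submodule.subset_span hs, hlt⟩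

end TangentSpace

/-! ### Mean squares of the weighted residuals, summed over cells. -/

section Variance

variable {𝒞 𝒜 𝒵 : Type*} {𝒴 : Set ℝ}
  [Countable 𝒞] [Countable 𝒜] [Countable 𝒵] [Countable 𝒴]
  [MeasurableSpace 𝒞] [MeasurableSpace 𝒜] [MeasurableSpace 𝒵]
  [DiscreteMeasurableSpace 𝒞] [DiscreteMeasurableSpace 𝒜] [DiscreteMeasurableSpace 𝒵]
  {P : Measure (Obs 𝒞 𝒜 𝒵 𝒴)} [IsProbabilityMeasure P] {aStar a : 𝒜}
  (hpos : ∀ x, 0 < P.real {x})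
  (hind : CondIndepDiscrete P outV trt (fun x => (med x, cov x)))
include hpos

omit hpos in
theorem fiberMean_medCov_residual_sq (z : 𝒵) (c : 𝒞) :
    fiberMean P medCov (fun x => outcomeResidual P x ^ 2) (z, c) = varZC P z c := by
  rw [varZC, variance_eq_integral Measurable.of_discrete.aemeasurable, ← medCov_fiber]
  refine fiberMean_congr fun x hx => ?_
  simp only [medCov, Prod.mk.injEq] at hx
  rw [outcomeResidual, hx.1, hx.2, meanZC, medCov_fiber]

/-- On a cell of (Z,C) the weight is the constant Δ/q, where Δ = p(z|a*,c) - p(z|a,c), and the cell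
has mass q p(c). One factor q cancels. -/
theorem hasSum_integral_sq_BDTD
    (h : MemLp (fun x => outcomeResidual P x * weightBDTD P aStar a x) 2 P) :
    HasSum (fun i : 𝒵 × 𝒞 => (pZ P i.1 aStar i.2 - pZ P i.1 a i.2) ^ 2 * pC P i.2 *
        varZC P i.1 i.2 * (1 / ∑' b, pZ P i.1 b i.2 * pA P b i.2))
      (∫ x, (outcomeResidual P x * weightBDTD P aStar a x) ^ 2 ∂P) := by
  obtain ⟨x₀⟩ := nonempty_of_isProbabilityMeasure P
  convert hasSum_fiberMean medCov h.integrable_sq using 2 with i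
  obtain ⟨z, c⟩ := i
  simp_rw [mul_pow]
  rw [fiberMean_mul_of (k := weightBDTD P aStar a (c, trt x₀, z, outV x₀) ^ 2),
    fiberMean_medCov_residual_sq, medCov_fiber, weightBDTD]
  · have hq := tsum_pZ_mul_pA_pos hpos z c
    have e : P.real {x | med x = z ∧ cov x = c} = (∑' b, pZ P z b c * pA P b c) * pC P c := by
      rw [(hasSum_pZ_mul_pA hpos z c).tsum_eq, pC, div_mul_cancel₀ _ (covariate_pos hpos c).ne']
    simp only [med, cov] at e ⊢
    rw [e]
    field_simp
  · intro y hy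
    rw [weightBDTD_factorsThrough_medCov (show medCov y = medCov (c, trt x₀, z, outV x₀) from hy)]

include hind

/-- Cells of (A,Z,C) are needed here. Each has mass p(z|b,c)p(b|c)p(c) and weight Δ/p(z|b,c), and
the mean of R² on it is var(Y|z,c), free of b. -/
theorem hasSum_integral_sq_TD
    (h : MemLp (fun x => outcomeResidual P x * weightTD P aStar a x) 2 P) :
    HasSum (fun i : 𝒵 × 𝒞 => (pZ P i.1 aStar i.2 - pZ P i.1 a i.2) ^ 2 * pC P i.2 *
        varZC P i.1 i.2 * ∑' b, pA P b i.2 / pZ P i.1 b i.2)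
      (∫ x, (outcomeResidual P x * weightTD P aStar a x) ^ 2 ∂P) := by
  obtain ⟨x₀⟩ := nonempty_of_isProbabilityMeasure P
  have hs := hasSum_fiberMean trtMedCov h.integrable_sq
  have e : ∀ i : 𝒜 × 𝒵 × 𝒞, P.real {x | trtMedCov x = i} *
      fiberMean P trtMedCov (fun x => (outcomeResidual P x * weightTD P aStar a x) ^ 2) i =
      (pZ P i.2.1 aStar i.2.2 - pZ P i.2.1 a i.2.2) ^ 2 * pC P i.2.2 *
        varZC P i.2.1 i.2.2 * (pA P i.1 i.2.2 / pZ P i.2.1 i.1 i.2.2) := by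
    rintro ⟨b, z, c⟩
    simp_rw [mul_pow]
    have hsq : (fun x => outcomeResidual P x ^ 2).FactorsThrough outMedCov := fun x y hxy => by
      simp only [outcomeResidual_factorsThrough hxy]
    have h1 := fiberMean_trtMedCov_outMedCov hpos hind hsq (c, b, z, outV x₀)
    change fiberMean P trtMedCov _ (b, z, c) = fiberMean P medCov _ (z, c) at h1
    rw [fiberMean_mul_of (k := weightTD P aStar a (c, b, z, outV x₀) ^ 2), h1,
      fiberMean_medCov_residual_sq, trtMedCov_fiber, weightTD]
    · have hz := pZ_pos hpos z b c
      have e : P.real {x | trt x = b ∧ med x = z ∧ cov x = c} = pZ P z b c * pA P b c * pC P c := by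
        rw [pZ_mul_pA hpos, pC, div_mul_cancel₀ _ (covariate_pos hpos c).ne']
      simp only [med, cov, trt] at e hz ⊢
      rw [e]
      field_simp
    · intro y hy
      rw [weightTD_factorsThrough (show trtMedCov y = trtMedCov (c, b, z, outV x₀) from hy)]
  simp_rw [e] at hs
  -- The sum over (b,z,c) is regrouped with b innermost; summability in b for each (z,c) is
  -- inherited from the full sum.
  have hs' := (Equiv.prodComm 𝒜 (𝒵 × 𝒞)).symm.hasSum_iff.2 hs
  have hf := hs'.prod_fiberwise fun i => (hs'.summable.prod_factor i).hasSum
  convert hf using 2 with i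
  simp only [Function.comp_def, Equiv.prodComm_symm, Equiv.prodComm_apply, Prod.swap_prod_mk]
  rw [tsum_mul_left]

theorem varCorrection_eq
    (h : MemLp (fun x => outcomeResidual P x * weightTD P aStar a x) 2 P)
    (h' : MemLp (fun x => outcomeResidual P x * weightBDTD P aStar a x) 2 P) :
    varCorrection P aStar a = ∫ x, (outcomeResidual P x * weightBDTD P aStar a x) ^ 2 ∂P
      - ∫ x, (outcomeResidual P x * weightTD P aStar a x) ^ 2 ∂P := by
  rw [← ((hasSum_integral_sq_BDTD hpos h').sub (hasSum_integral_sq_TD hpos hind h)).tsum_eq,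
    varCorrection]
  congr 1; funext i
  ring

end Variance

/-- Pythagoras for mean squares. -/
theorem integral_sq_eq_add_of_integral_sub_mul {X : Type*} [MeasurableSpace X] {P : Measure X}
    {f g : X → ℝ} (hf : MemLp f 2 P) (hg : MemLp g 2 P) (h : ∫ x, (f x - g x) * g x ∂P = 0) :
    ∫ x, f x ^ 2 ∂P = ∫ x, g x ^ 2 ∂P + ∫ x, (f x - g x) ^ 2 ∂P := by
  have hd : MemLp (fun x => f x - g x) 2 P := hf.sub hg
  have hm : Integrable (fun x => (f x - g x) * g x) P := hd.integrable_mul hg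
  calc ∫ x, f x ^ 2 ∂P
      = ∫ x, (g x ^ 2 + (f x - g x) ^ 2) + 2 * ((f x - g x) * g x) ∂P := by
        congr 1; funext x; ring
    _ = _ := by
      have hgd : Integrable (fun x => g x ^ 2 + (f x - g x) ^ 2) P :=
        hg.integrable_sq.add hd.integrable_sq
      rw [integral_add hgd (hm.const_mul 2),
        integral_add hg.integrable_sq hd.integrable_sq, integral_const_mul, h, mul_zero, add_zero]

theorem integral_mul_eq_of_integral_sub_mul {X : Type*} [MeasurableSpace X] {P : Measure X}
    {f g h : X → ℝ} (hf : Integrable (fun x => f x * h x) P)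
    (hg : Integrable (fun x => g x * h x) P) (h0 : ∫ x, (f x - g x) * h x ∂P = 0) :
    ∫ x, f x * h x ∂P = ∫ x, g x * h x ∂P := by
  simp_rw [sub_mul] at h0
  rwa [integral_sub hf hg, sub_eq_zero] at h0

theorem variance_eq_integral_sq {X : Type*} [MeasurableSpace X] {P : Measure X} {f : X → ℝ}
    (hf : AEMeasurable f P) (h0 : ∫ x, f x ∂P = 0) : variance f P = ∫ x, f x ^ 2 ∂P := by
  rw [variance_eq_integral hf, h0]; simp

/-! ### Projection on the tangent space, the efficiency bound, and influence functions. -/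

section Efficiency

variable {𝒞 𝒜 𝒵 : Type*} {𝒴 : Set ℝ}
  [Countable 𝒞] [Countable 𝒜] [Countable 𝒵] [Countable 𝒴]
  [MeasurableSpace 𝒞] [MeasurableSpace 𝒜] [MeasurableSpace 𝒵]
  [DiscreteMeasurableSpace 𝒞] [DiscreteMeasurableSpace 𝒜] [DiscreteMeasurableSpace 𝒵]

section Projection

variable {P : Measure (Obs 𝒞 𝒜 𝒵 𝒴)} [IsProbabilityMeasure P] {aStar a : 𝒜} {θ : ℝ}
  (hpos : ∀ x, 0 < P.real {x})
  (hind : CondIndepDiscrete P outV trt (fun x => (med x, cov x)))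
  (hGs : Integrable (fun x => out x * (ind aStar x / pA P aStar (cov x))) P)
  (hG : Integrable (fun x => out x * (ind a x / pA P a (cov x))) P)
  {w : Obs 𝒞 𝒜 𝒵 𝒴 → ℝ} (hw : w.FactorsThrough trtMedCov)
  (hw' : ∀ x, fiberMean P outMedCov w (outMedCov x) = weightBDTD P aStar a x)
include hpos hind hGs hG hw hw'

/-- Changing the weight does not change the pairing with the factor tangent space. -/
theorem integral_residual_mul_sub_mul_of_mem
    (hm : MemLp (fun x => outcomeResidual P x * w x) 2 P)
    {h : Obs 𝒞 𝒜 𝒵 𝒴 → ℝ} (hh : h ∈ factorTangentSpace P) :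
    ∫ x, (outcomeResidual P x * w x - outcomeResidual P x * weightBDTD P aStar a x) * h x ∂P
      = 0 := by
  have hm' := memLp_residual_mul_weightBDTD hpos hind hGs hG hw' hm
  obtain ⟨u₁, u₂, u₃, u₄, d⟩ := exists_factorDecomposition hh
  have hu : MemLp (fun x => u₁ x + u₂ x + u₃ x) 2 P := (d.memLp₁.add d.memLp₂).add d.memLp₃
  have hd : MemLp (fun x => outcomeResidual P x * w x
    - outcomeResidual P x * weightBDTD P aStar a x) 2 P := hm.sub hm'
  have := integral_residual_mul_sub_eq_zero hpos hind hGs hG hw hw' (hm.integrable (by norm_num))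
    (hm'.integrable (by norm_num)) (u := fun x => u₁ x + u₂ x + u₃ x) (fun x y hxy => ?_)
    d.factors₄ (hd.integrable_mul hu) (hd.integrable_mul d.memLp₄)
  · simpa only [d.sum] using this
  · have e₁ := trtCov_factorsThrough_trtMedCov (cov_factorsThrough_trtCov d.factors₁) hxy
    have e₂ := trtCov_factorsThrough_trtMedCov d.factors₂ hxy
    simp only [e₁, e₂, d.factors₃ hxy]

/-- Changing the weight does not change the pairing with bounded elements of the factor tangent
space. -/
theorem integral_residual_mul_sub_mul_of_bounded
    (hi : Integrable (fun x => outcomeResidual P x * w x) P)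
    (hi' : Integrable (fun x => outcomeResidual P x * weightBDTD P aStar a x) P)
    {h : Obs 𝒞 𝒜 𝒵 𝒴 → ℝ} (hh : h ∈ factorTangentSpace P) {K : ℝ} (hK : 0 ≤ K)
    (hb : ∀ x, |h x| ≤ K) :
    ∫ x, (outcomeResidual P x * w x - outcomeResidual P x * weightBDTD P aStar a x) * h x ∂P
      = 0 := by
  -- The split h = E(h|A,Z,C) + residual has bounded terms whenever h is bounded, so an integrable
  -- weighted residual suffices.
  have hr := ((mem_factorTangentSpace_iff hpos hind).1 hh).2.2
  have hd : Integrable (fun x => outcomeResidual P x * w x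
    - outcomeResidual P x * weightBDTD P aStar a x) P := hi.sub hi'
  have bu : ∀ x : Obs 𝒞 𝒜 𝒵 𝒴, |fiberMean P trtMedCov h (trtMedCov x)| ≤ K := fun x => abs_fiberMean_le hK hb _
  have bv : ∀ x, |h x - fiberMean P trtMedCov h (trtMedCov x)| ≤ K + K := fun x =>
    (abs_sub _ _).trans (add_le_add (hb x) (bu x))
  have := integral_residual_mul_sub_eq_zero hpos hind hGs hG hw hw' hi hi'
    (u := fun x => fiberMean P trtMedCov h (trtMedCov x)) (fun x y hxy => by simp only [hxy])
    hr (hd.mul_bdd (aestronglyMeasurable_discrete _) (ae_of_all _ bu)) (hd.mul_bdd (aestronglyMeasurable_discrete _) (ae_of_all _ bv))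
  simpa only [add_sub_cancel] using this

theorem integral_sq_residual_mul
    (h1 : MemLp (fun x => outcomeResidual P x * w x) 2 P) :
    ∫ x, (outcomeResidual P x * w x) ^ 2 ∂P
      = ∫ x, (outcomeResidual P x * weightBDTD P aStar a x) ^ 2 ∂P
      + ∫ x, (outcomeResidual P x * w x
        - outcomeResidual P x * weightBDTD P aStar a x) ^ 2 ∂P := by
  have h1' := memLp_residual_mul_weightBDTD hpos hind hGs hG hw' h1
  have hd : MemLp (fun x => outcomeResidual P x * w x
    - outcomeResidual P x * weightBDTD P aStar a x) 2 P := h1.sub h1'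
  refine integral_sq_eq_add_of_integral_sub_mul h1 h1' ?_
  have := integral_residual_mul_sub_eq_zero hpos hind hGs hG hw hw' (h1.integrable (by norm_num))
    (h1'.integrable (by norm_num)) (u := fun _ => 0) (fun _ _ _ => rfl)
    (v := fun x => outcomeResidual P x * weightBDTD P aStar a x) (fun x y hxy => ?_)
    (by simp) (hd.integrable_mul h1')
  · simpa only [zero_add] using this
  · simp only [outcomeResidual_factorsThrough hxy,
      weightBDTD_factorsThrough_medCov (Prod.ext_iff.1 hxy).2]

variable (hθ : θ = ∫ x, out x * weightBD P aStar a x ∂P)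
  (hψ : MemLp (fun x => outcomeResidual P x * w x + mediatorPart P aStar a x
      + (covariatePart P aStar a x - θ)) 2 P)
include hθ hψ

theorem phiBDTD_mem_factorTangentSpace : phiBDTD P aStar a θ ∈ factorTangentSpace P := by
  obtain ⟨h1, h2, h3⟩ := memLp_influence_parts hpos hind hGs hG hw hψ
  exact (factorDecomposition_efficient hpos hind hGs hG hθ
    (memLp_residual_mul_weightBDTD hpos hind hGs hG hw' h1) h2 h3).mem

theorem memLp_phiBDTD : MemLp (phiBDTD P aStar a θ) 2 P :=
  ((mem_factorTangentSpace_iff hpos hind).1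
    (phiBDTD_mem_factorTangentSpace hpos hind hGs hG hw hw' hθ hψ)).1

theorem integral_sub_phiBDTD_mul_of_mem {h : Obs 𝒞 𝒜 𝒵 𝒴 → ℝ} (hh : h ∈ factorTangentSpace P) :
    ∫ x, (outcomeResidual P x * w x + mediatorPart P aStar a x
      + (covariatePart P aStar a x - θ) - phiBDTD P aStar a θ x) * h x ∂P = 0 := by
  rw [← integral_residual_mul_sub_mul_of_mem hpos hind hGs hG hw hw'
    (memLp_influence_parts hpos hind hGs hG hw hψ).1 hh]
  congr 1; funext x
  rw [phiBDTD_eq hpos hind hGs hG]; ring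

/-- Pythagoras for the projection. Applied to the back-door and the two-door weights, it gives both
variance comparisons. -/
theorem integral_sq_influence :
    ∫ x, (outcomeResidual P x * w x + mediatorPart P aStar a x
      + (covariatePart P aStar a x - θ)) ^ 2 ∂P = ∫ x, phiBDTD P aStar a θ x ^ 2 ∂P
      + ∫ x, (outcomeResidual P x * w x
        - outcomeResidual P x * weightBDTD P aStar a x) ^ 2 ∂P := by
  rw [integral_sq_eq_add_of_integral_sub_mul hψ
    (memLp_phiBDTD hpos hind hGs hG hw hw' hθ hψ)
    (integral_sub_phiBDTD_mul_of_mem hpos hind hGs hG hw hw' hθ hψ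
      (phiBDTD_mem_factorTangentSpace hpos hind hGs hG hw hw' hθ hψ))]
  congr 2; funext x
  rw [phiBDTD_eq hpos hind hGs hG]; ring

end Projection

section Bound

variable {Q₀ : Measure (FullData 𝒞 𝒜 𝒵 𝒴)} {ρ : Measure (FullData 𝒞 𝒜 𝒵 𝒴) → ℝ}
  {φ : Obs 𝒞 𝒜 𝒵 𝒴 → ℝ}

/-- The efficiency bound is the second moment of an influence function in the tangent space. -/
theorem efficiencyBound_eq (hQ₀ : Q₀ ∈ backDoorTwoDoorModel 𝒞 𝒜 𝒵 𝒴)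
    (hφ : IsInfluenceFunction (backDoorTwoDoorModel 𝒞 𝒜 𝒵 𝒴) Q₀ ρ φ)
    (hmem : φ ∈ factorTangentSpace (obsLaw Q₀)) :
    efficiencyBound (backDoorTwoDoorModel 𝒞 𝒜 𝒵 𝒴) Q₀ ρ
      = ENNReal.ofReal (∫ x, φ x ^ 2 ∂(obsLaw Q₀)) := by
  have hpos := obsLaw_pos hQ₀
  have hprob := isProbabilityMeasure_obsLaw hQ₀
  have hind := condIndep_outcome_treatment hQ₀
  set P := obsLaw Q₀ with hP
  have hL : ∀ {Q S}, IsRegularSubmodel (backDoorTwoDoorModel 𝒞 𝒜 𝒵 𝒴) Q₀ Q S → MemLp S 2 P :=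
    fun h => ((mem_factorTangentSpace_iff hpos hind).1 (score_mem_factorTangentSpace hQ₀ h)).1
  apply le_antisymm
  · refine sSup_le ?_
    rintro b ⟨Q, S, d, hS, hd, h0, rfl⟩
    refine ENNReal.ofReal_le_ofReal ?_
    rw [div_le_iff₀ h0, hd.unique (hφ.2 Q S hS)]
    exact sq_integral_mul_le hφ.1 (hL hS)
  · set V := ∫ x, φ x ^ 2 ∂P with hV
    rcases (integral_nonneg fun x => sq_nonneg (φ x) : 0 ≤ V).eq_or_lt with h0 | h0
    · rw [show V = 0 from h0.symm, ENNReal.ofReal_zero]; exact zero_le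
    refine ENNReal.le_of_forall_pos_le_add fun δ hδ _ => ?_
    have hδ' : (0 : ℝ) < δ := hδ
    -- The bound δ controls the loss in the Cramér–Rao ratio; the bound V/2 excludes a score with E
    -- s² = 0, whose distance from φ would be V.
    have hε : 0 < min (δ : ℝ) (V / 2) := lt_min hδ' (by positivity)
    obtain ⟨s, ⟨Q, hs⟩, hlt⟩ := exists_score_approx hQ₀ hmem hε
    have hsL := hL hs
    have hdL : MemLp (fun x => φ x - s x) 2 P := hφ.1.sub hsL
    have hm : Integrable (fun x => φ x * s x) P := hφ.1.integrable_mul hsL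
    set I := ∫ x, φ x * s x ∂P with hI
    set W := ∫ x, s x ^ 2 ∂P with hW
    have hexp : ∫ x, (φ x - s x) ^ 2 ∂P = V - 2 * I + W := by
      calc _ = ∫ x, (φ x ^ 2 - 2 * (φ x * s x)) + s x ^ 2 ∂P := by congr 1; funext x; ring
        _ = _ := by
          have h2m : Integrable (fun x => φ x ^ 2 - 2 * (φ x * s x)) P :=
            hφ.1.integrable_sq.sub (hm.const_mul 2)
          rw [integral_add h2m hsL.integrable_sq,
            integral_sub hφ.1.integrable_sq (hm.const_mul 2), integral_const_mul]
    rw [hexp] at hlt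
    have hW0 : 0 ≤ W := integral_nonneg fun x => sq_nonneg (s x)
    have h1 := hlt.trans_le (min_le_left _ _)
    have h2 := hlt.trans_le (min_le_right _ _)
    have hCS : I ^ 2 ≤ V * W := sq_integral_mul_le hφ.1 hsL
    have hWpos : 0 < W := by
      refine hW0.lt_of_ne fun h => ?_
      rw [← h, mul_zero] at hCS
      have : I = 0 := by nlinarith
      rw [this, ← h] at h2
      linarith
    have key : V ≤ I ^ 2 / W + δ := by
      -- From V - 2I + W < δ it follows that (V - δ)W ≤ 2IW - W² ≤ I².
      have : V - δ ≤ I ^ 2 / W := by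
        rw [le_div_iff₀ hWpos]
        nlinarith [sq_nonneg (I - W)]
      linarith
    calc ENNReal.ofReal V ≤ ENNReal.ofReal (I ^ 2 / W + δ) := ENNReal.ofReal_le_ofReal key
      _ = ENNReal.ofReal (I ^ 2 / W) + δ := by
        rw [ENNReal.ofReal_add (by positivity) hδ'.le, ENNReal.ofReal_coe_nnreal]
      _ ≤ _ := by gcongr; exact le_sSup ⟨Q, s, I, hs, hφ.2 Q s hs, hWpos, rfl⟩

end Bound

section InfluenceFunction

variable {Q₀ : Measure (FullData 𝒞 𝒜 𝒵 𝒴)} (hQ₀ : Q₀ ∈ backDoorTwoDoorModel 𝒞 𝒜 𝒵 𝒴)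
include hQ₀

theorem ace_eq {aStar a : 𝒜}
    (hGs : Integrable (fun x => out x * (ind aStar x / pA (obsLaw Q₀) aStar (cov x))) (obsLaw Q₀))
    (hG : Integrable (fun x => out x * (ind a x / pA (obsLaw Q₀) a (cov x))) (obsLaw Q₀)) :
    ace aStar a Q₀ = ∫ x, out x * weightBD (obsLaw Q₀) aStar a x ∂(obsLaw Q₀) := by
  rw [ace, integral_yPot hQ₀, integral_yPot hQ₀, ← integral_sub hGs hG]
  congr 1; funext x
  rw [ind_div_pA, ind_div_pA, weightBD, sub_div, mul_sub]

variable {P : Measure (Obs 𝒞 𝒜 𝒵 𝒴)} (hP : P = obsLaw Q₀) {aStar a : 𝒜} {θ : ℝ}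
  (hGs : Integrable (fun x => out x * (ind aStar x / pA P aStar (cov x))) P)
  (hG : Integrable (fun x => out x * (ind a x / pA P a (cov x))) P)
  {w : Obs 𝒞 𝒜 𝒵 𝒴 → ℝ} (hw : w.FactorsThrough trtMedCov)
  (hw' : ∀ x, fiberMean P outMedCov w (outMedCov x) = weightBDTD P aStar a x)
  (hψ : MemLp (fun x => outcomeResidual P x * w x + mediatorPart P aStar a x
      + (covariatePart P aStar a x - θ)) 2 P)
include hP hGs hG hw hw' hψ

/-- The derivative is known as a pairing with the back-door function, which need not be square
integrable. Against bounded scores, both the back-door weight and w can be replaced by their common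
conditional mean, so the two pairings agree. -/
theorem isInfluenceFunction_influence :
    IsInfluenceFunction (backDoorTwoDoorModel 𝒞 𝒜 𝒵 𝒴) Q₀ (ace aStar a)
      (fun x => outcomeResidual P x * w x + mediatorPart P aStar a x
        + (covariatePart P aStar a x - θ)) := by
  subst hP
  have hpos := obsLaw_pos hQ₀
  have hprob := isProbabilityMeasure_obsLaw hQ₀
  have hind := condIndep_outcome_treatment hQ₀
  refine ⟨hψ, fun Q S h => ?_⟩
  convert hasDerivAt_ace hQ₀ h hGs hG θ using 1
  obtain ⟨K, hK⟩ := exists_isLikelihoodPath h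
  have hS := score_mem_factorTangentSpace hQ₀ h
  obtain ⟨h1, h2, h3⟩ := memLp_influence_parts hpos hind hGs hG hw hψ
  have h1' := memLp_residual_mul_weightBDTD hpos hind hGs hG hw' h1
  have i1 := h1.integrable (by norm_num : (1 : ENNReal) ≤ 2)
  have i2 := h1'.integrable (by norm_num : (1 : ENNReal) ≤ 2)
  have iBD := integrable_residual_mul_weightBD hpos hind hGs hG
  have e1 := integral_residual_mul_sub_mul_of_bounded hpos hind hGs hG hw hw' i1 i2 hS hK.nonneg
    hK.abs_score_le
  have e2 := integral_residual_mul_sub_mul_of_bounded hpos hind hGs hG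
    (trtCov_factorsThrough_trtMedCov weightBD_factorsThrough)
    (fiberMean_outMedCov_weightBD hpos hind) iBD i2 hS hK.nonneg hK.abs_score_le
  have hrest := (h2.add h3).integrable (by norm_num : (1 : ENNReal) ≤ 2)
  have hi : ∀ {v : Obs 𝒞 𝒜 𝒵 𝒴 → ℝ},
      Integrable (fun x => outcomeResidual (obsLaw Q₀) x * v x) (obsLaw Q₀) →
      Integrable (fun x => (outcomeResidual (obsLaw Q₀) x * v x
        + mediatorPart (obsLaw Q₀) aStar a x
        + (covariatePart (obsLaw Q₀) aStar a x - θ)) * S x) (obsLaw Q₀) := fun {v} hv => by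
    refine Integrable.mul_bdd (c := K) ?_ (aestronglyMeasurable_discrete _) (ae_of_all _ hK.abs_score_le)
    refine (hv.add hrest).congr (ae_of_all _ fun x => ?_)
    simp only [Pi.add_apply]; ring
  refine (integral_mul_eq_of_integral_sub_mul (hi i1) (hi i2) ?_).trans
    (integral_mul_eq_of_integral_sub_mul (hi iBD) (hi i2) ?_).symm
  · simpa only [add_sub_add_right_eq_sub] using e1
  · simpa only [add_sub_add_right_eq_sub] using e2

variable (hθ : θ = ∫ x, out x * weightBD P aStar a x ∂P)
include hθ

theorem isInfluenceFunction_phiBDTD :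
    IsInfluenceFunction (backDoorTwoDoorModel 𝒞 𝒜 𝒵 𝒴) Q₀ (ace aStar a)
      (phiBDTD P aStar a θ) := by
  have h := isInfluenceFunction_influence hQ₀ hP hGs hG hw hw' hψ
  subst hP
  have hpos := obsLaw_pos hQ₀
  have hprob := isProbabilityMeasure_obsLaw hQ₀
  have hind := condIndep_outcome_treatment hQ₀
  have hφ := memLp_phiBDTD hpos hind hGs hG hw hw' hθ hψ
  refine ⟨hφ, fun Q S hS => ?_⟩
  convert h.2 Q S hS using 1
  have hSm := score_mem_factorTangentSpace hQ₀ hS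
  have hSL := ((mem_factorTangentSpace_iff hpos hind).1 hSm).1
  exact (integral_mul_eq_of_integral_sub_mul (hψ.integrable_mul hSL) (hφ.integrable_mul hSL)
    (integral_sub_phiBDTD_mul_of_mem hpos hind hGs hG hw hw' hθ hψ hSm)).symm

end InfluenceFunction

end Efficiency

end

end TwoDoor

/-! ### Assembly of the theorem. -/

theorem proposition3
    {𝒞 𝒜 𝒵 : Type*} {𝒴 : Set ℝ}
    [Countable 𝒞] [Countable 𝒜] [Countable 𝒵] [Countable 𝒴]
    [MeasurableSpace 𝒞] [MeasurableSpace 𝒜] [MeasurableSpace 𝒵]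
    [DiscreteMeasurableSpace 𝒞] [DiscreteMeasurableSpace 𝒜] [DiscreteMeasurableSpace 𝒵]
    (aStar a : 𝒜)
    (Q₀ : Measure (FullData 𝒞 𝒜 𝒵 𝒴))
    (hQ₀ : Q₀ ∈ backDoorTwoDoorModel 𝒞 𝒜 𝒵 𝒴)
    (hYstar : Integrable (fun w => (yPot aStar w : ℝ)) Q₀)
    (hY : Integrable (fun w => (yPot a w : ℝ)) Q₀)
    (P : Measure (Obs 𝒞 𝒜 𝒵 𝒴)) (hP : P = obsLaw Q₀)
    (θ : ℝ) (hθ : θ = ace aStar a Q₀)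
    (Λ : Set (Obs 𝒞 𝒜 𝒵 𝒴 → ℝ)) (hΛ : Λ = tangentSpace (backDoorTwoDoorModel 𝒞 𝒜 𝒵 𝒴) Q₀)
    (hφ : MemLp (phiTD P aStar a θ) 2 P) :
    -- the observed outcome and treatment are independent given mediator and covariates
    CondIndepDiscrete P outV trt (fun x => (med x, cov x)) ∧
    -- the efficient influence function
    IsEfficientInfluenceFunction (backDoorTwoDoorModel 𝒞 𝒜 𝒵 𝒴) Q₀ (ace aStar a)
      (phiBDTD P aStar a θ) ∧
    -- it is the projection of the influence function `φ_td` on the tangent space of the factorization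
    Λ = factorTangentSpace P ∧
    IsInfluenceFunction (backDoorTwoDoorModel 𝒞 𝒜 𝒵 𝒴) Q₀ (ace aStar a) (phiTD P aStar a θ) ∧
    IsProjection P Λ (phiTD P aStar a θ) (phiBDTD P aStar a θ) ∧
    -- the semiparametric efficiency bound
    efficiencyBound (backDoorTwoDoorModel 𝒞 𝒜 𝒵 𝒴) Q₀ (ace aStar a) =
      ENNReal.ofReal (variance (phiBDTD P aStar a θ) P) ∧
    variance (phiBDTD P aStar a θ) P = variance (phiTD P aStar a θ) P + varCorrection P aStar a ∧
    varCorrection P aStar a ≤ 0 ∧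
    -- comparison with the two single-assumption variances (in `[0, ∞]`)
    evariance (phiBDTD P aStar a θ) P ≤ evariance (phiTD P aStar a θ) P ∧
    evariance (phiBDTD P aStar a θ) P ≤ evariance (phiBD P aStar a θ) P := by
  have hpos := obsLaw_pos hQ₀
  have hprob := isProbabilityMeasure_obsLaw hQ₀
  have hind := condIndep_outcome_treatment hQ₀
  have hGs := (integrable_yPot_iff hQ₀ aStar).1 hYstar
  have hG := (integrable_yPot_iff hQ₀ a).1 hY
  rw [ace_eq hQ₀ hGs hG] at hθ
  rw [tangentSpace_eq hQ₀] at hΛ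
  simp only [← hP] at hpos hprob hind hGs hG hθ hΛ
  have eTD : phiTD P aStar a θ = fun x => outcomeResidual P x * weightTD P aStar a x
      + mediatorPart P aStar a x + (covariatePart P aStar a x - θ) :=
    funext (phiTD_eq hpos hind hGs hG θ)
  have eBD : phiBD P aStar a θ = fun x => outcomeResidual P x * weightBD P aStar a x
      + mediatorPart P aStar a x + (covariatePart P aStar a x - θ) := funext (phiBD_eq θ)
  have eBDTD : phiBDTD P aStar a θ = fun x => outcomeResidual P x * weightBDTD P aStar a x
      + mediatorPart P aStar a x + (covariatePart P aStar a x - θ) :=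
    funext (phiBDTD_eq hpos hind hGs hG θ)
  have hwBD := fiberMean_outMedCov_weightBD (aStar := aStar) (a := a) hpos hind
  have hwTD := fiberMean_outMedCov_weightTD (aStar := aStar) (a := a) hpos hind
  have ftBD : (weightBD P aStar a).FactorsThrough trtMedCov :=
    trtCov_factorsThrough_trtMedCov weightBD_factorsThrough
  have ftTD : (weightTD P aStar a).FactorsThrough trtMedCov := weightTD_factorsThrough
  have hψ := eTD ▸ hφ
  have hTD := (memLp_influence_parts hpos hind hGs hG ftTD hψ).1
  have hBDTD := memLp_residual_mul_weightBDTD hpos hind hGs hG hwTD hTD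
  have hmem := phiBDTD_mem_factorTangentSpace hpos hind hGs hG ftTD hwTD hθ hψ
  have hL := memLp_phiBDTD hpos hind hGs hG ftTD hwTD hθ hψ
  have hinf := isInfluenceFunction_influence hQ₀ hP hGs hG ftTD hwTD hψ
  have hinf' := isInfluenceFunction_phiBDTD hQ₀ hP hGs hG ftTD hwTD hψ hθ
  have hproj : IsProjection P Λ (phiTD P aStar a θ) (phiBDTD P aStar a θ) := by
    rw [hΛ]
    refine ⟨hφ, hmem, fun h hh => ?_⟩
    rw [eTD]
    exact integral_sub_phiBDTD_mul_of_mem hpos hind hGs hG ftTD hwTD hθ hψ hh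
  have vBDTD : variance (phiBDTD P aStar a θ) P = ∫ x, phiBDTD P aStar a θ x ^ 2 ∂P := by
    refine variance_eq_integral_sq hL.aemeasurable ?_
    rw [eBDTD]
    exact integral_influence hpos hind hGs hG weightBDTD_factorsThrough
      (hBDTD.integrable (by norm_num)) hθ
  have vTD : variance (phiTD P aStar a θ) P = ∫ x, phiTD P aStar a θ x ^ 2 ∂P := by
    refine variance_eq_integral_sq hφ.aemeasurable ?_
    rw [eTD]
    exact integral_influence hpos hind hGs hG ftTD (hTD.integrable (by norm_num)) hθ
  have sqTD := integral_sq_influence hpos hind hGs hG ftTD hwTD hθ hψ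
  have sqRes := integral_sq_residual_mul hpos hind hGs hG ftTD hwTD hTD
  have hcorr := varCorrection_eq hpos hind hTD hBDTD
  have hnonneg : 0 ≤ ∫ x, (outcomeResidual P x * weightTD P aStar a x
      - outcomeResidual P x * weightBDTD P aStar a x) ^ 2 ∂P :=
    integral_nonneg fun x => sq_nonneg _
  have hvar : variance (phiBDTD P aStar a θ) P
      = variance (phiTD P aStar a θ) P + varCorrection P aStar a := by
    rw [vBDTD, vTD, hcorr, sqRes, eTD, sqTD]; ring
  have hcorr0 : varCorrection P aStar a ≤ 0 := by rw [hcorr, sqRes]; linarith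
  refine ⟨hind, ⟨_, eTD ▸ hinf, ?_⟩, hΛ, eTD ▸ hinf, hproj, ?_, hvar, hcorr0, ?_, ?_⟩
  · rw [tangentSpace_eq hQ₀, ← hP, ← hΛ]; exact hproj
  · rw [vBDTD, hP]
    exact efficiencyBound_eq hQ₀ (hP ▸ hinf') (hP ▸ hmem)
  · rw [← hL.ofReal_variance_eq, ← hφ.ofReal_variance_eq]
    exact ENNReal.ofReal_le_ofReal (by linarith)
  -- Square integrability of φ_bd is not assumed; if it fails, the extended variance of φ_bd is ∞.
  · by_cases hBD : MemLp (phiBD P aStar a θ) 2 P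
    · have hψ' := eBD ▸ hBD
      have vBD : variance (phiBD P aStar a θ) P = ∫ x, phiBD P aStar a θ x ^ 2 ∂P := by
        refine variance_eq_integral_sq hBD.aemeasurable ?_
        rw [eBD]
        exact integral_influence hpos hind hGs hG ftBD
          (integrable_residual_mul_weightBD hpos hind hGs hG) hθ
      rw [← hL.ofReal_variance_eq, ← hBD.ofReal_variance_eq, vBDTD, vBD]
      refine ENNReal.ofReal_le_ofReal ?_
      rw [eBD, integral_sq_influence hpos hind hGs hG ftBD hwBD hθ hψ']
      exact le_add_of_nonneg_right (integral_nonneg fun x => sq_nonneg _)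
    · rw [evariance_eq_top (aestronglyMeasurable_discrete _) hBD]
      exact le_top
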